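/- **Model.** Let $\mathcal S\ge 1$ be an integer, $\beta\ge 0$, $h\ge 0$, $D\in\mathbb R$. For $\sigma\in\{0,\pm1,\dots,\pm\mathcal S\}^N$ let $$H_N(\sigma)=\frac{\beta}{\sqrt N}\sum_{i<j}g_{ij}\sigma_i\sigma_j+D\sum_{i=1}^N\sigma_i^2+h\sum_{i=1}^N\sigma_i ,$$ with $g_{ij}$ ($i<j$) i.i.d. standard Gaussian (the Ghatak–Sherrington model). Let $\langle\cdot\rangle$ be the average over independent replicas under the Gibbs measure with weights proportional to $e^{H_N(\sigma)}$, and $\nu(\cdot)=\mathbb E\langle\cdot\rangle$. **Cavity constants.** For reals $p,q$ and $\eta\sim\mathcal N(0,1)$, let $\langle\cdot\rangle_0$ be the average over i.i.d. spins $\epsilon_1,\epsilon_2,\dots\in\{0,\pm1,\dots,\pm\mathcal S\}$, each with law proportional to $$\exp\Big(\epsilon\,\beta\eta\sqrt q+\tfrac{\beta^2}{2}(p-q)\epsilon^2+D\epsilon^2+h\epsilon\Big),$$ and let $\nu_0(\cdot)=\mathbb E_\eta\langle\cdot\rangle_0$. With $\epsilon_{kl}=\epsilon_k\epsilon_l$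 put $$\begin{aligned} &A=\nu_0((\epsilon_1-\epsilon_3)(\epsilon_2-\epsilon_4)\epsilon_{12}),\quad F=\nu_0((\epsilon_{13}-\epsilon_{23})\epsilon_{13}),\quad G=\nu_0((\epsilon_{13}-\epsilon_{23})\epsilon_{14}),\\ &E=\nu_0((\epsilon_1^2-\epsilon_2^2)\epsilon_{13}),\quad \mathsf D=\nu_0((\epsilon_1^2-\epsilon_2^2)\epsilon_1^2),\quad I_3=\nu_0((\epsilon_{12}-q)\epsilon_{34}),\\ &I_5=\nu_0((\epsilon_{12}-q)\epsilon_{33}),\quad K_3=\nu_0((\epsilon_{11}-p)\epsilon_{23}),\quad K_4=\nu_0((\epsilon_{11}-p)\epsilon_{22}),\\ &M_1=1-\beta^2(F-3G),\quad M_2=1-\tfrac{\beta^2}{2}\mathsf D,\quad M_3=1-\beta^2(F-G),\quad M=M_1M_2+\beta^4E^2,\\ &A_2^2=\frac{A}{N(1-\beta^2A)},\quad A_1^2=\frac{GM_2+\frac{\beta^2}{2}E^2}{M}\cdot\frac1{NM_3},\quad B_1^2=\frac{\mathsf DM_1-2\beta^2E^2}{NM},\quad C_1^2=\frac{E}{NM}.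 \end{aligned}$$ **Theorem.** There is $\beta'>0$, depending only on $\mathcal S$, such that for all $0\le\beta<\beta'$, $h\ge0$, $D\in\mathbb R$ the system $p=\nu_0(\epsilon_1^2)$, $q=\nu_0(\epsilon_1\epsilon_2)$ has exactly one solution $(p,q)\in\mathbb{R}^2$; for this solution $M_1,M_2,M_3,M>0$, and the random variables $$T=\frac1N\sum_{i=1}^N\langle\sigma_i\rangle^2-q,\qquad S=\frac1N\sum_{i=1}^N\langle\sigma_i^2\rangle-p$$ satisfy $$\nu(T^2)=A_0^2+O_N(3),\qquad \nu(S^2)=B_0^2+O_N(3),\qquad \nu(ST)=C_0+O_N(3),$$ where $$\begin{aligned} A_0^2&=\tfrac{\beta^2}{M}(\beta^2EK_4+M_2I_5)C_1^2+\tfrac{2\beta^2}{M}\big(\beta^2E(E-K_3)+M_2(2G-I_3)\big)A_1^2\\ &\quad+\tfrac{\beta^2}{M}(\beta^2EK_3+M_2I_3)A_2^2+\tfrac1{MN}(\beta^2EK_3+M_2I_3),\\ B_0^2&=\tfrac{\beta^2}{2M}(M_1K_4-\beta^2EI_5)B_1^2+\tfrac{\beta^2}{M}\big(M_1(E-K_3)-\beta^2E(2G-I_3)\big)C_1^2+\tfrac1{MN}(M_1K_4-\beta^2EI_5),\\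 C_0&=\tfrac{\beta^2}{M}\big(\tfrac12M_2I_5+\tfrac12\beta^2EK_4\big)B_1^2+\tfrac{\beta^2}{M}\big(M_2(2G-I_3)+\beta^2E(E-K_3)\big)C_1^2+\tfrac1{MN}(M_2I_5+\beta^2EK_4). \end{aligned}$$ Here $X=O_N(3)$ means $|X|\le K N^{-3/2}$ for all $N\ge1$, with a constant $K$ that may depend on $\mathcal S,\beta,h,D$ but not on $N$. -/

import Mathlib

open MeasureTheory ProbabilityTheory

noncomputable section

namespace GhatakSherrington

/-- Parameters of the model: largest spin value `S`, inverse temperature `β`, external field `h`,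
crystal field `D`. -/
structure Params where
  S : ℕ
  β : ℝ
  h : ℝ
  D : ℝ

/-- The set of spin values `{0, ±1, …, ±S}`. -/
abbrev Spin (S : ℕ) : Type := ↥(Finset.Icc (-(S : ℤ)) (S : ℤ))

/-- The real value of a spin. -/
def Spin.val {S : ℕ} (s : Spin S) : ℝ := ((s : ℤ) : ℝ)

/-- Configurations of `N` spins. -/
abbrev Config (N S : ℕ) : Type := Fin N → Spin S

/-- The interaction parameters `g_{ij}`, one for each pair of sites `i < j`. -/
abbrev Disorder (N : ℕ) : Type := {e : Fin N × Fin N // e.1 < e.2} → ℝ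

/-- The law of the disorder: i.i.d. standard Gaussians. -/
def disorderLaw (N : ℕ) : Measure (Disorder N) := Measure.pi fun _ => gaussianReal 0 1

section Model

variable (P : Params) {N : ℕ}

/-- The Hamiltonian
`(β / √N) ∑_{i<j} g_{ij} σ_i σ_j + D ∑_i σ_i² + h ∑_i σ_i`. -/
def hamiltonian (g : Disorder N) (σ : Config N P.S) : ℝ :=
  P.β / √(N : ℝ) * ∑ e : {e : Fin N × Fin N // e.1 < e.2},
      g e * (σ e.1.1).val * (σ e.1.2).val
    + P.D * ∑ i, (σ i).val ^ 2 + P.h * ∑ i, (σ i).val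

/-- The partition function. -/
def partitionFunction (g : Disorder N) : ℝ := ∑ σ : Config N P.S, Real.exp (hamiltonian P g σ)

/-- The Gibbs probability of a configuration. -/
def gibbsWeight (g : Disorder N) (σ : Config N P.S) : ℝ :=
  Real.exp (hamiltonian P g σ) / partitionFunction P g

/-- The Gibbs average `⟨f⟩` of a function of `n` replicas. -/
def gibbs {n : ℕ} (g : Disorder N) (f : (Fin n → Config N P.S) → ℝ) : ℝ :=
  ∑ σ : Fin n → Config N P.S, (∏ k, gibbsWeight P g (σ k)) * f σ

/-- `ν(f) = 𝔼⟨f⟩`; the function `f` of `n` replicas may also depend on the disorder. -/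
def nu {n : ℕ} (f : Disorder N → (Fin n → Config N P.S) → ℝ) : ℝ :=
  ∫ g, gibbs P g (f g) ∂(disorderLaw N)

/-- `⟨σ_i⟩`. -/
def siteMean (g : Disorder N) (i : Fin N) : ℝ :=
  gibbs P g fun σ : Fin 1 → Config N P.S => (σ 0 i).val

/-- `⟨σ_i²⟩`. -/
def siteSecondMoment (g : Disorder N) (i : Fin N) : ℝ :=
  gibbs P g fun σ : Fin 1 → Config N P.S => (σ 0 i).val ^ 2

/-- The basis component `T = N⁻¹ ∑_i ⟨σ_i⟩² - q` of the overlaps. -/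
def basisT (q : ℝ) (g : Disorder N) : ℝ :=
  (1 / (N : ℝ)) * ∑ i, siteMean P g i ^ 2 - q

/-- The basis component `S = N⁻¹ ∑_i ⟨σ_i²⟩ - p` of the self-overlaps. -/
def basisS (p : ℝ) (g : Disorder N) : ℝ :=
  (1 / (N : ℝ)) * ∑ i, siteSecondMoment P g i - p

end Model

section Cavity

variable (P : Params) (p q : ℝ)

/-- The Boltzmann weight of the last spin at time `0` of the cavity interpolation, where the last
spin is decoupled from the other spins. -/
def cavityWeight (η : ℝ) (s : Spin P.S) : ℝ :=
  Real.exp (s.val * (P.β * η * √q) + P.β ^ 2 / 2 * (p - q) * s.val ^ 2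
    + P.D * s.val ^ 2 + P.h * s.val)

/-- The average `⟨φ⟩₀` of a function of the last spins `ε_1, …, ε_n` of `n` replicas. -/
def cavityGibbs {n : ℕ} (η : ℝ) (φ : (Fin n → ℝ) → ℝ) : ℝ :=
  ∑ ε : Fin n → Spin P.S,
    (∏ k, cavityWeight P p q η (ε k) / ∑ s, cavityWeight P p q η s) * φ fun k => (ε k).val

/-- `ν₀(φ)` for a function `φ` of the last spins of `n` replicas. -/
def nu0 {n : ℕ} (φ : (Fin n → ℝ) → ℝ) : ℝ :=
  ∫ η, cavityGibbs P p q η φ ∂(gaussianReal 0 1)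

/-- The replica symmetric equations `p = ν₀(ε_1²)`, `q = ν₀(ε_1 ε_2)`. -/
def IsReplicaSymmetric : Prop :=
  p = nu0 P p q (fun ε : Fin 1 → ℝ => ε 0 ^ 2) ∧
  q = nu0 P p q (fun ε : Fin 2 → ℝ => ε 0 * ε 1)

/-! Constants of the last spins. Replicas `1, 2, 3, 4` have indices `0, 1, 2, 3`. -/

def constF : ℝ :=
  nu0 P p q fun ε : Fin 4 → ℝ => (ε 0 * ε 2 - ε 1 * ε 2) * (ε 0 * ε 2)

def constG : ℝ :=
  nu0 P p q fun ε : Fin 4 → ℝ => (ε 0 * ε 2 - ε 1 * ε 2) * (ε 0 * ε 3)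

def constE : ℝ :=
  nu0 P p q fun ε : Fin 4 → ℝ => (ε 0 ^ 2 - ε 1 ^ 2) * (ε 0 * ε 2)

def constD : ℝ :=
  nu0 P p q fun ε : Fin 4 → ℝ => (ε 0 ^ 2 - ε 1 ^ 2) * ε 0 ^ 2

def constA : ℝ :=
  nu0 P p q fun ε : Fin 4 → ℝ => (ε 0 - ε 2) * (ε 1 - ε 3) * (ε 0 * ε 1)

def constI3 : ℝ :=
  nu0 P p q fun ε : Fin 4 → ℝ => (ε 0 * ε 1 - q) * (ε 2 * ε 3)

def constI5 : ℝ :=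
  nu0 P p q fun ε : Fin 4 → ℝ => (ε 0 * ε 1 - q) * (ε 2 * ε 2)

def constK3 : ℝ :=
  nu0 P p q fun ε : Fin 4 → ℝ => (ε 0 * ε 0 - p) * (ε 1 * ε 2)

def constK4 : ℝ :=
  nu0 P p q fun ε : Fin 4 → ℝ => (ε 0 * ε 0 - p) * (ε 1 * ε 1)

def constM1 : ℝ := 1 - P.β ^ 2 * (constF P p q - 3 * constG P p q)

def constM2 : ℝ := 1 - P.β ^ 2 / 2 * constD P p q

def constM3 : ℝ := 1 - P.β ^ 2 * (constF P p q - constG P p q)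

def constM : ℝ := constM1 P p q * constM2 P p q + P.β ^ 4 * constE P p q ^ 2

/-- `A_2²`, the leading term of `ν(T_{12}²)`. -/
def A2sq (N : ℕ) : ℝ := constA P p q / (N * (1 - P.β ^ 2 * constA P p q))

/-- `A_1²`, the leading term of `ν(T_1²)`. -/
def A1sq (N : ℕ) : ℝ :=
  (constG P p q * constM2 P p q + P.β ^ 2 / 2 * constE P p q ^ 2) / constM P p q
    * (1 / (N * constM3 P p q))

/-- `B_1²`, the leading term of `ν(S_1²)`. -/
def B1sq (N : ℕ) : ℝ :=
  (constD P p q * constM1 P p q - 2 * P.β ^ 2 * constE P p q ^ 2) / (N * constM P p q)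

/-- `C_1²`, the leading term of `ν(S_1 T_1)`. -/
def C1sq (N : ℕ) : ℝ := constE P p q / (N * constM P p q)

/-- `A_0²`, the leading term of `ν(T²)`. -/
def A0sq (N : ℕ) : ℝ :=
  let β := P.β
  let E := constE P p q
  let G := constG P p q
  let I3 := constI3 P p q
  let I5 := constI5 P p q
  let K3 := constK3 P p q
  let K4 := constK4 P p q
  let M2 := constM2 P p q
  let M := constM P p q
  β ^ 2 / M * (β ^ 2 * E * K4 + M2 * I5) * C1sq P p q N
    + 2 * (β ^ 2 / M) * (β ^ 2 * E * (E - K3) + M2 * (2 * G - I3)) * A1sq P p q N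
    + β ^ 2 / M * (β ^ 2 * E * K3 + M2 * I3) * A2sq P p q N
    + 1 / (M * N) * (β ^ 2 * E * K3 + M2 * I3)

/-- `B_0²`, the leading term of `ν(S²)`. -/
def B0sq (N : ℕ) : ℝ :=
  let β := P.β
  let E := constE P p q
  let G := constG P p q
  let I3 := constI3 P p q
  let I5 := constI5 P p q
  let K3 := constK3 P p q
  let K4 := constK4 P p q
  let M1 := constM1 P p q
  let M := constM P p q
  β ^ 2 / (2 * M) * (M1 * K4 - β ^ 2 * E * I5) * B1sq P p q N
    + β ^ 2 / M * (M1 * (E - K3) - E * β ^ 2 * (2 * G - I3)) * C1sq P p q N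
    + 1 / (M * N) * (M1 * K4 - β ^ 2 * E * I5)

/-- `C_0`, the leading term of `ν(S T)`. -/
def C0 (N : ℕ) : ℝ :=
  let β := P.β
  let E := constE P p q
  let G := constG P p q
  let I3 := constI3 P p q
  let I5 := constI5 P p q
  let K3 := constK3 P p q
  let K4 := constK4 P p q
  let M2 := constM2 P p q
  let M := constM P p q
  β ^ 2 / M * (1 / 2 * M2 * I5 + 1 / 2 * β ^ 2 * E * K4) * B1sq P p q N
    + β ^ 2 / M * (M2 * (2 * G - I3) + β ^ 2 * E * (E - K3)) * C1sq P p q N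
    + 1 / (M * N) * (M2 * I5 + β ^ 2 * E * K4)

end Cavity

end GhatakSherrington

end

/-! Write R_kl for the overlap of replicas k and l, centered at p if k = l and at q otherwise.
Replicas are independent given the disorder, so T = ⟨R_12⟩ and S = ⟨R_11⟩. The three quantities are
therefore the covariances ν(R_12 R_34), ν(R_11 R_22) and ν(R_11 R_23), and it suffices to compute
every covariance ν(R_kl R_k'l') up to N^(-3/2).

The tool is the cavity interpolation `cavityPath`, which decouples the spin at one site i at angle 0
and is the model at angle π/2. Gaussian integration by parts (`GaussianPath.hasDerivAt_avg`)
differentiates an average along it: two replicas are added and, by `cavityPath_drift`, a factor β²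
times a spin product at i times a centered overlap without site i appears. Each derivative thus
gains one overlap. Using an angle instead of t = sin²θ replaces √t and √(1-t) by functions smooth up
to the endpoints. At angle 0 averages factorize (`cavityPath_avg_zero_mul`), and the equations for
(p, q) say that the centered spin products have mean zero there. Those equations have one solution
because at small β they express a fixed point of a contraction.

Sizes: by symmetry between sites, one factor of R_kl^(r+1) can be replaced by the centered spin
product at a site. Its leading term vanishes at angle 0, the derivative is β² times moments of the
same degree, and removing the site costs 1/N times moments of degree r-1. For small β the first term
is absorbed (`overlapMoment_le_of_odd`), so overlaps are of order N^(-1/2), up to fourth moments.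

Covariances: the same expansion to second order, with a third-moment remainder, gives linear
equations among the covariances up to O(N^(-3/2)) (`abs_overlapCov_sub_le`). By replica symmetry a
covariance depends only on how the four indices coincide (`eq_eval_of_symmetric`), which leaves
seven unknowns. The formulas of the theorem solve the equations without error, an algebraic identity
(`solvesCavity_of_eq`). The linear map is a contraction at small β, so the true covariances differ
from these formulas by a multiple of the error (`norm_overlapPattern_sub_le`). -/

noncomputable section

namespace GhatakSherrington

/-! ### Gaussian integration by parts -/

/-- The law of a family of i.i.d. standard Gaussian variables. -/
abbrev gaussianPi (J : Type*) [Fintype J] : Measure (J → ℝ) :=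
  Measure.pi fun _ => gaussianReal 0 1

theorem hasDerivAt_gaussianPDFReal (x : ℝ) :
    HasDerivAt (gaussianPDFReal 0 1) (-x * gaussianPDFReal 0 1 x) x := by
  have h : gaussianPDFReal 0 1 = fun x => (√(2 * Real.pi))⁻¹ * Real.exp (-x ^ 2 / 2) := by
    ext x; simp [gaussianPDFReal]
  rw [h]
  have h1 : HasDerivAt (fun x : ℝ => -x ^ 2 / 2) (-x) x := by
    have := ((hasDerivAt_pow 2 x).neg).div_const 2
    refine this.congr_deriv ?_
    norm_num
    ring
  refine (h1.exp.const_mul ((√(2 * Real.pi))⁻¹)).congr_deriv ?_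
  ring

theorem integrable_id_gaussianReal : Integrable (fun x : ℝ => x) (gaussianReal 0 1) :=
  (memLp_id_gaussianReal (μ := 0) (v := 1) 1).integrable (by norm_num)

theorem integrable_gaussianReal_iff (f : ℝ → ℝ) :
    Integrable f (gaussianReal 0 1) ↔ Integrable fun x => gaussianPDFReal 0 1 x * f x := by
  rw [gaussianReal_of_var_ne_zero 0 one_ne_zero,
    integrable_withDensity_iff_integrable_smul' (measurable_gaussianPDF 0 1)
      (ae_of_all _ fun x => gaussianPDF_lt_top)]
  simp [toReal_gaussianPDF]

/-- Gaussian integration by parts on the line. -/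
theorem integral_id_mul_gaussianReal {f f' : ℝ → ℝ} {K : ℝ} (hf : ∀ x, HasDerivAt f (f' x) x)
    (hf' : Continuous f') (hb : ∀ x, |f x| ≤ K) (hb' : ∀ x, |f' x| ≤ K) :
    ∫ x, x * f x ∂(gaussianReal 0 1) = ∫ x, f' x ∂(gaussianReal 0 1) := by
  have hfc : Continuous f := continuous_iff_continuousAt.2 fun x => (hf x).continuousAt
  have i0 : Integrable f (gaussianReal 0 1) :=
    Integrable.of_bound hfc.aestronglyMeasurable K (ae_of_all _ hb)
  have i1 : Integrable f' (gaussianReal 0 1) :=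
    Integrable.of_bound hf'.aestronglyMeasurable K (ae_of_all _ hb')
  have i2 : Integrable (fun x => x * f x) (gaussianReal 0 1) :=
    integrable_id_gaussianReal.mul_bdd (c := K) hfc.aestronglyMeasurable (ae_of_all _ hb)
  rw [integrable_gaussianReal_iff] at i0 i1 i2
  rw [integral_gaussianReal_eq_integral_smul one_ne_zero,
    integral_gaussianReal_eq_integral_smul one_ne_zero]
  have := integral_mul_deriv_eq_deriv_mul_of_integrable (u := f) (v := gaussianPDFReal 0 1)
    (u' := f') (v' := fun x => -x * gaussianPDFReal 0 1 x) (fun x _ => hf x)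
    (fun x _ => hasDerivAt_gaussianPDFReal x)
    (by refine i2.neg.congr (ae_of_all _ fun x => ?_); simp; ring)
    (by refine i1.congr (ae_of_all _ fun x => ?_); simp; ring)
    (by refine i0.congr (ae_of_all _ fun x => ?_); simp; ring)
  simp only [smul_eq_mul]
  have e1 : ∫ x, gaussianPDFReal 0 1 x * (x * f x) = -∫ x, f x * (-x * gaussianPDFReal 0 1 x) := by
    rw [← integral_neg]; congr 1; ext x; ring
  rw [e1, this, neg_neg]
  congr 1; ext x; ring

section Pi

variable {J : Type*} [Fintype J]

theorem integrable_abs_eval_gaussianPi (j : J) :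
    Integrable (fun z : J → ℝ => |z j|) (gaussianPi J) :=
  ((measurePreserving_eval (fun _ : J => gaussianReal 0 1) j).integrable_comp_of_integrable
    integrable_id_gaussianReal).abs

section

variable [DecidableEq J]

/-- Resampling one coordinate preserves a product of probability measures. -/
theorem measurePreserving_update_gaussianPi (j : J) :
    MeasurePreserving (fun x : ℝ × (J → ℝ) => Function.update x.2 j x.1)
      ((gaussianReal 0 1).prod (gaussianPi J)) (gaussianPi J) := by
  have hm : Measurable (fun x : ℝ × (J → ℝ) => Function.update x.2 j x.1) := by
    refine measurable_pi_iff.2 fun k => ?_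
    by_cases h : k = j
    · subst h; simpa using measurable_fst
    · simpa [Function.update_of_ne h, Function.comp_def] using
        (measurable_pi_apply k).comp measurable_snd
  refine ⟨hm, ?_⟩
  symm
  refine Measure.pi_eq fun s hs => ?_
  rw [Measure.map_apply hm (MeasurableSet.univ_pi hs)]
  have : (fun x : ℝ × (J → ℝ) => Function.update x.2 j x.1) ⁻¹' (Set.univ.pi s)
      = s j ×ˢ (Set.univ.pi (Function.update s j Set.univ)) := by
    ext ⟨x, z⟩
    simp only [Set.mem_preimage, Set.mem_pi, Set.mem_univ, true_implies, Set.mem_prod]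
    constructor
    · intro h
      refine ⟨by simpa using h j, fun k => ?_⟩
      by_cases hk : k = j
      · subst hk; simp
      · simpa [Function.update_of_ne hk] using h k
    · rintro ⟨h1, h2⟩ k
      by_cases hk : k = j
      · subst hk; simpa using h1
      · simpa [Function.update_of_ne hk] using h2 k
  rw [this, Measure.prod_prod, Measure.pi_pi, ← Finset.mul_prod_erase _ _ (Finset.mem_univ j),
    ← Finset.mul_prod_erase _ (fun k => (gaussianReal 0 1) (s k)) (Finset.mem_univ j)]
  simp only [Function.update_self, measure_univ, one_mul]
  congr 1
  refine Finset.prod_congr rfl fun k hk => ?_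
  rw [Function.update_of_ne (Finset.ne_of_mem_erase hk)]

/-- Gaussian integration by parts in one coordinate. -/
theorem integral_eval_mul_gaussianPi (j : J) {F F' : (J → ℝ) → ℝ} {K : ℝ}
    (hF : ∀ z x, HasDerivAt (fun y => F (Function.update z j y)) (F' (Function.update z j x)) x)
    (hc : Continuous F) (hc' : Continuous F') (hb : ∀ z, |F z| ≤ K) (hb' : ∀ z, |F' z| ≤ K) :
    ∫ z, z j * F z ∂(gaussianPi J) = ∫ z, F' z ∂(gaussianPi J) := by
  have mp := measurePreserving_update_gaussianPi (J := J) j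
  have i1 : Integrable (fun z => z j * F z) (gaussianPi J) := by
    refine Integrable.mul_bdd (c := K) ?_ hc.aestronglyMeasurable (ae_of_all _ hb)
    exact (measurePreserving_eval (fun _ : J => gaussianReal 0 1) j).integrable_comp_of_integrable
      integrable_id_gaussianReal
  have i2 : Integrable F' (gaussianPi J) :=
    Integrable.of_bound hc'.aestronglyMeasurable K (ae_of_all _ hb')
  have e1 : ∫ z, z j * F z ∂(gaussianPi J) = ∫ x : ℝ × (J → ℝ),
      x.1 * F (Function.update x.2 j x.1) ∂((gaussianReal 0 1).prod (gaussianPi J)) := by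
    conv_lhs => rw [← mp.map_eq]
    rw [integral_map mp.measurable.aemeasurable (by rw [mp.map_eq]; exact i1.aestronglyMeasurable)]
    simp
  have e2 : ∫ z, F' z ∂(gaussianPi J) = ∫ x : ℝ × (J → ℝ),
      F' (Function.update x.2 j x.1) ∂((gaussianReal 0 1).prod (gaussianPi J)) := by
    conv_lhs => rw [← mp.map_eq]
    rw [integral_map mp.measurable.aemeasurable (by rw [mp.map_eq]; exact i2.aestronglyMeasurable)]
  have j1 := mp.integrable_comp_of_integrable i1
  have j2 := mp.integrable_comp_of_integrable i2
  -- After resampling, Fubini freezes all coordinates but the j-th and the one-dimensional formula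
  -- applies to the inner integral.
  rw [e1, e2, integral_prod_symm, integral_prod_symm]
  · congr 1; ext z
    exact integral_id_mul_gaussianReal (hF z) (hc'.comp (by fun_prop)) (fun x => hb _)
      (fun x => hb' _)
  · exact j2
  · refine j1.congr (ae_of_all _ fun x => ?_)
    simp

/-- A function of one coordinate is independent of a function of the others. -/
theorem integral_eval_mul_of_update (j : J) {F : ℝ → ℝ} {G : (J → ℝ) → ℝ} 
    (hG : ∀ z x, G (Function.update z j x) = G z) (hF : Continuous F) (hc : Continuous G) :
    ∫ z, F (z j) * G z ∂(gaussianPi J)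
      = (∫ x, F x ∂(gaussianReal 0 1)) * ∫ z, G z ∂(gaussianPi J) := by
  have mp := measurePreserving_update_gaussianPi (J := J) j
  conv_lhs => rw [← mp.map_eq]
  rw [integral_map mp.measurable.aemeasurable (Continuous.aestronglyMeasurable (by fun_prop))]
  simp only [Function.update_self, hG]
  rw [integral_prod_mul]

end

end Pi

/-- Forgetting coordinates of a Gaussian vector. -/
theorem measurePreserving_comp_gaussianPi {I J : Type*} [Fintype I] [Fintype J] (e : I → J)
    (he : Function.Injective e) :
    MeasurePreserving (fun z : J → ℝ => fun i => z (e i)) (gaussianPi J) (gaussianPi I) := by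
  classical
  have hm : Measurable (fun z : J → ℝ => fun i => z (e i)) := by fun_prop
  refine ⟨hm, ?_⟩
  symm
  refine Measure.pi_eq fun s hs => ?_
  rw [Measure.map_apply hm (MeasurableSet.univ_pi hs)]
  -- The side of the box at j is `s i` if j = e i, and the empty intersection, hence everything, if
  -- j is not in the range. The latter sides have measure one.
  have : (fun z : J → ℝ => fun i => z (e i)) ⁻¹' (Set.univ.pi s)
      = Set.univ.pi (fun j => ⋂ i, ⋂ _ : e i = j, s i) := by
    ext z
    simp only [Set.mem_preimage, Set.mem_pi, Set.mem_univ, true_implies, Set.mem_iInter]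
    exact ⟨fun h j i hi => hi ▸ h i, fun h i => h (e i) i rfl⟩
  rw [this, Measure.pi_pi, ← Finset.prod_subset (Finset.subset_univ (Finset.univ.image e)),
    Finset.prod_image (fun a _ b _ h => he h)]
  · refine Finset.prod_congr rfl fun i _ => ?_
    congr 1
    ext x
    simp only [Set.mem_iInter]
    exact ⟨fun h => h i rfl, fun h i' hi' => he hi' ▸ h⟩
  · intro j _ hj
    have : (⋂ i, ⋂ _ : e i = j, s i) = Set.univ := by
      ext x
      simp only [Set.mem_iInter, Set.mem_univ, iff_true]
      intro i hi
      exact absurd (Finset.mem_image.2 ⟨i, Finset.mem_univ i, hi⟩) hj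
    rw [this, measure_univ]

end GhatakSherrington

end

noncomputable section

namespace GhatakSherrington

/-! ### Gibbs averages over a finite configuration space -/

section Gibbs

variable {C : Type*} [Fintype C]

/-- The Gibbs probability with exponent `H` on a finite set. -/
def gibbsProb (H : C → ℝ) (s : C) : ℝ := Real.exp (H s) / ∑ t, Real.exp (H t)

/-- The average over i.i.d. replicas under the Gibbs probability with exponent `H`. -/
def gibbsAvg {α : Type*} [Fintype α] [DecidableEq α] (H : C → ℝ) (f : (α → C) → ℝ) : ℝ :=
  ∑ σ : α → C, (∏ k, gibbsProb H (σ k)) * f σ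

theorem gibbsProb_nonneg (H : C → ℝ) (s : C) : 0 ≤ gibbsProb H s := by
  unfold gibbsProb; positivity

section

variable [Nonempty C]

theorem sum_exp_pos (H : C → ℝ) : 0 < ∑ t, Real.exp (H t) :=
  Finset.sum_pos (fun _ _ => Real.exp_pos _) Finset.univ_nonempty

theorem sum_gibbsProb (H : C → ℝ) : ∑ s, gibbsProb H s = 1 := by
  unfold gibbsProb
  rw [← Finset.sum_div, div_self (sum_exp_pos H).ne']

theorem hasDerivAt_gibbsProb {H : ℝ → C → ℝ} {H' : C → ℝ} {t : ℝ}
    (h : ∀ s, HasDerivAt (fun u => H u s) (H' s) t) (s : C) :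
    HasDerivAt (fun u => gibbsProb (H u) s)
      (gibbsProb (H t) s * (H' s - ∑ r, gibbsProb (H t) r * H' r)) t := by
  unfold gibbsProb
  have h1 : HasDerivAt (fun u => ∑ r, Real.exp (H u r)) (∑ r, Real.exp (H t r) * H' r) t :=
    HasDerivAt.fun_sum fun r _ => (h r).exp
  have hz := (sum_exp_pos (H t)).ne'
  refine ((h s).exp.div h1 hz).congr_deriv ?_
  have : ∑ r, Real.exp (H t r) / (∑ t', Real.exp (H t t')) * H' r
      = (∑ r, Real.exp (H t r) * H' r) / ∑ t', Real.exp (H t t') := by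
    rw [Finset.sum_div]; exact Finset.sum_congr rfl fun r _ => by ring
  rw [this]
  field_simp

theorem continuous_gibbsProb {Z : Type*} [TopologicalSpace Z] {H : Z → C → ℝ}
    (h : ∀ s, Continuous fun z => H z s) (s : C) : Continuous fun z => gibbsProb (H z) s := by
  unfold gibbsProb
  refine Continuous.div (Real.continuous_exp.comp (h s))
    (continuous_finsetSum _ fun r _ => Real.continuous_exp.comp (h r))
    fun z => (sum_exp_pos (H z)).ne'

end

section Replicas

variable {α : Type*} [Fintype α] [DecidableEq α]

omit [DecidableEq α] in
theorem prod_gibbsProb_nonneg (H : C → ℝ) (σ : α → C) : 0 ≤ ∏ k, gibbsProb H (σ k) :=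
  Finset.prod_nonneg fun _ _ => gibbsProb_nonneg _ _

variable [Nonempty C]

theorem sum_prod_gibbsProb (H : C → ℝ) : ∑ σ : α → C, ∏ k, gibbsProb H (σ k) = 1 := by
  have := Finset.prod_univ_sum (fun _ : α => (Finset.univ : Finset C)) fun _ s => gibbsProb H s
  simp only [sum_gibbsProb, Finset.prod_const_one, Fintype.piFinset_univ] at this
  exact this.symm

theorem continuous_gibbsAvg {Z : Type*} [TopologicalSpace Z] {H : Z → C → ℝ}
    (h : ∀ s, Continuous fun z => H z s) (f : (α → C) → ℝ) :
    Continuous fun z => gibbsAvg (H z) f := by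
  unfold gibbsAvg
  refine continuous_finsetSum _ fun σ _ => Continuous.mul ?_ continuous_const
  exact continuous_finsetProd _ fun k _ => continuous_gibbsProb h _

theorem abs_gibbsAvg_le (H : C → ℝ) {f : (α → C) → ℝ} {K : ℝ} (hf : ∀ σ, |f σ| ≤ K) :
    |gibbsAvg H f| ≤ K := by
  unfold gibbsAvg
  calc |∑ σ : α → C, (∏ k, gibbsProb H (σ k)) * f σ|
      ≤ ∑ σ : α → C, |(∏ k, gibbsProb H (σ k)) * f σ| := Finset.abs_sum_le_sum_abs _ _
    _ ≤ ∑ σ : α → C, (∏ k, gibbsProb H (σ k)) * K := by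
        refine Finset.sum_le_sum fun σ _ => ?_
        rw [abs_mul, abs_of_nonneg (prod_gibbsProb_nonneg H σ)]
        exact mul_le_mul_of_nonneg_left (hf σ) (prod_gibbsProb_nonneg H σ)
    _ = K := by rw [← Finset.sum_mul, sum_prod_gibbsProb, one_mul]

/-- Replicas which do not appear in a function can be dropped. -/
theorem gibbsAvg_comp_injective {γ : Type*} [Fintype γ] [DecidableEq γ] (H : C → ℝ) {ι : γ → α}
    (hι : Function.Injective ι) (f : (γ → C) → ℝ) :
    gibbsAvg H (fun σ : α → C => f (fun c => σ (ι c))) = gibbsAvg H f := by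
  classical
  unfold gibbsAvg
  rw [← Finset.sum_fiberwise (Finset.univ : Finset (α → C)) (fun σ => fun c => σ (ι c))]
  refine Finset.sum_congr rfl fun τ _ => ?_
  -- The fiber over τ is a product set: the replica `ι c` is pinned to `τ c` and all others are
  -- free. The sum over it factorizes, and each free replica contributes total mass one.
  have h1 : ∑ σ ∈ (Finset.univ : Finset (α → C)) with (fun c => σ (ι c)) = τ,
      (∏ k, gibbsProb H (σ k)) * f (fun c => σ (ι c))
      = (∑ σ ∈ Fintype.piFinset fun k : α =>
          (Finset.univ : Finset C).filter (fun s => ∀ c, ι c = k → s = τ c),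
          ∏ k, gibbsProb H (σ k)) * f τ := by
    rw [Finset.sum_mul]
    refine Finset.sum_congr ?_ ?_
    · ext σ
      simp only [Finset.mem_filter, Finset.mem_univ, true_and, Fintype.mem_piFinset]
      refine ⟨fun h k c hc => ?_, fun h => funext fun c => h (ι c) c rfl⟩
      rw [← hc, ← h]
    · intro σ hσ
      have : (fun c => σ (ι c)) = τ := by
        funext c
        have := Fintype.mem_piFinset.1 hσ (ι c)
        simp only [Finset.mem_filter, Finset.mem_univ, true_and] at this
        exact this c rfl
      rw [this]
  rw [h1, ← Finset.prod_univ_sum (fun k : α =>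
          (Finset.univ : Finset C).filter (fun s => ∀ c, ι c = k → s = τ c))
          (fun _ s => gibbsProb H s)]
  congr 1
  rw [← Finset.prod_subset (Finset.subset_univ (Finset.univ.image ι)),
    Finset.prod_image (fun a _ b _ h => hι h)]
  · refine Finset.prod_congr rfl fun c _ => ?_
    have : (Finset.univ : Finset C).filter (fun s => ∀ c', ι c' = ι c → s = τ c') = {τ c} := by
      ext s
      simp only [Finset.mem_filter, Finset.mem_univ, true_and, Finset.mem_singleton]
      exact ⟨fun h => h c rfl, fun h c' hc' => by rw [hι hc', h]⟩
    rw [this, Finset.sum_singleton]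
  · intro k _ hk
    have : (Finset.univ : Finset C).filter (fun s => ∀ c', ι c' = k → s = τ c') = Finset.univ := by
      refine Finset.filter_true_of_mem fun s _ c' hc' => ?_
      exact absurd (Finset.mem_image.2 ⟨c', Finset.mem_univ _, hc'⟩) hk
    rw [this, sum_gibbsProb]

omit [Nonempty C] in
/-- Factorization of Gibbs averages over a product space with an additive exponent. -/
theorem gibbsAvg_factor {A B : Type*} [Fintype A] [Fintype B] [Nonempty A] [Nonempty B]
    (e : C ≃ A × B) (a : A → ℝ) (b : B → ℝ) (φ : (α → A) → ℝ) (ψ : (α → B) → ℝ) :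
    gibbsAvg (fun s => a (e s).1 + b (e s).2)
      (fun σ : α → C => φ (fun k => (e (σ k)).1) * ψ (fun k => (e (σ k)).2))
      = gibbsAvg a φ * gibbsAvg b ψ := by
  have hp : ∀ s, gibbsProb (fun s => a (e s).1 + b (e s).2) s
      = gibbsProb a (e s).1 * gibbsProb b (e s).2 := by
    intro s
    unfold gibbsProb
    rw [Equiv.sum_comp e (fun x : A × B => Real.exp (a x.1 + b x.2)), Fintype.sum_prod_type]
    simp only [Real.exp_add, ← Finset.mul_sum, ← Finset.sum_mul]
    rw [mul_div_mul_comm]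
  unfold gibbsAvg
  rw [Finset.sum_mul_sum, ← Fintype.sum_prod_type',
    ← Equiv.sum_comp ((Equiv.arrowCongr (Equiv.refl α) e).trans
      (Equiv.arrowProdEquivProdArrow α (fun _ => A) (fun _ => B)))]
  refine Finset.sum_congr rfl fun σ _ => ?_
  simp only [hp, Finset.prod_mul_distrib, Equiv.trans_apply, Equiv.arrowCongr_apply,
    Equiv.coe_refl, Equiv.arrowProdEquivProdArrow_apply, Function.comp_apply, Equiv.refl_symm, id]
  ring

end Replicas

section FinReplicas

variable [Nonempty C] {n : ℕ}

omit [Nonempty C] in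
-- Averaging over the last replica first: a Gibbs mean inside an average can be traded for
-- evaluation at a fresh replica.
theorem gibbsAvg_snoc (H : C → ℝ) (F : (Fin n → C) → C → ℝ) :
    gibbsAvg H (fun σ : Fin (n + 1) → C => F (fun k => σ k.castSucc) (σ (Fin.last n)))
      = gibbsAvg H fun τ => ∑ s, gibbsProb H s * F τ s := by
  unfold gibbsAvg
  rw [← Equiv.sum_comp (Fin.snocEquiv fun _ : Fin (n + 1) => C), Fintype.sum_prod_type_right]
  refine Finset.sum_congr rfl fun τ _ => ?_
  rw [Finset.mul_sum]
  refine Finset.sum_congr rfl fun s _ => ?_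
  simp only [Fin.snocEquiv, Equiv.coe_fn_mk, Fin.prod_univ_castSucc, Fin.snoc_castSucc,
    Fin.snoc_last]
  ring

/-- The derivation rule for Gibbs averages: the function of `n + 1` replicas whose average is the
derivative of the average of `f` when the exponent has derivative `h`. -/
def replicaDeriv (f : (Fin n → C) → ℝ) (h : C → ℝ) (σ : Fin (n + 1) → C) : ℝ :=
  f (fun k => σ k.castSucc) * (∑ k : Fin n, h (σ k.castSucc) - n * h (σ (Fin.last n)))

/-- The fresh replica with coefficient -n supplies the n subtracted means ⟨h⟩ that come from
differentiating the normalizations. -/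
theorem gibbsAvg_replicaDeriv (H : C → ℝ) (f : (Fin n → C) → ℝ) (h : C → ℝ) :
    gibbsAvg H (replicaDeriv f h)
      = gibbsAvg H fun τ => f τ * ∑ k, (h (τ k) - ∑ r, gibbsProb H r * h r) := by
  unfold replicaDeriv
  rw [gibbsAvg_snoc H fun τ s => f τ * (∑ k : Fin n, h (τ k) - n * h s)]
  unfold gibbsAvg
  refine Finset.sum_congr rfl fun τ _ => ?_
  congr 1
  have : ∀ s, gibbsProb H s * (f τ * (∑ k, h (τ k) - n * h s))
      = gibbsProb H s * (f τ * ∑ k, h (τ k)) - f τ * n * (gibbsProb H s * h s) := fun s => by ring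
  simp only [this, Finset.sum_sub_distrib, ← Finset.sum_mul, ← Finset.mul_sum, sum_gibbsProb,
    Finset.sum_const, Finset.card_univ, Fintype.card_fin, nsmul_eq_mul]
  ring

theorem hasDerivAt_gibbsAvg {H : ℝ → C → ℝ} {H' : C → ℝ} {t : ℝ}
    (h : ∀ s, HasDerivAt (fun u => H u s) (H' s) t) (f : (Fin n → C) → ℝ) :
    HasDerivAt (fun u => gibbsAvg (H u) f) (gibbsAvg (H t) (replicaDeriv f H')) t := by
  rw [gibbsAvg_replicaDeriv]
  unfold gibbsAvg
  refine HasDerivAt.fun_sum fun σ _ => ?_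
  have h1 := HasDerivAt.fun_finsetProd (u := Finset.univ) (x := t)
    (f := fun k u => gibbsProb (H u) (σ k))
    (f' := fun k => gibbsProb (H t) (σ k) * (H' (σ k) - ∑ r, gibbsProb (H t) r * H' r))
    fun k _ => hasDerivAt_gibbsProb h (σ k)
  refine (h1.mul_const (f σ)).congr_deriv ?_
  simp only [smul_eq_mul]
  have : ∀ k ∈ (Finset.univ : Finset (Fin n)),
      (∏ j ∈ Finset.univ.erase k, gibbsProb (H t) (σ j)) *
        (gibbsProb (H t) (σ k) * (H' (σ k) - ∑ r, gibbsProb (H t) r * H' r))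
      = (∏ j, gibbsProb (H t) (σ j)) * (H' (σ k) - ∑ r, gibbsProb (H t) r * H' r) := by
    intro k hk
    rw [← Finset.mul_prod_erase _ _ hk]
    ring
  rw [Finset.sum_congr rfl this, ← Finset.mul_sum]
  ring

omit [Fintype C] [Nonempty C] in
theorem abs_replicaDeriv_le {f : (Fin n → C) → ℝ} {h : C → ℝ} {K L : ℝ} (hf : ∀ σ, |f σ| ≤ K)
    (hh : ∀ s, |h s| ≤ L) (σ : Fin (n + 1) → C) : |replicaDeriv f h σ| ≤ K * (2 * n * L) := by
  unfold replicaDeriv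
  rw [abs_mul]
  have hK : 0 ≤ K := (abs_nonneg _).trans (hf fun k => σ k.castSucc)
  refine mul_le_mul (hf _) ?_ (abs_nonneg _) hK
  calc |∑ k : Fin n, h (σ k.castSucc) - n * h (σ (Fin.last n))|
      ≤ |∑ k : Fin n, h (σ k.castSucc)| + |n * h (σ (Fin.last n))| := abs_sub _ _
    _ ≤ ∑ k : Fin n, L + n * L := by
        refine add_le_add ((Finset.abs_sum_le_sum_abs _ _).trans
          (Finset.sum_le_sum fun k _ => hh _)) ?_
        rw [abs_mul, Nat.abs_cast]
        exact mul_le_mul_of_nonneg_left (hh _) (Nat.cast_nonneg n)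
    _ = 2 * n * L := by simp; ring

end FinReplicas

end Gibbs

end GhatakSherrington

end

noncomputable section

namespace GhatakSherrington

/-! ### Gaussian interpolation -/

/-- A path, parametrized by an angle, of Gaussian Hamiltonians on a finite configuration space `C`.
The covariance of the Hamiltonian and its deterministic part vary at the rates
`sin θ cos θ • cov` and `sin θ cos θ • diag`. -/
structure GaussianPath (J C : Type*) [Fintype J] where
  c : ℝ → J → C → ℝ
  c' : ℝ → J → C → ℝ
  d : ℝ → C → ℝ
  bound : ℝ
  cov : C → C → ℝ
  diag : C → ℝ
  hasDerivAt_c : ∀ θ j s, HasDerivAt (fun t => c t j s) (c' θ j s) θ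
  hasDerivAt_d : ∀ θ s, HasDerivAt (fun t => d t s) (Real.sin θ * Real.cos θ * diag s) θ
  abs_c'_le : ∀ θ j s, |c' θ j s| ≤ bound
  sum_c' : ∀ θ s t, ∑ j, c' θ j s * c θ j t = Real.sin θ * Real.cos θ * cov s t

/-- The signs of the replicas when a covariance is differentiated: first factor. -/
def driftU (n : ℕ) (k : Fin (n + 2)) : ℝ :=
  if (k : ℕ) < n then 1 else if (k : ℕ) = n then -n else 0

/-- The signs of the replicas when a covariance is differentiated: second factor. -/
def driftV (n : ℕ) (k : Fin (n + 2)) : ℝ := if (k : ℕ) < n + 1 then 1 else -(n + 1)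

theorem sum_driftU_mul {n : ℕ} (x : Fin (n + 2) → ℝ) :
    ∑ k, driftU n k * x k
      = ∑ k : Fin n, x k.castSucc.castSucc - n * x (Fin.last n).castSucc := by
  rw [Fin.sum_univ_castSucc, Fin.sum_univ_castSucc]
  simp [driftU]
  ring

theorem sum_driftV_mul {n : ℕ} (x : Fin (n + 2) → ℝ) :
    ∑ k, driftV n k * x k
      = ∑ k : Fin (n + 1), x k.castSucc - (n + 1 : ℕ) * x (Fin.last (n + 1)) := by
  have h1 : ∀ k : Fin (n + 1), driftV n k.castSucc = 1 := fun k => if_pos k.isLt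
  have h2 : driftV n (Fin.last (n + 1)) = -(n + 1) := if_neg (lt_irrefl _)
  rw [Fin.sum_univ_castSucc]
  simp only [h1, h2]
  push_cast
  ring_nf

/-- The first derivation adds one replica with sign -n and does not see the second one, whence the
final 0 in `driftU`. The second treats the resulting n + 1 replicas alike and adds one with sign -(n
+ 1). -/
theorem replicaDeriv_replicaDeriv {C : Type*} {n : ℕ} (f : (Fin n → C) → ℝ) (a b : C → ℝ)
    (σ : Fin (n + 2) → C) :
    replicaDeriv (replicaDeriv f a) b σ = f (fun k => σ k.castSucc.castSucc) *
      ((∑ k, driftU n k * a (σ k)) * ∑ l, driftV n l * b (σ l)) := by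
  rw [sum_driftU_mul, sum_driftV_mul]
  unfold replicaDeriv
  ring

namespace GaussianPath

variable {J C : Type*} [Fintype J] [Fintype C] (X : GaussianPath J C)

/-- The Hamiltonian. -/
def energy (θ : ℝ) (z : J → ℝ) (s : C) : ℝ := ∑ j, z j * X.c θ j s + X.d θ s

/-- The average over the disorder and over replicas. -/
def avg {n : ℕ} (θ : ℝ) (f : (Fin n → C) → ℝ) : ℝ :=
  ∫ z, gibbsAvg (X.energy θ z) f ∂(gaussianPi J)

/-- The function of `n + 2` replicas whose average gives the derivative of the average of `f`. -/
def drift {n : ℕ} (f : (Fin n → C) → ℝ) (σ : Fin (n + 2) → C) : ℝ :=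
  f (fun k => σ k.castSucc.castSucc) *
    (∑ k, ∑ l, driftU n k * driftV n l * X.cov (σ k) (σ l) + ∑ k, driftU n k * X.diag (σ k))

omit [Fintype C] in
theorem continuous_energy (θ : ℝ) (s : C) : Continuous fun z => X.energy θ z s := by
  unfold energy; fun_prop

section Linear

variable [Nonempty C] {n : ℕ} (θ : ℝ)

theorem integrable_gibbsAvg (f : (Fin n → C) → ℝ) :
    Integrable (fun z => gibbsAvg (X.energy θ z) f) (gaussianPi J) := by
  refine Integrable.of_bound
    (continuous_gibbsAvg (X.continuous_energy θ) f).aestronglyMeasurable (∑ σ, |f σ|)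
    (ae_of_all _ fun z => abs_gibbsAvg_le _ fun σ => ?_)
  exact Finset.single_le_sum (f := fun σ => |f σ|) (fun _ _ => abs_nonneg _) (Finset.mem_univ σ)

/-- The averaged probability of a configuration of replicas. -/
def weight (σ : Fin n → C) : ℝ := ∫ z, ∏ k, gibbsProb (X.energy θ z) (σ k) ∂(gaussianPi J)

omit [Nonempty C] in
theorem weight_nonneg (σ : Fin n → C) : 0 ≤ X.weight θ σ :=
  integral_nonneg fun _ => prod_gibbsProb_nonneg _ _

/-- After integrating out the disorder only a finite probability vector on tuples of configurations
remains. Linearity and monotonicity of the averages are read off from it. -/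
theorem avg_eq_sum (f : (Fin n → C) → ℝ) : X.avg θ f = ∑ σ, X.weight θ σ * f σ := by
  classical
  unfold avg weight gibbsAvg
  have hi : ∀ σ : Fin n → C,
      Integrable (fun z => ∏ k, gibbsProb (X.energy θ z) (σ k)) (gaussianPi J) := by
    intro σ
    refine (X.integrable_gibbsAvg θ (Pi.single σ (1 : ℝ))).congr (ae_of_all _ fun z => ?_)
    simp [gibbsAvg, Pi.single_apply]
  rw [integral_finsetSum _ fun σ _ => (hi σ).mul_const _]
  simp_rw [integral_mul_const]

theorem sum_weight : ∑ σ : Fin n → C, X.weight θ σ = 1 := by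
  have h := X.avg_eq_sum θ (fun _ : Fin n → C => (1 : ℝ))
  simp only [mul_one] at h
  rw [← h]
  simp [avg, gibbsAvg, sum_prod_gibbsProb]

theorem avg_add (f g : (Fin n → C) → ℝ) :
    X.avg θ (fun σ => f σ + g σ) = X.avg θ f + X.avg θ g := by
  simp only [avg_eq_sum, mul_add, Finset.sum_add_distrib]

theorem avg_sub (f g : (Fin n → C) → ℝ) :
    X.avg θ (fun σ => f σ - g σ) = X.avg θ f - X.avg θ g := by
  simp only [avg_eq_sum, mul_sub, Finset.sum_sub_distrib]

theorem avg_const_mul (a : ℝ) (f : (Fin n → C) → ℝ) :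
    X.avg θ (fun σ => a * f σ) = a * X.avg θ f := by
  simp only [avg_eq_sum, Finset.mul_sum]
  exact Finset.sum_congr rfl fun σ _ => by ring

theorem avg_sum {I : Type*} (t : Finset I) (f : I → (Fin n → C) → ℝ) :
    X.avg θ (fun σ => ∑ i ∈ t, f i σ) = ∑ i ∈ t, X.avg θ (f i) := by
  simp only [avg_eq_sum, Finset.mul_sum]
  exact Finset.sum_comm

theorem avg_const (a : ℝ) : X.avg θ (fun _ : Fin n → C => a) = a := by
  rw [avg_eq_sum, ← Finset.sum_mul, sum_weight, one_mul]

theorem avg_mono {f g : (Fin n → C) → ℝ} (h : ∀ σ, f σ ≤ g σ) : X.avg θ f ≤ X.avg θ g := by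
  simp only [avg_eq_sum]
  exact Finset.sum_le_sum fun σ _ => mul_le_mul_of_nonneg_left (h σ) (X.weight_nonneg θ σ)

theorem abs_avg_le {f g : (Fin n → C) → ℝ} (h : ∀ σ, |f σ| ≤ g σ) : |X.avg θ f| ≤ X.avg θ g := by
  rw [abs_le]
  refine ⟨?_, X.avg_mono θ fun σ => (le_abs_self _).trans (h σ)⟩
  have := X.avg_mono θ (f := fun σ => -1 * g σ) (g := f) fun σ => by
    have := neg_abs_le (f σ); linarith [h σ]
  rw [avg_const_mul] at this
  linarith

theorem avg_comp_injective {m : ℕ} {ι : Fin m → Fin n} (hι : Function.Injective ι)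
    (f : (Fin m → C) → ℝ) : X.avg θ (fun σ : Fin n → C => f (fun c => σ (ι c))) = X.avg θ f := by
  unfold avg
  simp_rw [gibbsAvg_comp_injective _ hι f]

end Linear

/-! ### Differentiation of averages along a Gaussian path -/

section Derivative

variable [Nonempty C] {n : ℕ}

omit [Fintype C] [Nonempty C] in
theorem hasDerivAt_energy (z : J → ℝ) (θ : ℝ) (s : C) :
    HasDerivAt (fun t => X.energy t z s)
      (∑ j, z j * X.c' θ j s + Real.sin θ * Real.cos θ * X.diag s) θ := by
  unfold energy
  exact (HasDerivAt.fun_sum fun j _ => (X.hasDerivAt_c θ j s).const_mul _).add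
    (X.hasDerivAt_d θ s)

omit [Nonempty C] in
-- The bound is uniform in θ and linear in |z|, hence an integrable dominating function for
-- differentiating under the integral.
theorem abs_deriv_energy_le (z : J → ℝ) (θ : ℝ) (s : C) :
    |∑ j, z j * X.c' θ j s + Real.sin θ * Real.cos θ * X.diag s|
      ≤ ∑ j, |z j| * X.bound + ∑ s, |X.diag s| := by
  refine (abs_add_le _ _).trans (add_le_add ((Finset.abs_sum_le_sum_abs _ _).trans ?_) ?_)
  · refine Finset.sum_le_sum fun j _ => ?_
    rw [abs_mul]
    exact mul_le_mul_of_nonneg_left (X.abs_c'_le θ j s) (abs_nonneg _)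
  · rw [abs_mul, abs_mul]
    have h1 : |Real.sin θ| * |Real.cos θ| ≤ 1 :=
      mul_le_one₀ (Real.abs_sin_le_one θ) (abs_nonneg _) (Real.abs_cos_le_one θ)
    calc |Real.sin θ| * |Real.cos θ| * |X.diag s| ≤ 1 * |X.diag s| :=
          mul_le_mul_of_nonneg_right h1 (abs_nonneg _)
      _ ≤ _ := by
          rw [one_mul]
          exact Finset.single_le_sum (f := fun s => |X.diag s|) (fun _ _ => abs_nonneg _)
            (Finset.mem_univ s)

theorem hasDerivAt_avg_aux (f : (Fin n → C) → ℝ) (θ : ℝ) :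
    HasDerivAt (fun t => X.avg t f)
      (∫ z, gibbsAvg (X.energy θ z) (replicaDeriv f fun s =>
        ∑ j, z j * X.c' θ j s + Real.sin θ * Real.cos θ * X.diag s) ∂(gaussianPi J)) θ := by
  set K := ∑ σ, |f σ| with hK
  have hf : ∀ σ, |f σ| ≤ K := fun σ =>
    Finset.single_le_sum (f := fun σ => |f σ|) (fun _ _ => abs_nonneg _) (Finset.mem_univ σ)
  refine (hasDerivAt_integral_of_dominated_loc_of_deriv_le (μ := gaussianPi J)
    (F := fun t z => gibbsAvg (X.energy t z) f)
    (F' := fun t z => gibbsAvg (X.energy t z) (replicaDeriv f fun s =>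
        ∑ j, z j * X.c' t j s + Real.sin t * Real.cos t * X.diag s))
    (bound := fun z => K * (2 * n * (∑ j, |z j| * X.bound + ∑ s, |X.diag s|)))
    (s := Set.univ) Filter.univ_mem ?_ ?_ ?_ ?_ ?_ ?_).2
  · exact Filter.Eventually.of_forall fun t => (X.integrable_gibbsAvg t f).aestronglyMeasurable
  · exact X.integrable_gibbsAvg θ f
  · refine Continuous.aestronglyMeasurable ?_
    unfold gibbsAvg
    refine continuous_finsetSum _ fun σ _ => Continuous.mul ?_ ?_
    · exact continuous_finsetProd _ fun k _ => continuous_gibbsProb (X.continuous_energy θ) _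
    · unfold replicaDeriv; fun_prop
  · exact ae_of_all _ fun z t _ => abs_gibbsAvg_le _ (abs_replicaDeriv_le hf fun s =>
      X.abs_deriv_energy_le z t s)
  · refine Integrable.const_mul (Integrable.const_mul (Integrable.add ?_ (integrable_const _)) _) _
    exact integrable_finsetSum _ fun j _ => (integrable_abs_eval_gaussianPi j).mul_const _
  · exact ae_of_all _ fun z t _ => hasDerivAt_gibbsAvg (X.hasDerivAt_energy z t) f

/-- Gaussian integration by parts: the energy is affine in `z j` with slope `c θ j`, so the
derivation rule for Gibbs averages gives the derivative in that coordinate. -/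
theorem integral_eval_mul_gibbsAvg (θ : ℝ) (j : J) (g : (Fin n → C) → ℝ) :
    ∫ z, z j * gibbsAvg (X.energy θ z) g ∂(gaussianPi J)
      = X.avg θ (replicaDeriv g (X.c θ j)) := by
  classical
  set K := ∑ σ, |g σ| + ∑ σ, |replicaDeriv g (X.c θ j) σ| with hK
  refine integral_eval_mul_gaussianPi j (K := K) (fun z x => ?_)
    (continuous_gibbsAvg (X.continuous_energy θ) g)
    (continuous_gibbsAvg (X.continuous_energy θ) _)
    (fun z => abs_gibbsAvg_le _ fun σ => ?_) (fun z => abs_gibbsAvg_le _ fun σ => ?_)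
  · refine hasDerivAt_gibbsAvg (fun s => ?_) g
    unfold energy
    have h : ∀ i, HasDerivAt (fun y => Function.update z j y i * X.c θ i s)
        ((if i = j then 1 else 0) * X.c θ i s) x := by
      intro i
      by_cases hi : i = j
      · subst hi
        simpa using (hasDerivAt_id x).mul_const (X.c θ i s)
      · simpa [Function.update_of_ne hi, hi] using hasDerivAt_const x (z i * X.c θ i s)
    have := (HasDerivAt.fun_sum (u := Finset.univ) fun i _ => h i).add_const (X.d θ s)
    simpa using this
  · have := Finset.single_le_sum (f := fun σ => |g σ|) (fun _ _ => abs_nonneg _)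
      (Finset.mem_univ σ)
    have h2 : 0 ≤ ∑ σ, |replicaDeriv g (X.c θ j) σ| := Finset.sum_nonneg fun _ _ => abs_nonneg _
    linarith
  · have := Finset.single_le_sum (f := fun σ => |replicaDeriv g (X.c θ j) σ|)
      (fun _ _ => abs_nonneg _) (Finset.mem_univ σ)
    have h2 : 0 ≤ ∑ σ, |g σ| := Finset.sum_nonneg fun _ _ => abs_nonneg _
    linarith

omit [Nonempty C] in
theorem gibbsAvg_replicaDeriv_sum (H : C → ℝ) (f : (Fin n → C) → ℝ) (z : J → ℝ) (h : J → C → ℝ)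
    (e : C → ℝ) :
    gibbsAvg H (replicaDeriv f fun s => ∑ j, z j * h j s + e s)
      = ∑ j, z j * gibbsAvg H (replicaDeriv f (h j)) + gibbsAvg H (replicaDeriv f e) := by
  unfold gibbsAvg
  simp_rw [Finset.mul_sum]
  rw [Finset.sum_comm, ← Finset.sum_add_distrib]
  refine Finset.sum_congr rfl fun σ _ => ?_
  have : replicaDeriv f (fun s => ∑ j, z j * h j s + e s) σ
      = ∑ j, z j * replicaDeriv f (h j) σ + replicaDeriv f e σ := by
    unfold replicaDeriv
    simp only [Finset.sum_add_distrib, mul_add]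
    rw [Finset.sum_comm]
    have : ∀ j, z j * (f (fun k => σ k.castSucc) *
        (∑ k : Fin n, h j (σ k.castSucc) - n * h j (σ (Fin.last n))))
        = f (fun k => σ k.castSucc) *
          (∑ k : Fin n, z j * h j (σ k.castSucc) - n * (z j * h j (σ (Fin.last n)))) := by
      intro j; rw [← Finset.mul_sum]; ring
    simp only [this, ← Finset.mul_sum, Finset.sum_sub_distrib]
    ring
  rw [this, mul_add, Finset.mul_sum]
  congr 1
  exact Finset.sum_congr rfl fun j _ => by ring

/-- The derivative of an average along a Gaussian path. -/
theorem hasDerivAt_avg (f : (Fin n → C) → ℝ) (θ : ℝ) :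
    HasDerivAt (fun t => X.avg t f) (Real.sin θ * Real.cos θ * X.avg θ (X.drift f)) θ := by
  refine (X.hasDerivAt_avg_aux f θ).congr_deriv ?_
  simp_rw [gibbsAvg_replicaDeriv_sum]
  have hI : ∀ j, Integrable (fun z : J → ℝ =>
      z j * gibbsAvg (X.energy θ z) (replicaDeriv f (X.c' θ j))) (gaussianPi J) := by
    intro j
    refine Integrable.mul_bdd (c := ∑ σ, |replicaDeriv f (X.c' θ j) σ|) ?_
      (X.integrable_gibbsAvg θ _).aestronglyMeasurable (ae_of_all _ fun z => abs_gibbsAvg_le _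
        fun σ => Finset.single_le_sum (f := fun σ => |replicaDeriv f (X.c' θ j) σ|)
          (fun _ _ => abs_nonneg _) (Finset.mem_univ σ))
    exact (measurePreserving_eval (fun _ : J => gaussianReal 0 1) j).integrable_comp_of_integrable
      integrable_id_gaussianReal
  rw [integral_add (integrable_finsetSum _ fun j _ => hI j) (X.integrable_gibbsAvg θ _),
    integral_finsetSum _ fun j _ => hI j]
  simp_rw [integral_eval_mul_gibbsAvg]
  -- The deterministic part needs no integration by parts and uses only n + 1 replicas. It is padded
  -- with one more, which has weight 0 in `driftU`.
  have e2 : ∫ z, gibbsAvg (X.energy θ z)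
      (replicaDeriv f fun s => Real.sin θ * Real.cos θ * X.diag s) ∂(gaussianPi J)
      = X.avg θ (fun σ : Fin (n + 2) → C => Real.sin θ * Real.cos θ *
        (f (fun k => σ k.castSucc.castSucc) * ∑ k, driftU n k * X.diag (σ k))) := by
    rw [show (fun σ : Fin (n + 2) → C => Real.sin θ * Real.cos θ *
        (f (fun k => σ k.castSucc.castSucc) * ∑ k, driftU n k * X.diag (σ k)))
        = fun σ : Fin (n + 2) → C => (replicaDeriv f fun s => Real.sin θ * Real.cos θ * X.diag s)
          (fun k => σ k.castSucc) from ?_]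
    · rw [X.avg_comp_injective θ (Fin.castSucc_injective _)
        (replicaDeriv f fun s => Real.sin θ * Real.cos θ * X.diag s)]
      rfl
    · funext σ
      unfold replicaDeriv
      rw [sum_driftU_mul, ← Finset.mul_sum]
      ring
  rw [e2, ← avg_sum, ← avg_add, ← avg_const_mul]
  congr 1
  funext σ
  unfold drift
  simp only [replicaDeriv_replicaDeriv]
  -- Only the sum over the Gaussian coordinates matters: by `sum_c'` it collapses to the rate of
  -- change of the covariance.
  have key : ∑ j, (∑ k, driftU n k * X.c' θ j (σ k)) * ∑ l, driftV n l * X.c θ j (σ l)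
      = Real.sin θ * Real.cos θ *
        ∑ k, ∑ l, driftU n k * driftV n l * X.cov (σ k) (σ l) := by
    simp_rw [Finset.sum_mul_sum, Finset.mul_sum]
    rw [Finset.sum_comm]
    refine Finset.sum_congr rfl fun k _ => ?_
    rw [Finset.sum_comm]
    refine Finset.sum_congr rfl fun l _ => ?_
    calc ∑ j, driftU n k * X.c' θ j (σ k) * (driftV n l * X.c θ j (σ l))
        = driftU n k * driftV n l * ∑ j, X.c' θ j (σ k) * X.c θ j (σ l) := by
          rw [Finset.mul_sum]; exact Finset.sum_congr rfl fun j _ => by ring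
      _ = _ := by rw [X.sum_c' θ (σ k) (σ l)]; ring
  rw [← Finset.mul_sum, key]
  ring

end Derivative

/-! ### First and second order comparison along a Gaussian path -/

section MeanValue

variable [Nonempty C] {n : ℕ}

theorem abs_sin_mul_cos_le (θ : ℝ) : |Real.sin θ * Real.cos θ| ≤ 1 / 2 := by
  rw [abs_le]
  constructor <;> nlinarith [sq_nonneg (Real.sin θ + Real.cos θ),
    sq_nonneg (Real.sin θ - Real.cos θ), Real.sin_sq_add_cos_sq θ]

/-- The mean value inequality: the factor 1/2 bounding sin θ cos θ absorbs the length of the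
interval, which is at most 2. -/
theorem abs_sub_le_of_sin_mul_cos {φ ψ : ℝ → ℝ} {B : ℝ}
    (h : ∀ θ, HasDerivAt φ (Real.sin θ * Real.cos θ * ψ θ) θ)
    (hB : ∀ θ ∈ Set.Icc 0 (Real.pi / 2), |ψ θ| ≤ B) {x y : ℝ}
    (hx : x ∈ Set.Icc 0 (Real.pi / 2)) (hy : y ∈ Set.Icc 0 (Real.pi / 2)) :
    |φ y - φ x| ≤ B := by
  have hB0 : 0 ≤ B := (abs_nonneg _).trans (hB _ hx)
  have := Convex.norm_image_sub_le_of_norm_hasDerivWithin_le (C := B / 2)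
    (fun θ _ => (h θ).hasDerivWithinAt) (fun θ hθ => ?_) (convex_Icc 0 (Real.pi / 2)) hx hy
  · refine this.trans ?_
    have h1 : ‖y - x‖ ≤ 2 := by
      rw [Real.norm_eq_abs, abs_le]
      constructor <;> linarith [hx.1, hx.2, hy.1, hy.2, Real.pi_le_four]
    nlinarith
  · rw [Real.norm_eq_abs, abs_mul]
    calc |Real.sin θ * Real.cos θ| * |ψ θ| ≤ 1 / 2 * B :=
          mul_le_mul (abs_sin_mul_cos_le θ) (hB θ hθ) (abs_nonneg _) (by norm_num)
      _ = B / 2 := by ring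

theorem zero_mem : (0 : ℝ) ∈ Set.Icc 0 (Real.pi / 2) := ⟨le_rfl, by positivity⟩

theorem pi_div_two_mem : Real.pi / 2 ∈ Set.Icc 0 (Real.pi / 2) := ⟨by positivity, le_rfl⟩

/-- First order comparison of two averages along a Gaussian path. -/
theorem abs_avg_sub_avg_le {f : (Fin n → C) → ℝ} {B : ℝ}
    (hB : ∀ θ ∈ Set.Icc 0 (Real.pi / 2), |X.avg θ (X.drift f)| ≤ B) {x y : ℝ}
    (hx : x ∈ Set.Icc 0 (Real.pi / 2)) (hy : y ∈ Set.Icc 0 (Real.pi / 2)) :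
    |X.avg y f - X.avg x f| ≤ B :=
  abs_sub_le_of_sin_mul_cos (X.hasDerivAt_avg f) hB hx hy

/-- Second order comparison of the averages at the ends of a Gaussian path. -/
theorem abs_avg_sub_sub_le {f : (Fin n → C) → ℝ} {B : ℝ}
    (hB : ∀ θ ∈ Set.Icc 0 (Real.pi / 2), |X.avg θ (X.drift (X.drift f))| ≤ B) :
    |X.avg (Real.pi / 2) f - X.avg 0 f - 1 / 2 * X.avg 0 (X.drift f)| ≤ B := by
  have h1 : ∀ θ ∈ Set.Icc 0 (Real.pi / 2),
      |X.avg θ (X.drift f) - X.avg 0 (X.drift f)| ≤ B := fun θ hθ =>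
    X.abs_avg_sub_avg_le hB zero_mem hθ
  -- The first order term is (1/2) sin²θ times the drift at angle 0. Subtracting it leaves the
  -- increment of the drift as the derivative, and `h1` bounds that increment by the second drift.
  have h2 : ∀ θ, HasDerivAt
      (fun t => X.avg t f - 1 / 2 * Real.sin t ^ 2 * X.avg 0 (X.drift f))
      (Real.sin θ * Real.cos θ * (X.avg θ (X.drift f) - X.avg 0 (X.drift f))) θ := by
    intro θ
    refine ((X.hasDerivAt_avg f θ).sub
      ((((Real.hasDerivAt_sin θ).pow 2).const_mul (1 / 2)).mul_const _)).congr_deriv ?_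
    norm_num
    ring
  have := abs_sub_le_of_sin_mul_cos h2 h1 zero_mem pi_div_two_mem
  simp only [Real.sin_pi_div_two, Real.sin_zero] at this
  convert this using 2
  ring

/-- Averages of nonnegative functions along a Gaussian path are comparable. -/
theorem avg_le_exp_mul_avg {f : (Fin n → C) → ℝ} {G : ℝ} (hf : ∀ σ, 0 ≤ f σ) (hG : 0 ≤ G)
    (h : ∀ σ, |X.drift f σ| ≤ G * f fun k => σ k.castSucc.castSucc) {θ : ℝ}
    (hθ : θ ∈ Set.Icc 0 (Real.pi / 2)) :
    X.avg θ f ≤ Real.exp G * X.avg (Real.pi / 2) f := by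
  have hn : ∀ t, 0 ≤ X.avg t f := fun t => by
    have := X.avg_mono t hf; rwa [avg_const] at this
  have hd : ∀ t, -(G / 2) * X.avg t f ≤ Real.sin t * Real.cos t * X.avg t (X.drift f) := by
    intro t
    have h1 : |X.avg t (X.drift f)| ≤ G * X.avg t f := by
      refine (X.abs_avg_le t h).trans_eq ?_
      rw [avg_const_mul]
      congr 1
      exact X.avg_comp_injective t
        ((Fin.castSucc_injective (n + 1)).comp (Fin.castSucc_injective n)) f
    have h2 : |Real.sin t * Real.cos t * X.avg t (X.drift f)| ≤ 1 / 2 * (G * X.avg t f) := by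
      rw [abs_mul]
      exact mul_le_mul (abs_sin_mul_cos_le t) h1 (abs_nonneg _) (by norm_num)
    linarith [neg_abs_le (Real.sin t * Real.cos t * X.avg t (X.drift f))]
  -- Grönwall: since sin θ cos θ is at most 1/2, the average decreases at relative rate at most G /
  -- 2, and this exponential factor compensates.
  have hder : ∀ t, HasDerivAt (fun u => Real.exp (G / 2 * u) * X.avg u f)
      (Real.exp (G / 2 * t) * (G / 2 * X.avg t f
        + Real.sin t * Real.cos t * X.avg t (X.drift f))) t := by
    intro t
    have he : HasDerivAt (fun u => Real.exp (G / 2 * u)) (Real.exp (G / 2 * t) * (G / 2)) t := by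
      simpa using ((hasDerivAt_id t).const_mul (G / 2)).exp
    refine (he.mul (X.hasDerivAt_avg f t)).congr_deriv ?_
    ring
  have hmono : Monotone fun u => Real.exp (G / 2 * u) * X.avg u f := by
    refine monotone_of_deriv_nonneg (fun t => (hder t).differentiableAt) fun t => ?_
    rw [(hder t).deriv]
    exact mul_nonneg (Real.exp_pos _).le (by linarith [hd t])
  have h1 := hmono hθ.2
  simp only at h1
  have h2 : X.avg θ f ≤ Real.exp (G / 2 * θ) * X.avg θ f :=
    le_mul_of_one_le_left (hn θ) (Real.one_le_exp (mul_nonneg (by linarith) hθ.1))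
  refine h2.trans (h1.trans (mul_le_mul_of_nonneg_right (Real.exp_le_exp.2 ?_) (hn _)))
  -- The exponent is G π / 4, which is at most G.
  nlinarith [Real.pi_le_four]

end MeanValue

end GaussianPath

end GhatakSherrington

end

noncomputable section

namespace GhatakSherrington

/-! ### The replica symmetric equations -/

instance (S : ℕ) : Nonempty (Spin S) := ⟨⟨0, by simp⟩⟩

theorem Spin.abs_val_le {S : ℕ} (s : Spin S) : |s.val| ≤ S := by
  have h := Finset.mem_Icc.1 s.2
  unfold Spin.val
  rw [abs_le]
  exact ⟨by exact_mod_cast h.1, by exact_mod_cast h.2⟩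

theorem Spin.abs_val_mul_val_le {S : ℕ} (s t : Spin S) : |s.val * t.val| ≤ (S : ℝ) ^ 2 := by
  rw [abs_mul, sq]
  exact mul_le_mul s.abs_val_le t.abs_val_le (abs_nonneg _) (Nat.cast_nonneg S)

theorem abs_driftU_le {n : ℕ} (k : Fin (n + 2)) : |driftU n k| ≤ n + 1 := by
  unfold driftU
  have hn : (0 : ℝ) ≤ n := Nat.cast_nonneg n
  split_ifs
  · rw [abs_one]; linarith
  · rw [abs_neg, Nat.abs_cast]; linarith
  · rw [abs_zero]; linarith

theorem abs_driftV_le {n : ℕ} (k : Fin (n + 2)) : |driftV n k| ≤ n + 1 := by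
  unfold driftV
  have hn : (0 : ℝ) ≤ n := Nat.cast_nonneg n
  split_ifs
  · rw [abs_one]; linarith
  · rw [abs_neg, abs_of_nonneg (by linarith)]

theorem GaussianPath.abs_drift_le {J C : Type*} [Fintype J] (X : GaussianPath J C) {n : ℕ}
    {f : (Fin n → C) → ℝ} {B a b : ℝ} (hf : ∀ σ, |f σ| ≤ B) (ha : ∀ s t, |X.cov s t| ≤ a)
    (hb : ∀ s, |X.diag s| ≤ b) (σ : Fin (n + 2) → C) :
    |X.drift f σ| ≤ B * ((n + 2) ^ 2 * (n + 1) ^ 2 * a + (n + 2) * (n + 1) * b) := by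
  have hn : (0 : ℝ) ≤ n := Nat.cast_nonneg n
  unfold GaussianPath.drift
  rw [abs_mul]
  refine mul_le_mul (hf _) ((abs_add_le _ _).trans (add_le_add ?_ ?_)) (abs_nonneg _)
    ((abs_nonneg _).trans (hf fun k => σ k.castSucc.castSucc))
  · calc |∑ k, ∑ l, driftU n k * driftV n l * X.cov (σ k) (σ l)|
        ≤ ∑ k : Fin (n + 2), ∑ l : Fin (n + 2), ((n : ℝ) + 1) * (n + 1) * a := by
          refine (Finset.abs_sum_le_sum_abs _ _).trans (Finset.sum_le_sum fun k _ =>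
            (Finset.abs_sum_le_sum_abs _ _).trans (Finset.sum_le_sum fun l _ => ?_))
          rw [abs_mul, abs_mul]
          exact mul_le_mul (mul_le_mul (abs_driftU_le k) (abs_driftV_le l) (abs_nonneg _)
            (by linarith)) (ha _ _) (abs_nonneg _) (by positivity)
      _ = _ := by simp; ring
  · calc |∑ k, driftU n k * X.diag (σ k)| ≤ ∑ k : Fin (n + 2), ((n : ℝ) + 1) * b := by
          refine (Finset.abs_sum_le_sum_abs _ _).trans (Finset.sum_le_sum fun k _ => ?_)
          rw [abs_mul]
          exact mul_le_mul (abs_driftU_le k) (hb _) (abs_nonneg _) (by linarith)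
      _ = _ := by simp; ring

/-! ### Dependence of the one-spin averages on the parameters p and q -/

section Cavity

variable (P : Params) (p q : ℝ)

/-- The exponent of the cavity weight. -/
def cavityExponent (η : ℝ) (s : Spin P.S) : ℝ :=
  s.val * (P.β * η * √q) + P.β ^ 2 / 2 * (p - q) * s.val ^ 2 + P.D * s.val ^ 2 + P.h * s.val

theorem continuous_cavityExponent (s : Spin P.S) :
    Continuous fun η => cavityExponent P p q η s := by
  unfold cavityExponent; fun_prop

theorem nu0_eq {n : ℕ} (φ : (Fin n → ℝ) → ℝ) :
    nu0 P p q φ = ∫ η, gibbsAvg (cavityExponent P p q η)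
      (fun ε : Fin n → Spin P.S => φ fun k => (ε k).val) ∂(gaussianReal 0 1) :=
  rfl

theorem abs_nu0_le {n : ℕ} {φ : (Fin n → ℝ) → ℝ} {K : ℝ}
    (h : ∀ ε : Fin n → Spin P.S, |φ fun k => (ε k).val| ≤ K) : |nu0 P p q φ| ≤ K := by
  rw [nu0_eq, ← Real.norm_eq_abs]
  refine (norm_integral_le_of_norm_le_const (C := K) (ae_of_all _ fun η =>
    abs_gibbsAvg_le _ h)).trans_eq ?_
  simp

/-- The Gaussian path from the cavity weights with parameters `(p', q')` to those with parameters
`(p, q)`. -/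
def cavityParamPath (p' q' : ℝ) (hq : 0 ≤ q) (hq' : 0 ≤ q') : GaussianPath Bool (Spin P.S) where
  c θ b s := if b then Real.sin θ * (P.β * √q * s.val) else Real.cos θ * (P.β * √q' * s.val)
  c' θ b s := if b then Real.cos θ * (P.β * √q * s.val) else -Real.sin θ * (P.β * √q' * s.val)
  d θ s := P.D * s.val ^ 2 + P.h * s.val + P.β ^ 2 / 2 *
    (Real.sin θ ^ 2 * (p - q) + Real.cos θ ^ 2 * (p' - q')) * s.val ^ 2
  bound := |P.β| * (√q + √q') * P.S
  cov s t := P.β ^ 2 * (q - q') * (s.val * t.val)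
  diag s := P.β ^ 2 * ((p - q) - (p' - q')) * (s.val * s.val)
  hasDerivAt_c θ b s := by
    cases b
    · simpa using (Real.hasDerivAt_cos θ).mul_const _
    · simpa using (Real.hasDerivAt_sin θ).mul_const _
  hasDerivAt_d θ s := by
    have h1 := (((Real.hasDerivAt_sin θ).pow 2).mul_const (p - q)).add
      (((Real.hasDerivAt_cos θ).pow 2).mul_const (p' - q'))
    refine (((h1.const_mul (P.β ^ 2 / 2)).mul_const (s.val ^ 2)).const_add
      (P.D * s.val ^ 2 + P.h * s.val)).congr_deriv ?_
    norm_num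
    ring
  abs_c'_le θ b s := by
    have hs := s.abs_val_le
    have hS : (0 : ℝ) ≤ P.S := Nat.cast_nonneg _
    have key : ∀ a r r' : ℝ, |a| ≤ 1 → 0 ≤ r → 0 ≤ r' →
        |a * (P.β * r * s.val)| ≤ |P.β| * (r + r') * P.S := by
      intro a r r' ha hr hr'
      rw [abs_mul, abs_mul, abs_mul, abs_of_nonneg hr]
      calc |a| * (|P.β| * r * |s.val|) ≤ 1 * (|P.β| * r * P.S) := by gcongr
        _ ≤ |P.β| * (r + r') * P.S := by rw [one_mul]; gcongr; linarith
    cases b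
    · have := key (-Real.sin θ) (√q') (√q) (by rw [abs_neg]; exact Real.abs_sin_le_one θ)
        (Real.sqrt_nonneg _) (Real.sqrt_nonneg _)
      simpa [add_comm] using this
    · have := key (Real.cos θ) (√q) (√q') (Real.abs_cos_le_one θ)
        (Real.sqrt_nonneg _) (Real.sqrt_nonneg _)
      simpa using this
  sum_c' θ s t := by
    simp only [Fintype.sum_bool, if_true, Bool.false_eq_true, if_false]
    have h1 := Real.mul_self_sqrt hq
    have h2 := Real.mul_self_sqrt hq'
    linear_combination (Real.sin θ * Real.cos θ * P.β ^ 2 * s.val * t.val) * h1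
      - (Real.sin θ * Real.cos θ * P.β ^ 2 * s.val * t.val) * h2

theorem cavityParamPath_avg_zero {n : ℕ} (p' q' : ℝ) (hq : 0 ≤ q) (hq' : 0 ≤ q')
    (φ : (Fin n → ℝ) → ℝ) :
    (cavityParamPath P p q p' q' hq hq').avg 0 (fun ε => φ fun k => (ε k).val)
      = nu0 P p' q' φ := by
  have h : ∀ z, (cavityParamPath P p q p' q' hq hq').energy 0 z
      = cavityExponent P p' q' (z false) := by
    intro z; funext s
    simp [GaussianPath.energy, cavityParamPath, cavityExponent]
    ring
  unfold GaussianPath.avg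
  simp_rw [h]
  have mp := measurePreserving_eval (fun _ : Bool => gaussianReal 0 1) false
  rw [nu0_eq, ← mp.map_eq, integral_map mp.measurable.aemeasurable]
  exact (continuous_gibbsAvg (continuous_cavityExponent P p' q') _).aestronglyMeasurable

theorem cavityParamPath_avg_pi_div_two {n : ℕ} (p' q' : ℝ) (hq : 0 ≤ q) (hq' : 0 ≤ q')
    (φ : (Fin n → ℝ) → ℝ) :
    (cavityParamPath P p q p' q' hq hq').avg (Real.pi / 2) (fun ε => φ fun k => (ε k).val)
      = nu0 P p q φ := by
  have h : ∀ z, (cavityParamPath P p q p' q' hq hq').energy (Real.pi / 2) z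
      = cavityExponent P p q (z true) := by
    intro z; funext s
    simp [GaussianPath.energy, cavityParamPath, cavityExponent]
    ring
  unfold GaussianPath.avg
  simp_rw [h]
  have mp := measurePreserving_eval (fun _ : Bool => gaussianReal 0 1) true
  rw [nu0_eq, ← mp.map_eq, integral_map mp.measurable.aemeasurable]
  exact (continuous_gibbsAvg (continuous_cavityExponent P p q) _).aestronglyMeasurable

/-- Along `cavityParamPath` the covariance and the diagonal change at rates β² times differences of
the parameters. The drift, and hence the Lipschitz constant, is of order β². -/
theorem abs_nu0_sub_nu0_le {n : ℕ} {p' q' δ : ℝ} (hq : 0 ≤ q) (hq' : 0 ≤ q')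
    (hp : |p - p'| ≤ δ) (hqq : |q - q'| ≤ δ) {φ : (Fin n → ℝ) → ℝ} {B : ℝ}
    (hφ : ∀ ε : Fin n → Spin P.S, |φ fun k => (ε k).val| ≤ B) :
    |nu0 P p q φ - nu0 P p' q' φ| ≤ B * ((n + 2) ^ 2 * (n + 1) ^ 2 * (P.β ^ 2 * δ * P.S ^ 2)
      + (n + 2) * (n + 1) * (P.β ^ 2 * (2 * δ) * P.S ^ 2)) := by
  rw [← cavityParamPath_avg_zero P p q p' q' hq hq',
    ← cavityParamPath_avg_pi_div_two P p q p' q' hq hq']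
  have hδ : 0 ≤ δ := (abs_nonneg _).trans hp
  refine GaussianPath.abs_avg_sub_avg_le _ (fun θ _ => ?_) GaussianPath.zero_mem
    GaussianPath.pi_div_two_mem
  refine (GaussianPath.abs_avg_le _ θ (g := fun _ => _)
    (GaussianPath.abs_drift_le _ hφ ?_ ?_)).trans_eq (GaussianPath.avg_const _ θ _)
  · intro s t
    simp only [cavityParamPath, abs_mul (P.β ^ 2 * (q - q')), abs_mul (P.β ^ 2),
      abs_of_nonneg (sq_nonneg P.β)]
    exact mul_le_mul (mul_le_mul_of_nonneg_left hqq (sq_nonneg _))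
      (Spin.abs_val_mul_val_le s t) (abs_nonneg _) (by positivity)
  · intro s
    have h2 : |(p - q) - (p' - q')| ≤ 2 * δ := by
      rw [show (p - q) - (p' - q') = (p - p') - (q - q') by ring]
      exact (abs_sub _ _).trans (by linarith)
    simp only [cavityParamPath, abs_mul (P.β ^ 2 * ((p - q) - (p' - q'))), abs_mul (P.β ^ 2),
      abs_of_nonneg (sq_nonneg P.β)]
    exact mul_le_mul (mul_le_mul_of_nonneg_left h2 (sq_nonneg _))
      (Spin.abs_val_mul_val_le s s) (abs_nonneg _) (by positivity)

/-- Given η the two spins are independent with the same law, so the inner average is the square of a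
mean. -/
theorem nu0_mul_nonneg : 0 ≤ nu0 P p q fun ε : Fin 2 → ℝ => ε 0 * ε 1 := by
  rw [nu0_eq]
  refine integral_nonneg fun η => ?_
  have h := Finset.prod_univ_sum (fun _ : Fin 2 => (Finset.univ : Finset (Spin P.S)))
    fun _ s => gibbsProb (cavityExponent P p q η) s * s.val
  simp only [Finset.prod_const, Finset.card_univ, Fintype.card_fin, Fintype.piFinset_univ,
    Finset.prod_mul_distrib] at h
  unfold gibbsAvg
  simp only [Pi.zero_apply]
  have h2 : ∑ σ : Fin 2 → Spin P.S, (∏ k, gibbsProb (cavityExponent P p q η) (σ k)) *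
      ((σ 0).val * (σ 1).val) = (∑ s, gibbsProb (cavityExponent P p q η) s * s.val) ^ 2 := by
    rw [h]
    refine Finset.sum_congr rfl fun σ _ => ?_
    rw [Fin.prod_univ_two (fun k => (σ k).val)]
  rw [h2]
  exact sq_nonneg _

end Cavity

theorem IsReplicaSymmetric.nonneg {P : Params} {p q : ℝ} (h : IsReplicaSymmetric P p q) :
    0 ≤ q := h.2 ▸ nu0_mul_nonneg P p q

theorem IsReplicaSymmetric.abs_le {P : Params} {p q : ℝ} (h : IsReplicaSymmetric P p q) :
    |p| ≤ (P.S : ℝ) ^ 2 ∧ |q| ≤ (P.S : ℝ) ^ 2 := by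
  constructor
  · rw [h.1]
    exact abs_nu0_le P p q fun ε => by rw [sq]; exact Spin.abs_val_mul_val_le _ _
  · rw [h.2]
    exact abs_nu0_le P p q fun ε => Spin.abs_val_mul_val_le _ _

/-- The replica symmetric equations have exactly one solution at high temperature. -/
theorem existsUnique_isReplicaSymmetric (P : Params) (hβ : 336 * (P.S : ℝ) ^ 4 * P.β ^ 2 ≤ 1) :
    ∃ p q : ℝ, IsReplicaSymmetric P p q ∧
      ∀ p' q' : ℝ, IsReplicaSymmetric P p' q' → p' = p ∧ q' = q := by
  -- Clipping q at 0 gives a self-map of the complete space ℝ² while keeping the variance of the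
  -- cavity field nonnegative. No solution is gained or lost, because the second equation forces q
  -- to be nonnegative.
  let Φ : ℝ × ℝ → ℝ × ℝ := fun x =>
    (nu0 P x.1 (max x.2 0) fun ε : Fin 1 → ℝ => ε 0 ^ 2,
      nu0 P x.1 (max x.2 0) fun ε : Fin 2 → ℝ => ε 0 * ε 1)
  have hΦ : ContractingWith (1 / 2) Φ := by
    refine ⟨by rw [← NNReal.coe_lt_coe]; norm_num, LipschitzWith.of_dist_le_mul fun x y => ?_⟩
    have hd : 0 ≤ dist x y := dist_nonneg
    have h1 : |x.1 - y.1| ≤ dist x y := by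
      rw [← Real.dist_eq, Prod.dist_eq]; exact le_max_left _ _
    have h2 : |max x.2 0 - max y.2 0| ≤ dist x y := by
      refine (abs_max_sub_max_le_abs _ _ _).trans ?_
      rw [← Real.dist_eq, Prod.dist_eq]; exact le_max_right _ _
    -- The Lipschitz constants are 48 S⁴β² for one replica and (144 + 24) S⁴β² = 168 S⁴β² for two.
    -- The hypothesis with 336 = 2 · 168 makes both at most 1/2.
    have hb := mul_le_mul_of_nonneg_right hβ hd
    have hpos : 0 ≤ (P.S : ℝ) ^ 4 * P.β ^ 2 * dist x y := by positivity
    rw [Prod.dist_eq]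
    push_cast
    refine max_le ?_ ?_
    · rw [Real.dist_eq]
      refine (abs_nu0_sub_nu0_le P _ _ (le_max_right _ _) (le_max_right _ _) h1 h2
        (B := (P.S : ℝ) ^ 2) fun ε => by rw [sq]; exact Spin.abs_val_mul_val_le _ _).trans ?_
      norm_num
      nlinarith
    · rw [Real.dist_eq]
      refine (abs_nu0_sub_nu0_le P _ _ (le_max_right _ _) (le_max_right _ _) h1 h2
        (B := (P.S : ℝ) ^ 2) fun ε => Spin.abs_val_mul_val_le _ _).trans ?_
      norm_num
      nlinarith
  have hfix : ∀ p q : ℝ, IsReplicaSymmetric P p q ↔ Function.IsFixedPt Φ (p, q) := by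
    intro p q
    constructor
    · intro h
      have hq := h.nonneg
      refine Prod.ext ?_ ?_
      · simp only [Φ, max_eq_left hq]; exact h.1.symm
      · simp only [Φ, max_eq_left hq]; exact h.2.symm
    · intro h
      have h1 : nu0 P p (max q 0) (fun ε : Fin 1 → ℝ => ε 0 ^ 2) = p := congrArg Prod.fst h
      have h2 : nu0 P p (max q 0) (fun ε : Fin 2 → ℝ => ε 0 * ε 1) = q := congrArg Prod.snd h
      have hq : 0 ≤ q := h2 ▸ nu0_mul_nonneg P p (max q 0)
      rw [max_eq_left hq] at h1 h2
      exact ⟨h1.symm, h2.symm⟩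
  refine ⟨(hΦ.fixedPoint Φ).1, (hΦ.fixedPoint Φ).2, (hfix _ _).2 hΦ.fixedPoint_isFixedPt,
    fun p' q' h => ?_⟩
  have := hΦ.fixedPoint_unique ((hfix p' q').1 h)
  rw [← this]
  exact ⟨rfl, rfl⟩

end GhatakSherrington

end

noncomputable section

namespace GhatakSherrington

/-! ### The cavity interpolation at a site -/

section Overlaps

variable {N S n : ℕ}

/-- The product of the spins at site `i` of the replicas `k` and `l`. -/
def spinProduct (i : Fin N) (σ : Fin n → Config N S) (k l : Fin n) : ℝ :=
  (σ k i).val * (σ l i).val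

/-- The centering constants of the overlaps. -/
def rsParam (p q : ℝ) (k l : Fin n) : ℝ := if k = l then p else q

/-- The centered overlap of the replicas `k` and `l`. -/
def overlap (p q : ℝ) (σ : Fin n → Config N S) (k l : Fin n) : ℝ :=
  1 / (N : ℝ) * ∑ i, spinProduct i σ k l - rsParam p q k l

/-- The centered overlap of the replicas `k` and `l` without the contribution of site `i`. -/
def cavityOverlap (p q : ℝ) (i : Fin N) (σ : Fin n → Config N S) (k l : Fin n) : ℝ :=
  overlap p q σ k l - spinProduct i σ k l / N

/-- The configuration with the spin at site `i` replaced by `0`. -/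
def eraseSpin (i : Fin N) (σ : Config N S) : Config N S := Function.update σ i ⟨0, by simp⟩

@[simp] theorem eraseSpin_self (i : Fin N) (σ : Config N S) : (eraseSpin i σ i).val = 0 := by
  simp [eraseSpin, Spin.val]

theorem eraseSpin_of_ne {i j : Fin N} (h : j ≠ i) (σ : Config N S) : eraseSpin i σ j = σ j := by
  simp [eraseSpin, h]

/-- The spin at site i does not enter the cavity overlap, which may therefore serve as the decoupled
factor at angle 0. -/
theorem cavityOverlap_eraseSpin (p q : ℝ) (i : Fin N) (σ : Fin n → Config N S) (k l : Fin n) :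
    cavityOverlap p q i (fun m => eraseSpin i (σ m)) k l = cavityOverlap p q i σ k l := by
  unfold cavityOverlap overlap
  rw [← Finset.add_sum_erase _ (fun j => spinProduct j σ k l) (Finset.mem_univ i),
    ← Finset.add_sum_erase _ (fun j => spinProduct j (fun m => eraseSpin i (σ m)) k l)
      (Finset.mem_univ i)]
  have h : ∀ j ∈ Finset.univ.erase i, spinProduct j (fun m => eraseSpin i (σ m)) k l
      = spinProduct j σ k l := fun j hj => by
    simp only [spinProduct, eraseSpin_of_ne (Finset.ne_of_mem_erase hj)]
  rw [Finset.sum_congr rfl h]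
  simp only [spinProduct, eraseSpin_self]
  ring

end Overlaps

/-- The pairs of sites. -/
abbrev Edge (N : ℕ) : Type := {e : Fin N × Fin N // e.1 < e.2}

/-- Each site j ≠ i lies on exactly one edge with i. Applied to products of spins of two
configurations, this turns the covariance of the couplings at i into an overlap without site i. -/
theorem sum_edge_incident {N : ℕ} (i : Fin N) (x : Fin N → ℝ) :
    ∑ e : Edge N, (if e.1.1 = i ∨ e.1.2 = i then x e.1.1 * x e.1.2 else 0)
      = x i * (∑ j, x j - x i) := by
  classical
  have h1 : ∑ e : Edge N, (if e.1.1 = i ∨ e.1.2 = i then x e.1.1 * x e.1.2 else 0)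
      = ∑ e ∈ (Finset.univ : Finset (Fin N × Fin N)).filter (fun e => e.1 < e.2),
        (if e.1 = i ∨ e.2 = i then x e.1 * x e.2 else 0) :=
    (Finset.sum_subtype _ (fun e => by simp)
      fun e : Fin N × Fin N => if e.1 = i ∨ e.2 = i then x e.1 * x e.2 else 0).symm
  rw [h1, Finset.sum_filter, Fintype.sum_prod_type]
  have h2 : ∀ a b : Fin N,
      (if a < b then (if a = i ∨ b = i then x a * x b else 0) else 0)
      = (if a = i then (if i < b then x i * x b else 0) else 0)
        + (if b = i then (if a < i then x a * x i else 0) else 0) := by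
    intro a b
    by_cases ha : a = i
    · subst ha
      by_cases hb : b = a
      · subst hb; simp
      · simp [hb]
    · by_cases hb : b = i
      · subst hb; simp [ha]
      · simp [ha, hb]
  simp only [h2, Finset.sum_add_distrib, Finset.sum_ite_eq', Finset.mem_univ, if_true]
  rw [Finset.sum_comm]
  simp only [Finset.sum_ite_eq', Finset.mem_univ, if_true]
  rw [← Finset.sum_add_distrib, mul_sub, Finset.mul_sum, ← Finset.sum_erase_eq_sub (Finset.mem_univ i),
    ← Finset.add_sum_erase _ _ (Finset.mem_univ i)]
  simp only [lt_irrefl, if_false, add_zero, zero_add]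
  refine Finset.sum_congr rfl fun j hj => ?_
  rcases lt_or_gt_of_ne (Finset.ne_of_mem_erase hj) with h | h
  · simp [h, not_lt.2 h.le, mul_comm]
  · simp [h, not_lt.2 h.le]

/-! ### The decoupling path and its drift -/

section Path

variable (P : Params) (p q : ℝ) {N : ℕ}

theorem cast_pos_of_fin (i : Fin N) : (0 : ℝ) < N := by
  exact_mod_cast (Nat.zero_le _).trans_lt i.isLt

/-- The interpolation which decouples the spin at site `i` from the others at angle `0`. -/
def cavityPath (hq : 0 ≤ q) (i : Fin N) : GaussianPath (Option (Edge N)) (Config N P.S) where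
  c θ j σ := j.elim (Real.cos θ * (P.β * √q * (σ i).val)) fun e =>
    (if e.1.1 = i ∨ e.1.2 = i then Real.sin θ else 1) *
      (P.β / √(N : ℝ) * ((σ e.1.1).val * (σ e.1.2).val))
  c' θ j σ := j.elim (-Real.sin θ * (P.β * √q * (σ i).val)) fun e =>
    (if e.1.1 = i ∨ e.1.2 = i then Real.cos θ else 0) *
      (P.β / √(N : ℝ) * ((σ e.1.1).val * (σ e.1.2).val))
  d θ σ := P.D * ∑ j, (σ j).val ^ 2 + P.h * ∑ j, (σ j).val
    + Real.cos θ ^ 2 * (P.β ^ 2 / 2 * (p - q) * (σ i).val ^ 2)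
  bound := |P.β| * √q * P.S + |P.β| / √(N : ℝ) * P.S ^ 2
  cov σ τ := P.β ^ 2 * ((σ i).val * (τ i).val) *
    (1 / (N : ℝ) * ∑ j, (σ j).val * (τ j).val - q - (σ i).val * (τ i).val / N)
  -- The covariance is centered at q even for σ = τ. This term moves the centering of self-overlaps
  -- from q to p.
  diag σ := -(P.β ^ 2 * (p - q) * ((σ i).val * (σ i).val))
  hasDerivAt_c θ j σ := by
    cases j with
    | none => simpa using (Real.hasDerivAt_cos θ).mul_const _
    | some e =>
      by_cases h : e.1.1 = i ∨ e.1.2 = i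
      · simpa [h] using (Real.hasDerivAt_sin θ).mul_const _
      · simpa [h] using hasDerivAt_const θ _
  hasDerivAt_d θ σ := by
    refine ((((Real.hasDerivAt_cos θ).pow 2).mul_const _).const_add
      (P.D * ∑ j, (σ j).val ^ 2 + P.h * ∑ j, (σ j).val)).congr_deriv ?_
    norm_num
    ring
  abs_c'_le θ j σ := by
    have hS : (0 : ℝ) ≤ P.S := Nat.cast_nonneg _
    have h0 : 0 ≤ |P.β| * √q * P.S := by positivity
    have h1 : 0 ≤ |P.β| / √(N : ℝ) * P.S ^ 2 := by positivity
    cases j with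
    | none =>
      refine le_trans ?_ (le_add_of_nonneg_right h1)
      simp only [Option.elim_none, abs_mul, abs_neg, abs_of_nonneg (Real.sqrt_nonneg q)]
      calc |Real.sin θ| * (|P.β| * √q * |(σ i).val|) ≤ 1 * (|P.β| * √q * P.S) := by
            gcongr
            · exact Real.abs_sin_le_one θ
            · exact Spin.abs_val_le _
        _ = _ := one_mul _
    | some e =>
      refine le_trans ?_ (le_add_of_nonneg_left h0)
      simp only [Option.elim_some]
      rw [abs_mul, abs_mul, abs_div, abs_of_nonneg (Real.sqrt_nonneg (N : ℝ))]
      calc _ ≤ 1 * (|P.β| / √(N : ℝ) * P.S ^ 2) := by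
            gcongr
            · split_ifs
              · exact Real.abs_cos_le_one θ
              · simp
            · exact Spin.abs_val_mul_val_le _ _
        _ = _ := one_mul _
  sum_c' θ σ τ := by
    have hN := cast_pos_of_fin i
    have hsq : (P.β / √(N : ℝ)) * (P.β / √(N : ℝ)) = P.β ^ 2 / N := by
      rw [div_mul_div_comm, Real.mul_self_sqrt hN.le, sq]
    rw [Fintype.sum_option]
    simp only [Option.elim_none, Option.elim_some]
    have h : ∀ e : Edge N, (if e.1.1 = i ∨ e.1.2 = i then Real.cos θ else 0) *
        (P.β / √(N : ℝ) * ((σ e.1.1).val * (σ e.1.2).val)) *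
        ((if e.1.1 = i ∨ e.1.2 = i then Real.sin θ else 1) *
        (P.β / √(N : ℝ) * ((τ e.1.1).val * (τ e.1.2).val)))
        = Real.sin θ * Real.cos θ * (P.β ^ 2 / N) *
          (if e.1.1 = i ∨ e.1.2 = i then ((σ e.1.1).val * (τ e.1.1).val) *
            ((σ e.1.2).val * (τ e.1.2).val) else 0) := by
      intro e
      rw [← hsq]
      split_ifs <;> ring
    simp only [h]
    rw [← Finset.mul_sum, sum_edge_incident i fun j => (σ j).val * (τ j).val]
    have hqq := Real.mul_self_sqrt hq
    field_simp
    linear_combination (-N * P.β ^ 2 * Real.sin θ * Real.cos θ * (σ i).val * (τ i).val) * hqq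

variable (hq : 0 ≤ q) (i : Fin N)

theorem cavityPath_energy_pi_div_two (z : Option (Edge N) → ℝ) :
    (cavityPath P p q hq i).energy (Real.pi / 2) z
      = hamiltonian P fun e : Edge N => z (some e) := by
  funext σ
  simp only [GaussianPath.energy, cavityPath, hamiltonian, Fintype.sum_option, Option.elim_none,
    Option.elim_some, Real.cos_pi_div_two, Real.sin_pi_div_two, ite_self, Finset.mul_sum]
  norm_num
  rw [← add_assoc]
  congr 2
  exact Finset.sum_congr rfl fun e _ => by ring

/-- At angle `π / 2` the average is the one of the model. -/
theorem cavityPath_avg_pi_div_two {n : ℕ} (f : (Fin n → Config N P.S) → ℝ) :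
    (cavityPath P p q hq i).avg (Real.pi / 2) f = nu P fun _ => f := by
  unfold GaussianPath.avg nu
  simp_rw [cavityPath_energy_pi_div_two]
  have mp := measurePreserving_comp_gaussianPi (J := Option (Edge N)) (some : Edge N → _)
    (Option.some_injective _)
  change _ = ∫ g, gibbsAvg (hamiltonian P g) f ∂(gaussianPi (Edge N))
  rw [← mp.map_eq, integral_map mp.measurable.aemeasurable]
  refine (continuous_gibbsAvg (fun s => ?_) f).aestronglyMeasurable
  unfold hamiltonian
  fun_prop

/-- At angle 0 the couplings at site i vanish and the Gaussian `z none` plays the role of η, so the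
energy splits into the cavity exponent and a function of the other spins. -/
theorem cavityPath_energy_zero (z : Option (Edge N) → ℝ) (σ : Config N P.S) :
    (cavityPath P p q hq i).energy 0 z σ = cavityExponent P p q (z none) (σ i)
      + (cavityPath P p q hq i).energy 0 z (eraseSpin i σ) := by
  simp only [GaussianPath.energy, cavityPath, cavityExponent, Fintype.sum_option,
    Option.elim_none, Option.elim_some, Real.cos_zero, Real.sin_zero, eraseSpin_self]
  have h : ∀ e : Edge N, z (some e) * ((if e.1.1 = i ∨ e.1.2 = i then 0 else 1) *
        (P.β / √(N : ℝ) * ((eraseSpin i σ e.1.1).val * (eraseSpin i σ e.1.2).val)))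
      = z (some e) * ((if e.1.1 = i ∨ e.1.2 = i then 0 else 1) *
        (P.β / √(N : ℝ) * ((σ e.1.1).val * (σ e.1.2).val))) := by
    intro e
    by_cases he : e.1.1 = i ∨ e.1.2 = i
    · simp [he]
    · rw [not_or] at he
      rw [eraseSpin_of_ne he.1, eraseSpin_of_ne he.2]
  have h2 : ∀ r : ℕ, r ≠ 0 →
      ∑ j, (σ j).val ^ r = (σ i).val ^ r + ∑ j, (eraseSpin i σ j).val ^ r := by
    intro r hr
    rw [← Finset.add_sum_erase _ (fun j => (σ j).val ^ r) (Finset.mem_univ i),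
      ← Finset.add_sum_erase _ (fun j => (eraseSpin i σ j).val ^ r) (Finset.mem_univ i)]
    simp only [eraseSpin_self, zero_pow hr, zero_add]
    congr 1
    refine Finset.sum_congr rfl fun j hj => ?_
    rw [eraseSpin_of_ne (Finset.ne_of_mem_erase hj)]
  have h21 := h2 1 one_ne_zero
  simp only [pow_one] at h21
  simp only [h]
  rw [h2 2 two_ne_zero, h21]
  ring

theorem cavityPath_energy_zero_eraseSpin_update (z : Option (Edge N) → ℝ) (x : ℝ)
    (σ : Config N P.S) :
    (cavityPath P p q hq i).energy 0 (Function.update z none x) (eraseSpin i σ)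
      = (cavityPath P p q hq i).energy 0 z (eraseSpin i σ) := by
  simp [GaussianPath.energy, cavityPath, Fintype.sum_option]

/-- At angle `0` the spin at site `i` is independent of the other spins. -/
theorem cavityPath_avg_zero_mul {n : ℕ} (φ : (Fin n → ℝ) → ℝ) (Y : (Fin n → Config N P.S) → ℝ)
    (hY : ∀ σ, Y (fun k => eraseSpin i (σ k)) = Y σ) :
    (cavityPath P p q hq i).avg 0 (fun σ => φ (fun k => (σ k i).val) * Y σ)
      = nu0 P p q φ * (cavityPath P p q hq i).avg 0 Y := by
  classical
  set X := cavityPath P p q hq i with hX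
  let e := Equiv.funSplitAt i (Spin P.S)
  let o : Spin P.S := ⟨0, by simp⟩
  have he : ∀ σ : Config N P.S, e.symm (o, (e σ).2) = eraseSpin i σ := by
    intro σ
    funext j
    by_cases h : j = i
    · subst h; simp [e, o, eraseSpin]
    · simp [e, eraseSpin, h]
  let b : (Option (Edge N) → ℝ) → ({j // j ≠ i} → Spin P.S) → ℝ :=
    fun z ρ => X.energy 0 z (e.symm (o, ρ))
  let ψ : (Fin n → {j // j ≠ i} → Spin P.S) → ℝ := fun ρ => Y fun k => e.symm (o, ρ k)
  have hE : ∀ z, X.energy 0 z = fun σ => cavityExponent P p q (z none) (e σ).1 + b z (e σ).2 := by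
    intro z; funext σ
    simp only [b, he]
    exact cavityPath_energy_zero P p q hq i z σ
  have hψ : ∀ σ : Fin n → Config N P.S, ψ (fun k => (e (σ k)).2) = Y σ := by
    intro σ
    simp only [ψ, he, hY]
  -- For fixed disorder the additive energy makes the Gibbs measure a product, so the average
  -- factorizes. The disorder factorizes afterwards, since `z none` enters the first factor alone.
  have fac : ∀ (φ : (Fin n → ℝ) → ℝ) (z),
      gibbsAvg (X.energy 0 z) (fun σ => φ (fun k => (σ k i).val) * Y σ)
      = gibbsAvg (cavityExponent P p q (z none))
          (fun ε : Fin n → Spin P.S => φ fun k => (ε k).val) * gibbsAvg (b z) ψ := by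
    intro φ z
    rw [hE, ← gibbsAvg_factor e]
    congr 1
    funext σ
    rw [hψ]
    rfl
  have facY : ∀ z, gibbsAvg (X.energy 0 z) Y = gibbsAvg (b z) ψ := by
    intro z
    have := fac (fun _ => 1) z
    simp only [one_mul] at this
    rw [this]
    simp [gibbsAvg, sum_prod_gibbsProb]
  unfold GaussianPath.avg
  simp_rw [fac φ, ← facY]
  rw [integral_eval_mul_of_update (none : Option (Edge N)) (F := fun x =>
      gibbsAvg (cavityExponent P p q x) fun ε : Fin n → Spin P.S => φ fun k => (ε k).val)]
  · rfl
  · intro z x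
    rw [facY, facY]
    congr 1
    funext ρ
    simp only [b]
    have : e.symm (o, ρ) = eraseSpin i (e.symm (o, ρ)) := by rw [← he]; simp
    rw [this]
    exact cavityPath_energy_zero_eraseSpin_update P p q hq i z x _
  · exact continuous_gibbsAvg (continuous_cavityExponent P p q) _
  · exact continuous_gibbsAvg (X.continuous_energy 0) _

/-- Wherever `driftU` is nonzero, `driftV` equals 1. This lets the diagonal term be merged into the
double sum over pairs of replicas. -/
theorem driftU_mul_driftV_self {n : ℕ} (k : Fin (n + 2)) :
    driftU n k * driftV n k = driftU n k := by
  unfold driftU driftV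
  split_ifs <;> first | omega | simp

/-- The drift becomes linear in the cavity overlaps, each with its own centering: the diagonal part
has been absorbed into the terms k = l. This is why every derivative gains one small factor. -/
theorem cavityPath_drift {n : ℕ} (f : (Fin n → Config N P.S) → ℝ)
    (σ : Fin (n + 2) → Config N P.S) :
    (cavityPath P p q hq i).drift f σ = f (fun k => σ k.castSucc.castSucc) *
      (P.β ^ 2 * ∑ k, ∑ l, driftU n k * driftV n l *
        (spinProduct i σ k l * cavityOverlap p q i σ k l)) := by
  unfold GaussianPath.drift
  congr 1
  have h : ∀ k, driftU n k * (cavityPath P p q hq i).diag (σ k)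
      = ∑ l, if k = l then driftU n k * driftV n l * (cavityPath P p q hq i).diag (σ k) else 0 := by
    intro k
    rw [Finset.sum_ite_eq, if_pos (Finset.mem_univ k), driftU_mul_driftV_self]
  simp_rw [h]
  rw [← Finset.sum_add_distrib, Finset.mul_sum]
  refine Finset.sum_congr rfl fun k _ => ?_
  rw [← Finset.sum_add_distrib, Finset.mul_sum]
  refine Finset.sum_congr rfl fun l _ => ?_
  by_cases hkl : k = l
  · subst hkl
    simp only [if_true, cavityPath, spinProduct, cavityOverlap, overlap, rsParam]
    ring
  · simp only [hkl, if_false, cavityPath, spinProduct, cavityOverlap, overlap, rsParam]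
    ring

end Path

end GhatakSherrington

end

noncomputable section

namespace GhatakSherrington

/-! ### Moments of the overlaps -/

section ModelAvg

variable (P : Params) {N n : ℕ}

/-- `ν(f)` for a function `f` of the replicas. -/
def modelAvg (f : (Fin n → Config N P.S) → ℝ) : ℝ := nu P fun _ => f

theorem cavityPath_avg_end {p q : ℝ} (hq : 0 ≤ q) (i : Fin N) (f : (Fin n → Config N P.S) → ℝ) :
    (cavityPath P p q hq i).avg (Real.pi / 2) f = modelAvg P f :=
  cavityPath_avg_pi_div_two P p q hq i f

variable [NeZero N]

/-- Every cavity path ends at the model. The one with p = q = 0 at site 0 is picked only to inherit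
linearity and monotonicity. -/
theorem modelAvg_eq (f : (Fin n → Config N P.S) → ℝ) :
    modelAvg P f = (cavityPath P 0 0 le_rfl (0 : Fin N)).avg (Real.pi / 2) f :=
  (cavityPath_avg_end P le_rfl 0 f).symm

theorem modelAvg_add (f g : (Fin n → Config N P.S) → ℝ) :
    modelAvg P (fun σ => f σ + g σ) = modelAvg P f + modelAvg P g := by
  simp only [modelAvg_eq]; exact GaussianPath.avg_add _ _ f g

theorem modelAvg_sub (f g : (Fin n → Config N P.S) → ℝ) :
    modelAvg P (fun σ => f σ - g σ) = modelAvg P f - modelAvg P g := by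
  simp only [modelAvg_eq]; exact GaussianPath.avg_sub _ _ f g

theorem modelAvg_const_mul (a : ℝ) (f : (Fin n → Config N P.S) → ℝ) :
    modelAvg P (fun σ => a * f σ) = a * modelAvg P f := by
  simp only [modelAvg_eq]; exact GaussianPath.avg_const_mul _ _ a f

theorem modelAvg_sum {I : Type*} (t : Finset I) (f : I → (Fin n → Config N P.S) → ℝ) :
    modelAvg P (fun σ => ∑ i ∈ t, f i σ) = ∑ i ∈ t, modelAvg P (f i) := by
  simp only [modelAvg_eq]; exact GaussianPath.avg_sum _ _ t f

theorem modelAvg_const (a : ℝ) : modelAvg P (fun _ : Fin n → Config N P.S => a) = a := by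
  simp only [modelAvg_eq]; exact GaussianPath.avg_const _ _ a

theorem modelAvg_mono {f g : (Fin n → Config N P.S) → ℝ} (h : ∀ σ, f σ ≤ g σ) :
    modelAvg P f ≤ modelAvg P g := by
  simp only [modelAvg_eq]; exact GaussianPath.avg_mono _ _ h

theorem modelAvg_nonneg {f : (Fin n → Config N P.S) → ℝ} (h : ∀ σ, 0 ≤ f σ) :
    0 ≤ modelAvg P f := by
  have := modelAvg_mono P h; rwa [modelAvg_const] at this

theorem abs_modelAvg_le {f g : (Fin n → Config N P.S) → ℝ} (h : ∀ σ, |f σ| ≤ g σ) :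
    |modelAvg P f| ≤ modelAvg P g := by
  simp only [modelAvg_eq]; exact GaussianPath.abs_avg_le _ _ h

theorem modelAvg_comp_injective {m : ℕ} {ι : Fin m → Fin n} (hι : Function.Injective ι)
    (f : (Fin m → Config N P.S) → ℝ) :
    modelAvg P (fun σ : Fin n → Config N P.S => f (fun c => σ (ι c))) = modelAvg P f := by
  simp only [modelAvg_eq]; exact GaussianPath.avg_comp_injective _ _ hι f

end ModelAvg

section Bounds

variable {N S n : ℕ} (p q : ℝ)

theorem abs_spinProduct_le (i : Fin N) (σ : Fin n → Config N S) (k l : Fin n) :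
    |spinProduct i σ k l| ≤ (S : ℝ) ^ 2 := Spin.abs_val_mul_val_le _ _

variable {p q} in
theorem abs_rsParam_le (hp : |p| ≤ (S : ℝ) ^ 2) (hq : |q| ≤ (S : ℝ) ^ 2) (k l : Fin n) :
    |rsParam p q k l| ≤ (S : ℝ) ^ 2 := by
  unfold rsParam; split_ifs <;> assumption

theorem spinProduct_comp {m : ℕ} (ι : Fin m → Fin n) (i : Fin N)
    (σ : Fin n → Config N S) (k l : Fin m) :
    spinProduct i (fun c => σ (ι c)) k l = spinProduct i σ (ι k) (ι l) := rfl

theorem rsParam_comp {m : ℕ} {ι : Fin m → Fin n} (hι : Function.Injective ι) (k l : Fin m) :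
    rsParam p q (ι k) (ι l) = rsParam p q k l := by
  simp [rsParam, hι.eq_iff]

theorem overlap_comp {m : ℕ} {ι : Fin m → Fin n} (hι : Function.Injective ι)
    (σ : Fin n → Config N S) (k l : Fin m) :
    overlap p q (fun c => σ (ι c)) k l = overlap p q σ (ι k) (ι l) := by
  simp only [overlap, spinProduct_comp, rsParam_comp p q hι]

theorem cavityOverlap_comp {m : ℕ} {ι : Fin m → Fin n} (hι : Function.Injective ι) (i : Fin N)
    (σ : Fin n → Config N S) (k l : Fin m) :
    cavityOverlap p q i (fun c => σ (ι c)) k l = cavityOverlap p q i σ (ι k) (ι l) := by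
  simp only [cavityOverlap, overlap_comp p q hι, spinProduct_comp]

theorem overlap_eq_sum [NeZero N] (σ : Fin n → Config N S) (k l : Fin n) :
    overlap p q σ k l = 1 / (N : ℝ) * ∑ i, (spinProduct i σ k l - rsParam p q k l) := by
  have hN : (N : ℝ) ≠ 0 := Nat.cast_ne_zero.2 (NeZero.ne N)
  unfold overlap
  rw [Finset.sum_sub_distrib, Finset.sum_const, Finset.card_univ, Fintype.card_fin, nsmul_eq_mul]
  field_simp

theorem abs_cavityOverlap_sub_le (i : Fin N) (σ : Fin n → Config N S) (k l : Fin n) :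
    |overlap p q σ k l - cavityOverlap p q i σ k l| ≤ (S : ℝ) ^ 2 / N := by
  unfold cavityOverlap
  rw [sub_sub_cancel, abs_div, Nat.abs_cast]
  exact div_le_div_of_nonneg_right (abs_spinProduct_le i σ k l) (Nat.cast_nonneg N)

variable {p q} (hp : |p| ≤ (S : ℝ) ^ 2) (hq : |q| ≤ (S : ℝ) ^ 2)

include hp hq

theorem abs_overlap_le [NeZero N] (σ : Fin n → Config N S) (k l : Fin n) :
    |overlap p q σ k l| ≤ 2 * (S : ℝ) ^ 2 := by
  have hN : (0 : ℝ) < N := Nat.cast_pos.2 (NeZero.pos N)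
  rw [overlap_eq_sum, abs_mul, abs_of_nonneg (by positivity), one_div, inv_mul_le_iff₀ hN]
  refine (Finset.abs_sum_le_sum_abs _ _).trans ?_
  calc _ ≤ ∑ _i : Fin N, 2 * (S : ℝ) ^ 2 := Finset.sum_le_sum fun i _ => by
        have := abs_sub (spinProduct i σ k l) (rsParam p q k l)
        linarith [abs_spinProduct_le i σ k l, abs_rsParam_le hp hq k l]
    _ = _ := by simp

theorem abs_cavityOverlap_le (i : Fin N) (σ : Fin n → Config N S) (k l : Fin n) :
    |cavityOverlap p q i σ k l| ≤ 3 * (S : ℝ) ^ 2 := by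
  have hN1 : 1 ≤ N := (Nat.zero_le _).trans_lt i.isLt
  have : NeZero N := ⟨by omega⟩
  have h1 := abs_cavityOverlap_sub_le p q i σ k l
  have h2 := abs_overlap_le hp hq σ k l
  have h3 : (S : ℝ) ^ 2 / N ≤ (S : ℝ) ^ 2 := div_le_self (by positivity) (by exact_mod_cast hN1)
  have h4 := abs_sub_abs_le_abs_sub (cavityOverlap p q i σ k l) (overlap p q σ k l)
  rw [abs_sub_comm] at h4
  linarith

end Bounds

/-! ### Averages along the cavity path compared with averages in the model -/

section Comparison

/-- A bound for the logarithmic derivative of averages over `n` replicas along the cavity path. -/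
def cavityRate (S n : ℕ) : ℝ := 3 * ((n : ℝ) + 1) ^ 2 * (n + 2) ^ 2 * (S : ℝ) ^ 4

variable {P : Params} {p q : ℝ} {N n : ℕ} (hq : 0 ≤ q) (i : Fin N)

theorem abs_cavityPath_drift_le (f : (Fin n → Config N P.S) → ℝ)
    (σ : Fin (n + 2) → Config N P.S) :
    |(cavityPath P p q hq i).drift f σ| ≤ P.β ^ 2 * ((n + 1) ^ 2 * (P.S : ℝ) ^ 2) *
      (|f (fun k => σ k.castSucc.castSucc)| * ∑ k, ∑ l, |cavityOverlap p q i σ k l|) := by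
  rw [cavityPath_drift, abs_mul, abs_mul, abs_of_nonneg (sq_nonneg P.β)]
  have h : |∑ k, ∑ l, driftU n k * driftV n l *
      (spinProduct i σ k l * cavityOverlap p q i σ k l)|
      ≤ (n + 1) ^ 2 * (P.S : ℝ) ^ 2 * ∑ k, ∑ l, |cavityOverlap p q i σ k l| := by
    simp_rw [Finset.mul_sum]
    refine (Finset.abs_sum_le_sum_abs _ _).trans (Finset.sum_le_sum fun k _ =>
      (Finset.abs_sum_le_sum_abs _ _).trans (Finset.sum_le_sum fun l _ => ?_))
    rw [abs_mul, abs_mul, abs_mul, ← mul_assoc, sq ((n : ℝ) + 1)]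
    gcongr
    · exact abs_driftU_le k
    · exact abs_driftV_le l
    · exact abs_spinProduct_le i σ k l
  calc _ ≤ |f (fun k => σ k.castSucc.castSucc)| * (P.β ^ 2 * ((n + 1) ^ 2 * (P.S : ℝ) ^ 2 *
        ∑ k, ∑ l, |cavityOverlap p q i σ k l|)) := by gcongr
    _ = _ := by ring

variable (hβ : P.β ^ 2 ≤ 1) (hp : |p| ≤ (P.S : ℝ) ^ 2) (hqS : |q| ≤ (P.S : ℝ) ^ 2)

include hβ hp hqS

/-- The overlaps are bounded by a constant in S, so the drift of a nonnegative function is at most a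
multiple of it, uniformly in N. Bounds at intermediate angles thus reduce to bounds in the model. -/
theorem cavityPath_avg_le {f : (Fin n → Config N P.S) → ℝ} (hf : ∀ σ, 0 ≤ f σ) {θ : ℝ}
    (hθ : θ ∈ Set.Icc 0 (Real.pi / 2)) :
    (cavityPath P p q hq i).avg θ f ≤ Real.exp (cavityRate P.S n) * modelAvg P f := by
  rw [← cavityPath_avg_end P hq i]
  refine GaussianPath.avg_le_exp_mul_avg _ hf (by unfold cavityRate; positivity) (fun σ => ?_) hθ
  refine (abs_cavityPath_drift_le hq i f σ).trans ?_
  have h : ∑ k, ∑ l, |cavityOverlap p q i σ k l| ≤ (n + 2) ^ 2 * (3 * (P.S : ℝ) ^ 2) := by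
    calc _ ≤ ∑ _k : Fin (n + 2), ∑ _l : Fin (n + 2), 3 * (P.S : ℝ) ^ 2 :=
          Finset.sum_le_sum fun k _ => Finset.sum_le_sum fun l _ =>
            abs_cavityOverlap_le hp hqS i σ k l
      _ = _ := by simp; ring
  rw [abs_of_nonneg (hf _)]
  have h0 := hf fun k => σ k.castSucc.castSucc
  calc _ ≤ 1 * ((n + 1) ^ 2 * (P.S : ℝ) ^ 2) * (f (fun k => σ k.castSucc.castSucc) *
        ((n + 2) ^ 2 * (3 * (P.S : ℝ) ^ 2))) := by gcongr
    _ = _ := by unfold cavityRate; ring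

/-- Bound for the first derivative along the cavity path. -/
theorem abs_cavityPath_avg_drift_le {f g : (Fin n → Config N P.S) → ℝ} (hf : ∀ σ, |f σ| ≤ g σ)
    {M : ℝ} (hM : ∀ k l : Fin (n + 2), (modelAvg P fun σ : Fin (n + 2) → Config N P.S =>
      g (fun k => σ k.castSucc.castSucc) * |cavityOverlap p q i σ k l|) ≤ M)
    {θ : ℝ} (hθ : θ ∈ Set.Icc 0 (Real.pi / 2)) :
    |(cavityPath P p q hq i).avg θ ((cavityPath P p q hq i).drift f)|
      ≤ P.β ^ 2 * ((n + 1) ^ 2 * (n + 2) ^ 2 * (P.S : ℝ) ^ 2 *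
        Real.exp (cavityRate P.S (n + 2))) * M := by
  have hN1 : 1 ≤ N := (Nat.zero_le _).trans_lt i.isLt
  have : NeZero N := ⟨by omega⟩
  have hg : ∀ σ, 0 ≤ g σ := fun σ => (abs_nonneg _).trans (hf σ)
  have hs : ∀ σ : Fin (n + 2) → Config N P.S, 0 ≤ ∑ k, ∑ l, |cavityOverlap p q i σ k l| :=
    fun σ => Finset.sum_nonneg fun k _ => Finset.sum_nonneg fun l _ => abs_nonneg _
  refine (GaussianPath.abs_avg_le _ θ (abs_cavityPath_drift_le hq i f)).trans ?_
  rw [GaussianPath.avg_const_mul]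
  have h := cavityPath_avg_le hq i hβ hp hqS
    (f := fun σ : Fin (n + 2) → Config N P.S =>
      g (fun k => σ k.castSucc.castSucc) * ∑ k, ∑ l, |cavityOverlap p q i σ k l|)
    (fun σ => mul_nonneg (hg _) (hs σ)) hθ
  have h2 := GaussianPath.avg_mono (cavityPath P p q hq i) θ
    (f := fun σ : Fin (n + 2) → Config N P.S =>
      |f (fun k => σ k.castSucc.castSucc)| * ∑ k, ∑ l, |cavityOverlap p q i σ k l|)
    (g := fun σ : Fin (n + 2) → Config N P.S =>
      g (fun k => σ k.castSucc.castSucc) * ∑ k, ∑ l, |cavityOverlap p q i σ k l|)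
    (fun σ => mul_le_mul_of_nonneg_right (hf _) (hs σ))
  have h3 : (modelAvg P fun σ : Fin (n + 2) → Config N P.S =>
      g (fun k => σ k.castSucc.castSucc) * ∑ k, ∑ l, |cavityOverlap p q i σ k l|)
      ≤ (n + 2) ^ 2 * M := by
    simp_rw [Finset.mul_sum, modelAvg_sum]
    calc _ ≤ ∑ _k : Fin (n + 2), ∑ _l : Fin (n + 2), M :=
          Finset.sum_le_sum fun k _ => Finset.sum_le_sum fun l _ => hM k l
      _ = _ := by simp; ring
  calc _ ≤ P.β ^ 2 * ((n + 1) ^ 2 * (P.S : ℝ) ^ 2) *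
        (Real.exp (cavityRate P.S (n + 2)) * ((n + 2) ^ 2 * M)) :=
        mul_le_mul_of_nonneg_left ((h2.trans h).trans
          (mul_le_mul_of_nonneg_left h3 (Real.exp_pos _).le)) (by positivity)
    _ = _ := by ring

/-- Bound for the second derivative along the cavity path. -/
theorem abs_cavityPath_avg_drift_drift_le {f g : (Fin n → Config N P.S) → ℝ}
    (hf : ∀ σ, |f σ| ≤ g σ) {M : ℝ} (hM : ∀ (k l : Fin (n + 2)) (a b : Fin (n + 4)),
      (modelAvg P fun σ : Fin (n + 4) → Config N P.S =>
        g (fun m => σ m.castSucc.castSucc.castSucc.castSucc) *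
          |cavityOverlap p q i σ k.castSucc.castSucc l.castSucc.castSucc| *
          |cavityOverlap p q i σ a b|) ≤ M) {θ : ℝ} (hθ : θ ∈ Set.Icc 0 (Real.pi / 2)) :
    |(cavityPath P p q hq i).avg θ
      ((cavityPath P p q hq i).drift ((cavityPath P p q hq i).drift f))|
      ≤ ((n + 1) ^ 2 * (n + 2) ^ 2 * (n + 3) ^ 2 * (n + 4) ^ 2 * (P.S : ℝ) ^ 4 *
        Real.exp (cavityRate P.S (n + 4))) * M := by
  have hN1 : 1 ≤ N := (Nat.zero_le _).trans_lt i.isLt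
  have : NeZero N := ⟨by omega⟩
  have hg : ∀ σ, 0 ≤ g σ := fun σ => (abs_nonneg _).trans (hf σ)
  have hι : Function.Injective fun k : Fin (n + 2) => k.castSucc.castSucc :=
    (Fin.castSucc_injective _).comp (Fin.castSucc_injective _)
  have h1 : ∀ σ, |(cavityPath P p q hq i).drift f σ| ≤ ((n + 1) ^ 2 * (P.S : ℝ) ^ 2) *
      (g (fun k => σ k.castSucc.castSucc) * ∑ k, ∑ l, |cavityOverlap p q i σ k l|) := by
    intro σ
    refine (abs_cavityPath_drift_le hq i f σ).trans ?_
    have hs : 0 ≤ ∑ k, ∑ l, |cavityOverlap p q i σ k l| :=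
      Finset.sum_nonneg fun k _ => Finset.sum_nonneg fun l _ => abs_nonneg _
    calc _ ≤ 1 * ((n + 1) ^ 2 * (P.S : ℝ) ^ 2) *
          (g (fun k => σ k.castSucc.castSucc) * ∑ k, ∑ l, |cavityOverlap p q i σ k l|) := by
          gcongr
          exact hf _
      _ = _ := by ring
  have h2 : ∀ a b : Fin (n + 2 + 2), (modelAvg P fun σ : Fin (n + 2 + 2) → Config N P.S =>
      ((n + 1) ^ 2 * (P.S : ℝ) ^ 2) * (g (fun k => σ k.castSucc.castSucc.castSucc.castSucc) *
        ∑ k, ∑ l, |cavityOverlap p q i (fun k => σ k.castSucc.castSucc) k l|) *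
          |cavityOverlap p q i σ a b|)
      ≤ (n + 1) ^ 2 * (P.S : ℝ) ^ 2 * ((n + 2) ^ 2 * M) := by
    intro a b
    calc _ = (n + 1) ^ 2 * (P.S : ℝ) ^ 2 * ∑ k : Fin (n + 2), ∑ l : Fin (n + 2),
          modelAvg P fun σ : Fin (n + 4) → Config N P.S =>
            g (fun m => σ m.castSucc.castSucc.castSucc.castSucc) *
              |cavityOverlap p q i σ k.castSucc.castSucc l.castSucc.castSucc| *
              |cavityOverlap p q i σ a b| := by
          simp_rw [← modelAvg_sum, ← modelAvg_const_mul]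
          congr 1
          funext σ
          simp_rw [← Finset.sum_mul, ← Finset.mul_sum]
          simp only [cavityOverlap_comp p q hι]
          ring
      _ ≤ (n + 1) ^ 2 * (P.S : ℝ) ^ 2 * ∑ _k : Fin (n + 2), ∑ _l : Fin (n + 2), M := by
          gcongr
          exact hM _ _ a b
      _ = _ := by
          simp only [Finset.sum_const, Finset.card_univ, Fintype.card_fin, nsmul_eq_mul]
          push_cast
          ring
  refine (abs_cavityPath_avg_drift_le hq i hβ hp hqS h1 h2 hθ).trans ?_
  have hM0 : 0 ≤ M := (modelAvg_nonneg P fun σ => by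
    have := hg fun m => σ m.castSucc.castSucc.castSucc.castSucc
    positivity).trans (hM 0 0 0 0)
  calc _ ≤ 1 * (((n + 2 : ℕ) + 1) ^ 2 * ((n + 2 : ℕ) + 2) ^ 2 * (P.S : ℝ) ^ 2 *
        Real.exp (cavityRate P.S (n + 2 + 2))) * ((n + 1) ^ 2 * (P.S : ℝ) ^ 2 * ((n + 2) ^ 2 * M)) := by
        gcongr
    _ = _ := by push_cast; ring

end Comparison

/-! ### Absolute moments of the overlaps -/

section Moments

variable (P : Params) (p q : ℝ) (N : ℕ)

/-- The sum of the `r`-th absolute moments of the overlap and of the self-overlap. -/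
def overlapMoment (r : ℕ) : ℝ :=
  (modelAvg P fun σ : Fin 2 → Config N P.S => |overlap p q σ 0 1| ^ r)
    + modelAvg P fun σ : Fin 1 → Config N P.S => |overlap p q σ 0 0| ^ r

variable {P p q N} [NeZero N]

theorem modelAvg_abs_overlap_pow {n : ℕ} (k l : Fin n) (r : ℕ) :
    (modelAvg P fun σ : Fin n → Config N P.S => |overlap p q σ k l| ^ r)
      = if k = l then modelAvg P fun σ : Fin 1 → Config N P.S => |overlap p q σ 0 0| ^ r
        else modelAvg P fun σ : Fin 2 → Config N P.S => |overlap p q σ 0 1| ^ r := by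
  by_cases h : k = l
  · subst h
    have hι : Function.Injective (fun _ : Fin 1 => k) := Function.injective_of_subsingleton _
    rw [if_pos rfl, ← modelAvg_comp_injective P hι]
    simp only [overlap_comp p q hι]
  · have hι : Function.Injective ![k, l] := by
      intro a b; fin_cases a <;> fin_cases b <;> simp [h, Ne.symm h]
    rw [if_neg h, ← modelAvg_comp_injective P hι]
    simp only [overlap_comp p q hι]
    rfl

theorem overlapMoment_le {r : ℕ} {B : ℝ}
    (h : ∀ k l : Fin 2, (modelAvg P fun σ : Fin 2 → Config N P.S => |overlap p q σ k l| ^ r) ≤ B) :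
    overlapMoment P p q N r ≤ 2 * B := by
  have h1 := h 0 1
  have h2 := h 0 0
  rw [modelAvg_abs_overlap_pow, if_pos rfl] at h2
  unfold overlapMoment
  linarith

theorem overlapMoment_nonneg (r : ℕ) : 0 ≤ overlapMoment P p q N r :=
  add_nonneg (modelAvg_nonneg P fun _ => by positivity)
    (modelAvg_nonneg P fun _ => by positivity)

theorem modelAvg_abs_overlap_pow_le {n : ℕ} (k l : Fin n) (r : ℕ) :
    (modelAvg P fun σ : Fin n → Config N P.S => |overlap p q σ k l| ^ r)
      ≤ overlapMoment P p q N r := by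
  rw [modelAvg_abs_overlap_pow]
  unfold overlapMoment
  have h1 : 0 ≤ modelAvg P fun σ : Fin 1 → Config N P.S => |overlap p q σ 0 0| ^ r :=
    modelAvg_nonneg P fun _ => by positivity
  have h2 : 0 ≤ modelAvg P fun σ : Fin 2 → Config N P.S => |overlap p q σ 0 1| ^ r :=
    modelAvg_nonneg P fun _ => by positivity
  split_ifs <;> linarith

omit [NeZero N] in
theorem abs_cavityOverlap_pow_le {n : ℕ} (i : Fin N) (σ : Fin n → Config N P.S) (k l : Fin n)
    (r : ℕ) :
    |cavityOverlap p q i σ k l| ^ r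
      ≤ 2 ^ r * (|overlap p q σ k l| ^ r + ((P.S : ℝ) ^ 2 / N) ^ r) := by
  have h1 := abs_cavityOverlap_sub_le p q i σ k l
  have h4 := abs_sub_abs_le_abs_sub (cavityOverlap p q i σ k l) (overlap p q σ k l)
  rw [abs_sub_comm] at h4
  have h0 : (0 : ℝ) ≤ (P.S : ℝ) ^ 2 / N := by positivity
  calc _ ≤ (|overlap p q σ k l| + (P.S : ℝ) ^ 2 / N) ^ r := by gcongr; linarith
    _ ≤ 2 ^ (r - 1) * (|overlap p q σ k l| ^ r + ((P.S : ℝ) ^ 2 / N) ^ r) :=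
        add_pow_le (abs_nonneg _) h0 r
    _ ≤ _ := by
        gcongr
        · norm_num
        · omega

theorem modelAvg_abs_cavityOverlap_pow_le {n : ℕ} (i : Fin N) (k l : Fin n) (r : ℕ) :
    (modelAvg P fun σ : Fin n → Config N P.S => |cavityOverlap p q i σ k l| ^ r)
      ≤ 2 ^ r * (overlapMoment P p q N r + ((P.S : ℝ) ^ 2 / N) ^ r) := by
  refine (modelAvg_mono P fun σ => abs_cavityOverlap_pow_le i σ k l r).trans ?_
  rw [modelAvg_const_mul, modelAvg_add, modelAvg_const]
  gcongr
  exact modelAvg_abs_overlap_pow_le k l r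

end Moments

theorem nu0_comp_injective (P : Params) (p q : ℝ) {m n : ℕ} {ι : Fin m → Fin n}
    (hι : Function.Injective ι) (φ : (Fin m → ℝ) → ℝ) :
    (nu0 P p q fun ε : Fin n → ℝ => φ fun c => ε (ι c)) = nu0 P p q φ := by
  simp only [nu0_eq]
  simp_rw [gibbsAvg_comp_injective _ hι fun ε : Fin m → Spin P.S => φ fun k => (ε k).val]

/-- A path with equal end parameters is used only to inherit the linearity of path averages. -/
theorem nu0_eq_avg (P : Params) {p q : ℝ} (hq : 0 ≤ q) {n : ℕ} (φ : (Fin n → ℝ) → ℝ) :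
    nu0 P p q φ = (cavityParamPath P p q p q hq hq).avg 0
      (fun ε : Fin n → Spin P.S => φ fun k => (ε k).val) :=
  (cavityParamPath_avg_zero P p q p q hq hq φ).symm

section Nu0

variable {P : Params} {p q : ℝ} (hq : 0 ≤ q) {n : ℕ}

include hq

theorem nu0_sub (φ ψ : (Fin n → ℝ) → ℝ) :
    (nu0 P p q fun ε => φ ε - ψ ε) = nu0 P p q φ - nu0 P p q ψ := by
  simp only [nu0_eq_avg P hq]; exact GaussianPath.avg_sub _ _ _ _

theorem nu0_const_mul (a : ℝ) (φ : (Fin n → ℝ) → ℝ) :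
    (nu0 P p q fun ε => a * φ ε) = a * nu0 P p q φ := by
  simp only [nu0_eq_avg P hq]; exact GaussianPath.avg_const_mul _ _ _ _

theorem nu0_const (a : ℝ) : (nu0 P p q fun _ : Fin n → ℝ => a) = a := by
  simp only [nu0_eq_avg P hq]; exact GaussianPath.avg_const _ _ _

end Nu0

/-- The replica symmetric equations say that the centered spin products have mean zero. -/
theorem IsReplicaSymmetric.nu0_mul {P : Params} {p q : ℝ} (h : IsReplicaSymmetric P p q) {n : ℕ}
    (k l : Fin n) : (nu0 P p q fun ε => ε k * ε l) = rsParam p q k l := by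
  by_cases hkl : k = l
  · subst hkl
    have hι : Function.Injective (fun _ : Fin 1 => k) := Function.injective_of_subsingleton _
    have := nu0_comp_injective P p q hι fun ε => ε 0 ^ 2
    rw [rsParam, if_pos rfl]
    refine Eq.trans ?_ (this.trans h.1.symm)
    simp only [sq]
  · have hι : Function.Injective ![k, l] := by
      intro a b; fin_cases a <;> fin_cases b <;> simp [hkl, Ne.symm hkl]
    have := nu0_comp_injective P p q hι fun ε => ε 0 * ε 1
    rw [rsParam, if_neg hkl]
    exact this.trans h.2.symm

theorem IsReplicaSymmetric.nu0_mul_sub {P : Params} {p q : ℝ} (h : IsReplicaSymmetric P p q)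
    {n : ℕ} (k l : Fin n) : (nu0 P p q fun ε => ε k * ε l - rsParam p q k l) = 0 := by
  rw [nu0_sub h.nonneg, nu0_const h.nonneg, h.nu0_mul, sub_self]

/-! ### Self-consistent moment bounds -/

section Moments

variable {P : Params} {p q : ℝ} {N : ℕ} [NeZero N] (h : IsReplicaSymmetric P p q)
  (hβ : P.β ^ 2 ≤ 1)

/-- The constant of the self-consistent bound for the moments of the overlaps. -/
def momentRate (S : ℕ) : ℝ := 36864 * (S : ℝ) ^ 4 * Real.exp (cavityRate S 4)

include h hβ

/-- At angle 0 the average factorizes and vanishes by the equations for p and q. What remains is one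
derivative, which carries β² and one more overlap, so moments of degree r + 1 come back with a small
coefficient. -/
theorem abs_modelAvg_spinProduct_mul_cavityOverlap_pow_le (i : Fin N) (k l : Fin 2) {r : ℕ}
    (hr : r ≤ 3) :
    |modelAvg P fun σ : Fin 2 → Config N P.S =>
      (spinProduct i σ k l - rsParam p q k l) * cavityOverlap p q i σ k l ^ r|
      ≤ P.β ^ 2 * momentRate P.S *
        (overlapMoment P p q N (r + 1) + ((P.S : ℝ) ^ 2 / N) ^ (r + 1)) := by
  have hq := h.nonneg
  have hp := h.abs_le.1
  have hqS := h.abs_le.2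
  have hz : (cavityPath P p q hq i).avg 0 (fun σ : Fin 2 → Config N P.S =>
      (spinProduct i σ k l - rsParam p q k l) * cavityOverlap p q i σ k l ^ r) = 0 := by
    have := cavityPath_avg_zero_mul P p q hq i (n := 2)
      (fun ε => ε k * ε l - rsParam p q k l) (fun σ => cavityOverlap p q i σ k l ^ r)
      (fun σ => by rw [cavityOverlap_eraseSpin])
    rw [h.nu0_mul_sub, zero_mul] at this
    exact this
  set M := overlapMoment P p q N (r + 1) + ((P.S : ℝ) ^ 2 / N) ^ (r + 1) with hMdef
  have hM : 0 ≤ M := add_nonneg (overlapMoment_nonneg _) (by positivity)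
  have hf : ∀ σ : Fin 2 → Config N P.S,
      |(spinProduct i σ k l - rsParam p q k l) * cavityOverlap p q i σ k l ^ r|
        ≤ 2 * (P.S : ℝ) ^ 2 * |cavityOverlap p q i σ k l| ^ r := by
    intro σ
    rw [abs_mul, abs_pow]
    gcongr
    have := abs_sub (spinProduct i σ k l) (rsParam p q k l)
    linarith [abs_spinProduct_le i σ k l, abs_rsParam_le hp hqS k l]
  have key : ∀ a b : Fin 4, (modelAvg P fun σ : Fin 4 → Config N P.S =>
      (2 * (P.S : ℝ) ^ 2 * |cavityOverlap p q i (fun m : Fin 2 => σ m.castSucc.castSucc) k l| ^ r)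
        * |cavityOverlap p q i σ a b|) ≤ 2 * (P.S : ℝ) ^ 2 * (2 * (2 ^ (r + 1) * M)) := by
    intro a b
    have hι : Function.Injective fun k : Fin 2 => k.castSucc.castSucc :=
      (Fin.castSucc_injective _).comp (Fin.castSucc_injective _)
    simp only [cavityOverlap_comp p q hι, mul_assoc (2 * (P.S : ℝ) ^ 2)]
    rw [modelAvg_const_mul]
    gcongr
    calc _ ≤ modelAvg P fun σ : Fin 4 → Config N P.S =>
          |cavityOverlap p q i σ k.castSucc.castSucc l.castSucc.castSucc| ^ (r + 1)
            + |cavityOverlap p q i σ a b| ^ (r + 1) := by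
          refine modelAvg_mono P fun σ => ?_
          -- For nonnegative x and y, x^r y is at most the (r + 1)-st power of the larger one.
          generalize hx : |cavityOverlap p q i σ k.castSucc.castSucc l.castSucc.castSucc| = x
          generalize hy : |cavityOverlap p q i σ a b| = y
          have hx0 : 0 ≤ x := hx ▸ abs_nonneg _
          have hy0 : 0 ≤ y := hy ▸ abs_nonneg _
          rcases le_total x y with hxy | hxy
          · calc x ^ r * y ≤ y ^ r * y := by gcongr
              _ = y ^ (r + 1) := (pow_succ _ _).symm
              _ ≤ _ := le_add_of_nonneg_left (by positivity)
          · calc x ^ r * y ≤ x ^ r * x := by gcongr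
              _ = x ^ (r + 1) := (pow_succ _ _).symm
              _ ≤ _ := le_add_of_nonneg_right (by positivity)
      _ ≤ 2 ^ (r + 1) * M + 2 ^ (r + 1) * M := by
          rw [modelAvg_add]
          exact add_le_add (modelAvg_abs_cavityOverlap_pow_le i _ _ _)
            (modelAvg_abs_cavityOverlap_pow_le i _ _ _)
      _ = _ := by ring
  have h1 := GaussianPath.abs_avg_sub_avg_le (cavityPath P p q hq i)
    (fun θ hθ => abs_cavityPath_avg_drift_le hq i hβ hp hqS hf key hθ)
    GaussianPath.zero_mem GaussianPath.pi_div_two_mem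
  rw [hz, sub_zero, cavityPath_avg_end] at h1
  refine h1.trans ?_
  have h2 : (2 : ℝ) ^ (r + 1) ≤ 16 := by
    calc (2 : ℝ) ^ (r + 1) ≤ 2 ^ 4 := pow_le_pow_right₀ (by norm_num) (by omega)
      _ = 16 := by norm_num
  calc _ = P.β ^ 2 * (576 * (P.S : ℝ) ^ 4 * Real.exp (cavityRate P.S 4)) * (2 ^ (r + 1) * M) := by
        norm_num; ring
    _ ≤ P.β ^ 2 * (576 * (P.S : ℝ) ^ 4 * Real.exp (cavityRate P.S 4)) * (16 * M) := by gcongr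
    _ ≤ _ := by
        unfold momentRate
        have : 0 ≤ P.β ^ 2 * ((P.S : ℝ) ^ 4 * Real.exp (cavityRate P.S 4)) * M := by positivity
        nlinarith

/-- As r + 1 is even, the absolute value can be dropped and one factor expanded over the sites. In
the other r factors the site is removed, at a cost of order 1/N times moments of degree r - 1; the
main term is the preceding lemma. -/
theorem modelAvg_abs_overlap_pow_le_of_odd (k l : Fin 2) {r : ℕ} (hr : r ≤ 3) (hodd : Odd r) :
    (modelAvg P fun σ : Fin 2 → Config N P.S => |overlap p q σ k l| ^ (r + 1))
      ≤ P.β ^ 2 * momentRate P.S *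
        (overlapMoment P p q N (r + 1) + ((P.S : ℝ) ^ 2 / N) ^ (r + 1))
        + 54 * (P.S : ℝ) ^ 4 / N *
          (overlapMoment P p q N (r - 1) + ((P.S : ℝ) ^ 2 / N) ^ (r - 1)) := by
  have hN : (0 : ℝ) < N := Nat.cast_pos.2 (NeZero.pos N)
  have hp := h.abs_le.1
  have hqS := h.abs_le.2
  have hev : Even (r + 1) := hodd.add_one
  have e1 : ∀ σ : Fin 2 → Config N P.S, |overlap p q σ k l| ^ (r + 1)
      = 1 / (N : ℝ) * ∑ i, ((spinProduct i σ k l - rsParam p q k l) * cavityOverlap p q i σ k l ^ r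
        + (spinProduct i σ k l - rsParam p q k l) *
          (overlap p q σ k l ^ r - cavityOverlap p q i σ k l ^ r)) := by
    intro σ
    rw [hev.pow_abs, pow_succ]
    nth_rewrite 2 [overlap_eq_sum]
    simp_rw [← mul_add, add_sub_cancel, ← Finset.sum_mul]
    ring
  simp_rw [e1]
  rw [modelAvg_const_mul, modelAvg_sum, one_div, inv_mul_le_iff₀ hN]
  set B := P.β ^ 2 * momentRate P.S *
        (overlapMoment P p q N (r + 1) + ((P.S : ℝ) ^ 2 / N) ^ (r + 1))
        + 54 * (P.S : ℝ) ^ 4 / N *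
          (overlapMoment P p q N (r - 1) + ((P.S : ℝ) ^ 2 / N) ^ (r - 1)) with hB
  calc _ ≤ ∑ _i : Fin N, B := Finset.sum_le_sum fun i _ => ?_
    _ = N * B := by simp
  rw [modelAvg_add, hB]
  refine add_le_add ((le_abs_self _).trans
    (abs_modelAvg_spinProduct_mul_cavityOverlap_pow_le h hβ i k l hr)) ((le_abs_self _).trans ?_)
  have hpt : ∀ σ : Fin 2 → Config N P.S, |(spinProduct i σ k l - rsParam p q k l) *
          (overlap p q σ k l ^ r - cavityOverlap p q i σ k l ^ r)|
      ≤ 2 * (P.S : ℝ) ^ 2 * ((P.S : ℝ) ^ 2 / N * 3 *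
        (|overlap p q σ k l| ^ (r - 1) + |cavityOverlap p q i σ k l| ^ (r - 1))) := by
    intro σ
    rw [abs_mul]
    have h1 : |spinProduct i σ k l - rsParam p q k l| ≤ 2 * (P.S : ℝ) ^ 2 := by
      have := abs_sub (spinProduct i σ k l) (rsParam p q k l)
      linarith [abs_spinProduct_le i σ k l, abs_rsParam_le hp hqS k l]
    have h2 : max |overlap p q σ k l| |cavityOverlap p q i σ k l| ^ (r - 1)
        ≤ |overlap p q σ k l| ^ (r - 1) + |cavityOverlap p q i σ k l| ^ (r - 1) := by
      rcases max_cases |overlap p q σ k l| |cavityOverlap p q i σ k l| with hm | hm <;> rw [hm.1]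
      · exact le_add_of_nonneg_right (by positivity)
      · exact le_add_of_nonneg_left (by positivity)
    refine mul_le_mul h1 ?_ (abs_nonneg _) (by positivity)
    refine (abs_pow_sub_pow_le _ _ _).trans ?_
    refine mul_le_mul (mul_le_mul (abs_cavityOverlap_sub_le p q i σ k l) (by exact_mod_cast hr)
      (Nat.cast_nonneg r) (by positivity)) h2 (by positivity) (by positivity)
  refine (abs_modelAvg_le P hpt).trans ?_
  rw [modelAvg_const_mul, modelAvg_const_mul, modelAvg_add]
  have h3 := modelAvg_abs_overlap_pow_le (P := P) (p := p) (q := q) (N := N) k l (r - 1)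
  have h4 := modelAvg_abs_cavityOverlap_pow_le (P := P) (p := p) (q := q) i k l (r - 1)
  have h5 : (2 : ℝ) ^ (r - 1) ≤ 4 := by
    calc (2 : ℝ) ^ (r - 1) ≤ 2 ^ 2 := pow_le_pow_right₀ (by norm_num) (by omega)
      _ = 4 := by norm_num
  set m := overlapMoment P p q N (r - 1) with hm
  have hm0 : 0 ≤ m := overlapMoment_nonneg _
  have hc0 : 0 ≤ ((P.S : ℝ) ^ 2 / N) ^ (r - 1) := by positivity
  have h6 : (2 : ℝ) ^ (r - 1) * (m + ((P.S : ℝ) ^ 2 / N) ^ (r - 1))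
      ≤ 4 * (m + ((P.S : ℝ) ^ 2 / N) ^ (r - 1)) := by gcongr
  calc _ ≤ 2 * (P.S : ℝ) ^ 2 * ((P.S : ℝ) ^ 2 / N * 3 *
        (9 * (m + ((P.S : ℝ) ^ 2 / N) ^ (r - 1)))) := by
        gcongr
        linarith
    _ = _ := by ring

/-- The moment occurs on both sides. Summing over overlap and self-overlap doubles its coefficient,
the smallness of β makes that at most 1/2, and absorbing it turns 54 into 2 · 2 · 54 = 216. -/
theorem overlapMoment_le_of_odd {r : ℕ} (hr : r ≤ 3) (hodd : Odd r)
    (hsmall : 4 * (P.β ^ 2 * momentRate P.S) ≤ 1) :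
    overlapMoment P p q N (r + 1) ≤ ((P.S : ℝ) ^ 2 / N) ^ (r + 1) + 216 * (P.S : ℝ) ^ 4 / N *
          (overlapMoment P p q N (r - 1) + ((P.S : ℝ) ^ 2 / N) ^ (r - 1)) := by
  have h1 := overlapMoment_le fun k l => modelAvg_abs_overlap_pow_le_of_odd (N := N) h hβ k l hr hodd
  have h2 : 0 ≤ overlapMoment P p q N (r + 1) + ((P.S : ℝ) ^ 2 / N) ^ (r + 1) :=
    add_nonneg (overlapMoment_nonneg _) (by positivity)
  have h3 := mul_le_mul_of_nonneg_right hsmall h2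
  have h4 : 216 * (P.S : ℝ) ^ 4 / N *
          (overlapMoment P p q N (r - 1) + ((P.S : ℝ) ^ 2 / N) ^ (r - 1))
      = 4 * (54 * (P.S : ℝ) ^ 4 / N *
          (overlapMoment P p q N (r - 1) + ((P.S : ℝ) ^ 2 / N) ^ (r - 1))) := by ring
  rw [h4]
  linarith

end Moments

end GhatakSherrington

end

noncomputable section

namespace GhatakSherrington

/-! ### Sizes of the overlaps -/

/-- The order `N ^ (-1/2)` of the overlaps. -/
def fluctScale (N : ℕ) : ℝ := (√(N : ℝ))⁻¹

theorem fluctScale_nonneg (N : ℕ) : 0 ≤ fluctScale N := by unfold fluctScale; positivity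

theorem fluctScale_sq (N : ℕ) : fluctScale N ^ 2 = 1 / N := by
  unfold fluctScale
  rw [inv_pow, Real.sq_sqrt (Nat.cast_nonneg N), one_div]

theorem fluctScale_cube (N : ℕ) : fluctScale N ^ 3 = (N : ℝ) ^ (-(3 / 2) : ℝ) := by
  unfold fluctScale
  rw [inv_pow, Real.sqrt_eq_rpow, ← Real.rpow_natCast, ← Real.rpow_mul (Nat.cast_nonneg N),
    ← Real.rpow_neg (Nat.cast_nonneg N)]
  norm_num

theorem fluctScale_pos (N : ℕ) [NeZero N] : 0 < fluctScale N := by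
  have : (0 : ℝ) < N := Nat.cast_pos.2 (NeZero.pos N)
  unfold fluctScale
  positivity

theorem fluctScale_le_one (N : ℕ) [NeZero N] : fluctScale N ≤ 1 := by
  unfold fluctScale
  refine inv_le_one_of_one_le₀ (Real.one_le_sqrt.2 ?_)
  exact_mod_cast NeZero.one_le

section

variable {P : Params} {p q : ℝ} (h : IsReplicaSymmetric P p q) (hβ : P.β ^ 2 ≤ 1)
  (hsmall : 4 * (P.β ^ 2 * momentRate P.S) ≤ 1)

include h hβ hsmall

/-- Two steps of the recursion: r = 1 starts from the zeroth moment and gives the second, r = 3 then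
gives the fourth. -/
theorem exists_overlapMoment_le : ∃ C : ℝ, 0 ≤ C ∧ ∀ (N : ℕ) [NeZero N],
    overlapMoment P p q N 2 ≤ C * fluctScale N ^ 2 ∧
    overlapMoment P p q N 4 ≤ C * fluctScale N ^ 4 := by
  set L := (P.S : ℝ) ^ 2 with hL
  have hL0 : 0 ≤ L := by positivity
  set C2 := L ^ 2 + 648 * L ^ 2 with hC2
  set C4 := L ^ 4 + 216 * L ^ 2 * (C2 + L ^ 2) with hC4
  refine ⟨C2 + C4, by positivity, fun N _ => ?_⟩
  have h1 := overlapMoment_le_of_odd (N := N) h hβ (r := 1) (by norm_num) (by decide) hsmall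
  have h3 := overlapMoment_le_of_odd (N := N) h hβ (r := 3) (by norm_num) (by decide) hsmall
  have hm0 : overlapMoment P p q N 0 = 2 := by
    unfold overlapMoment
    simp only [pow_zero, modelAvg_const]
    norm_num
  have ht : (1 : ℝ) / N ≤ 1 := by
    rw [← fluctScale_sq]; exact pow_le_one₀ (fluctScale_nonneg N) (fluctScale_le_one N)
  have ht0 : 0 ≤ (1 : ℝ) / N := by positivity
  have e1 : (P.S : ℝ) ^ 2 / N = L * (1 / N) := by ring
  have e2 : 216 * (P.S : ℝ) ^ 4 / N = 216 * L ^ 2 * (1 / N) := by rw [hL]; ring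
  norm_num only at h1 h3
  rw [hm0, e1, e2] at h1
  rw [e1, e2] at h3
  have e4 : fluctScale N ^ 4 = (1 / N) ^ 2 := by rw [← fluctScale_sq]; ring
  rw [fluctScale_sq, e4]
  set t := (1 : ℝ) / N with htdef
  have htt : t ^ 2 ≤ t := by nlinarith
  have b2 : overlapMoment P p q N 2 ≤ C2 * t := by
    refine h1.trans ?_
    have : L ^ 2 * t ^ 2 ≤ L ^ 2 * t := by gcongr
    rw [hC2]
    nlinarith
  refine ⟨b2.trans ?_, h3.trans ?_⟩
  · have : 0 ≤ C4 * t := by positivity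
    linarith
  · have x1 : (L * t) ^ 4 ≤ L ^ 4 * t ^ 2 := by
      rw [mul_pow]
      refine mul_le_mul_of_nonneg_left ?_ (by positivity)
      calc t ^ 4 = t ^ 2 * t ^ 2 := by ring
        _ ≤ t ^ 2 * 1 := mul_le_mul_of_nonneg_left (pow_le_one₀ ht0 ht) (by positivity)
        _ = t ^ 2 := mul_one _
    have x2 : 216 * L ^ 2 * t * (overlapMoment P p q N 2 + (L * t) ^ 2)
        ≤ 216 * L ^ 2 * t * (C2 * t + L ^ 2 * t) := by
      gcongr
      rw [mul_pow]
      gcongr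
    have x3 : 0 ≤ C2 * t ^ 2 := by positivity
    calc _ ≤ L ^ 4 * t ^ 2 + 216 * L ^ 2 * t * (C2 * t + L ^ 2 * t) := add_le_add x1 x2
      _ = C4 * t ^ 2 := by rw [hC4]; ring
      _ ≤ _ := by linarith

theorem exists_modelAvg_abs_pow_le : ∃ C : ℝ, 0 ≤ C ∧ ∀ (N : ℕ) [NeZero N] (n : ℕ) (k l : Fin n)
    (r : ℕ), 1 ≤ r → r ≤ 3 →
    (modelAvg P fun σ : Fin n → Config N P.S => |overlap p q σ k l| ^ r) ≤ C * fluctScale N ^ r ∧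
    ∀ i, (modelAvg P fun σ : Fin n → Config N P.S => |cavityOverlap p q i σ k l| ^ r)
      ≤ C * fluctScale N ^ r := by
  obtain ⟨C, hC0, hC⟩ := exists_overlapMoment_le h hβ hsmall
  set L := (P.S : ℝ) ^ 2 with hL
  have hL0 : 0 ≤ L := by positivity
  have main : ∀ (N : ℕ) [NeZero N] (n : ℕ) (k l : Fin n) (r : ℕ), 1 ≤ r → r ≤ 3 →
      (modelAvg P fun σ : Fin n → Config N P.S => |overlap p q σ k l| ^ r)
        ≤ (C + 1) * fluctScale N ^ r := by
    intro N _ n k l r hr1 hr3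
    obtain ⟨c2, c4⟩ := hC N
    have m2 := (modelAvg_abs_overlap_pow_le (P := P) (p := p) (q := q) (N := N) k l 2).trans c2
    have m4 := (modelAvg_abs_overlap_pow_le (P := P) (p := p) (q := q) (N := N) k l 4).trans c4
    have hs := fluctScale_pos N
    set s := fluctScale N with hsdef
    interval_cases r
    -- Odd moments follow by interpolation at the scale s = N^(-1/2): x ≤ s + x²/s here, and x³ ≤ (s
    -- x² + x⁴/s)/2 for r = 3.
    · have hpt : ∀ σ : Fin n → Config N P.S,
          |overlap p q σ k l| ^ 1 ≤ s + s⁻¹ * |overlap p q σ k l| ^ 2 := by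
        intro σ
        generalize |overlap p q σ k l| = x
        have := sq_nonneg (x - s)
        rw [pow_one, ← mul_le_mul_iff_right₀ hs, mul_add, mul_inv_cancel_left₀ hs.ne']
        nlinarith [sq_nonneg x]
      refine (modelAvg_mono P hpt).trans ?_
      rw [modelAvg_add, modelAvg_const, modelAvg_const_mul, pow_one]
      calc _ ≤ s + s⁻¹ * (C * s ^ 2) := by gcongr
        _ = _ := by field_simp; ring
    · refine m2.trans ?_
      gcongr
      linarith
    · have hpt : ∀ σ : Fin n → Config N P.S, |overlap p q σ k l| ^ 3
          ≤ 1 / 2 * (s * |overlap p q σ k l| ^ 2 + s⁻¹ * |overlap p q σ k l| ^ 4) := by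
        intro σ
        generalize |overlap p q σ k l| = x
        have := mul_nonneg (sq_nonneg x) (sq_nonneg (x - s))
        rw [← mul_le_mul_iff_right₀ hs, mul_left_comm, mul_add, mul_inv_cancel_left₀ hs.ne']
        nlinarith
      refine (modelAvg_mono P hpt).trans ?_
      rw [modelAvg_const_mul, modelAvg_add, modelAvg_const_mul, modelAvg_const_mul]
      calc _ ≤ 1 / 2 * (s * (C * s ^ 2) + s⁻¹ * (C * s ^ 4)) := by gcongr
        _ = C * s ^ 3 := by field_simp; ring
        _ ≤ _ := by gcongr; linarith
  refine ⟨8 * ((C + 1) + (L + L ^ 2 + L ^ 3)), by positivity, fun N _ n k l r hr1 hr3 =>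
    ⟨?_, fun i => ?_⟩⟩
  · refine (main N n k l r hr1 hr3).trans ?_
    gcongr
    · exact pow_nonneg (fluctScale_nonneg N) r
    · have : 0 ≤ L + L ^ 2 + L ^ 3 := by positivity
      linarith
  · refine (modelAvg_mono P fun σ => abs_cavityOverlap_pow_le i σ k l r).trans ?_
    rw [modelAvg_const_mul, modelAvg_add, modelAvg_const]
    have h2 : (2 : ℝ) ^ r ≤ 8 := by
      calc (2 : ℝ) ^ r ≤ 2 ^ 3 := pow_le_pow_right₀ (by norm_num) hr3
        _ = 8 := by norm_num
    have h3 : ((P.S : ℝ) ^ 2 / N) ^ r ≤ (L + L ^ 2 + L ^ 3) * fluctScale N ^ r := by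
      have e : (P.S : ℝ) ^ 2 / N = L * fluctScale N ^ 2 := by rw [fluctScale_sq]; ring
      rw [e, mul_pow, ← pow_mul (fluctScale N)]
      have hL1 : L ^ r ≤ L + L ^ 2 + L ^ 3 := by
        interval_cases r <;> nlinarith [pow_nonneg hL0 2, pow_nonneg hL0 3]
      have hs : fluctScale N ^ (2 * r) ≤ fluctScale N ^ r :=
        pow_le_pow_of_le_one (fluctScale_nonneg N) (fluctScale_le_one N) (by omega)
      exact mul_le_mul hL1 hs (pow_nonneg (fluctScale_nonneg N) _) (by positivity)
    have h4 := main N n k l r hr1 hr3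
    have hs := pow_nonneg (fluctScale_nonneg N) r
    have h5 := modelAvg_nonneg P fun σ : Fin n → Config N P.S =>
      pow_nonneg (abs_nonneg (overlap p q σ k l)) r
    calc _ ≤ 8 * ((C + 1) * fluctScale N ^ r + (L + L ^ 2 + L ^ 3) * fluctScale N ^ r) := by
          gcongr
      _ = _ := by ring

end

end GhatakSherrington

end

noncomputable section

namespace GhatakSherrington

/-! ### The cavity equations for the covariances of the overlaps -/

/-- The overlaps are of order `N ^ (-1/2)`, with constant `C` for the first three moments. -/
def HasFluctuationBound (P : Params) (p q C : ℝ) : Prop :=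
  ∀ (N : ℕ) [NeZero N] (n : ℕ) (k l : Fin n) (r : ℕ), 1 ≤ r → r ≤ 3 →
    (modelAvg P fun σ : Fin n → Config N P.S => |overlap p q σ k l| ^ r) ≤ C * fluctScale N ^ r ∧
    ∀ i, (modelAvg P fun σ : Fin n → Config N P.S => |cavityOverlap p q i σ k l| ^ r)
      ≤ C * fluctScale N ^ r

/-- The covariance of two overlaps. -/
def overlapCov (P : Params) (p q : ℝ) (N : ℕ) {n : ℕ} (k l k' l' : Fin n) : ℝ :=
  modelAvg P fun σ : Fin n → Config N P.S => overlap p q σ k l * overlap p q σ k' l'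

/-- The covariance of two products of cavity spins. -/
def cavityCov (P : Params) (p q : ℝ) {n : ℕ} (k l k' l' : Fin n) : ℝ :=
  nu0 P p q fun ε : Fin n → ℝ => (ε k * ε l - rsParam p q k l) * (ε k' * ε l')

theorem mul_mul_le_cube_add {a b c : ℝ} (ha : 0 ≤ a) (hb : 0 ≤ b) (hc : 0 ≤ c) :
    a * b * c ≤ a ^ 3 + b ^ 3 + c ^ 3 := by
  have h1 : 0 ≤ (a + b + c) * ((a - b) ^ 2 + (b - c) ^ 2 + (c - a) ^ 2) := by positivity
  have h2 : 0 ≤ a ^ 3 + b ^ 3 + c ^ 3 := by positivity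
  nlinarith

section

variable {P : Params} {p q C : ℝ} (h : IsReplicaSymmetric P p q) (hβ : P.β ^ 2 ≤ 1)
  (hC : HasFluctuationBound P p q C) {N : ℕ} [NeZero N]

include h in
omit [NeZero N] in
theorem abs_spinProduct_sub_le {n : ℕ} (i : Fin N) (σ : Fin n → Config N P.S) (k l : Fin n) :
    |spinProduct i σ k l - rsParam p q k l| ≤ 2 * (P.S : ℝ) ^ 2 := by
  have := abs_sub (spinProduct i σ k l) (rsParam p q k l)
  linarith [abs_spinProduct_le i σ k l, abs_rsParam_le h.abs_le.1 h.abs_le.2 k l]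

include h in
theorem abs_cavityCov_le {n : ℕ} (k l k' l' : Fin n) :
    |cavityCov P p q k l k' l'| ≤ 2 * (P.S : ℝ) ^ 2 * (P.S : ℝ) ^ 2 := by
  refine abs_nu0_le P p q fun ε => ?_
  rw [abs_mul]
  refine mul_le_mul ?_ (Spin.abs_val_mul_val_le _ _) (abs_nonneg _) (by positivity)
  have := abs_sub ((ε k).val * (ε l).val) (rsParam p q k l)
  linarith [Spin.abs_val_mul_val_le (ε k) (ε l), abs_rsParam_le h.abs_le.1 h.abs_le.2 k l]

include hC in
theorem HasFluctuationBound.triple {n : ℕ} (i : Fin N) (a b c a' b' c' : Fin n) :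
    (modelAvg P fun σ : Fin n → Config N P.S => |cavityOverlap p q i σ a a'| *
      |cavityOverlap p q i σ b b'| * |cavityOverlap p q i σ c c'|) ≤ 3 * C * fluctScale N ^ 3 := by
  refine (modelAvg_mono P fun σ => mul_mul_le_cube_add (abs_nonneg _) (abs_nonneg _)
    (abs_nonneg _)).trans ?_
  rw [modelAvg_add, modelAvg_add]
  have h1 := (hC N n a a' 3 (by norm_num) le_rfl).2 i
  have h2 := (hC N n b b' 3 (by norm_num) le_rfl).2 i
  have h3 := (hC N n c c' 3 (by norm_num) le_rfl).2 i
  linarith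

include h hβ hC

/-- First order is enough: this term enters the covariance with a prefactor 1/N, so an error of
order N^(-1/2) is affordable. -/
theorem abs_modelAvg_spinProduct_mul_sub_le (i : Fin N) (k l k' l' : Fin 4) :
    |(modelAvg P fun σ : Fin 4 → Config N P.S =>
      (spinProduct i σ k l - rsParam p q k l) * spinProduct i σ k' l') - cavityCov P p q k l k' l'|
      ≤ 900 * (P.S : ℝ) ^ 2 * Real.exp (cavityRate P.S 6) *
        (2 * (P.S : ℝ) ^ 4 * C) * fluctScale N := by
  have hq := h.nonneg
  have hz : (cavityPath P p q hq i).avg 0 (fun σ : Fin 4 → Config N P.S =>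
      (spinProduct i σ k l - rsParam p q k l) * spinProduct i σ k' l')
      = cavityCov P p q k l k' l' := by
    have := cavityPath_avg_zero_mul P p q hq i (n := 4)
      (fun ε => (ε k * ε l - rsParam p q k l) * (ε k' * ε l')) (fun _ => 1) (fun _ => rfl)
    rw [GaussianPath.avg_const, mul_one] at this
    simp only [mul_one] at this
    exact this
  have hf : ∀ σ : Fin 4 → Config N P.S,
      |(spinProduct i σ k l - rsParam p q k l) * spinProduct i σ k' l'|
        ≤ 2 * (P.S : ℝ) ^ 4 := by
    intro σ
    rw [abs_mul]
    calc _ ≤ 2 * (P.S : ℝ) ^ 2 * (P.S : ℝ) ^ 2 := by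
          gcongr
          · exact abs_spinProduct_sub_le h i σ k l
          · exact abs_spinProduct_le i σ k' l'
      _ = _ := by ring
  have hM : ∀ a b : Fin 6, (modelAvg P fun σ : Fin 6 → Config N P.S =>
      2 * (P.S : ℝ) ^ 4 * |cavityOverlap p q i σ a b|) ≤ 2 * (P.S : ℝ) ^ 4 * (C * fluctScale N) := by
    intro a b
    rw [modelAvg_const_mul]
    gcongr
    have := (hC N 6 a b 1 le_rfl (by norm_num)).2 i
    simpa only [pow_one] using this
  have h1 := GaussianPath.abs_avg_sub_avg_le (cavityPath P p q hq i)
    (fun θ hθ => abs_cavityPath_avg_drift_le hq i hβ h.abs_le.1 h.abs_le.2 hf hM hθ)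
    GaussianPath.zero_mem GaussianPath.pi_div_two_mem
  rw [hz, cavityPath_avg_end] at h1
  refine h1.trans ?_
  have hM0 : 0 ≤ 2 * (P.S : ℝ) ^ 4 * (C * fluctScale N) :=
    (modelAvg_nonneg P fun σ => by positivity).trans (hM 0 0)
  calc _ ≤ 1 * (((4 : ℕ) + 1) ^ 2 * ((4 : ℕ) + 2) ^ 2 * (P.S : ℝ) ^ 2 *
        Real.exp (cavityRate P.S (4 + 2))) * (2 * (P.S : ℝ) ^ 4 * (C * fluctScale N)) := by
        gcongr
    _ = _ := by norm_num; ring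

/-- Moving from angle 0 to the model costs a product of three overlaps, and putting site i back
costs 1/N times one overlap. Both are of order N^(-3/2). -/
theorem abs_avg_zero_cavityOverlap_mul_sub_le (i : Fin N) (k l k' l' : Fin 6) :
    |(cavityPath P p q h.nonneg i).avg 0 (fun σ : Fin 6 → Config N P.S =>
      cavityOverlap p q i σ k l * cavityOverlap p q i σ k' l') - overlapCov P p q N k l k' l'|
      ≤ (3136 * (P.S : ℝ) ^ 2 * Real.exp (cavityRate P.S 8) * (3 * C)
        + 2 * (P.S : ℝ) ^ 2 * C) * fluctScale N ^ 3 := by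
  have hι : Function.Injective fun k : Fin 6 => k.castSucc.castSucc :=
    (Fin.castSucc_injective _).comp (Fin.castSucc_injective _)
  have hM : ∀ a b : Fin 8, (modelAvg P fun σ : Fin 8 → Config N P.S =>
      |cavityOverlap p q i (fun m : Fin 6 => σ m.castSucc.castSucc) k l *
        cavityOverlap p q i (fun m : Fin 6 => σ m.castSucc.castSucc) k' l'| *
        |cavityOverlap p q i σ a b|) ≤ 3 * C * fluctScale N ^ 3 := by
    intro a b
    simp only [cavityOverlap_comp p q hι, abs_mul]
    exact hC.triple i _ _ _ _ _ _
  have h1 := GaussianPath.abs_avg_sub_avg_le (cavityPath P p q h.nonneg i)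
    (fun θ hθ => abs_cavityPath_avg_drift_le h.nonneg i hβ h.abs_le.1 h.abs_le.2
      (f := fun σ : Fin 6 → Config N P.S =>
        cavityOverlap p q i σ k l * cavityOverlap p q i σ k' l')
      (g := fun σ : Fin 6 → Config N P.S =>
        |cavityOverlap p q i σ k l * cavityOverlap p q i σ k' l'|) (fun σ => le_rfl) hM hθ)
    GaussianPath.zero_mem GaussianPath.pi_div_two_mem
  rw [cavityPath_avg_end, abs_sub_comm] at h1
  have hM0 : 0 ≤ 3 * C * fluctScale N ^ 3 :=
    (modelAvg_nonneg P fun σ => by positivity).trans (hM 0 0)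
  have h2 : |(cavityPath P p q h.nonneg i).avg 0 (fun σ : Fin 6 → Config N P.S =>
      cavityOverlap p q i σ k l * cavityOverlap p q i σ k' l')
      - modelAvg P fun σ : Fin 6 → Config N P.S =>
        cavityOverlap p q i σ k l * cavityOverlap p q i σ k' l'|
      ≤ 3136 * (P.S : ℝ) ^ 2 * Real.exp (cavityRate P.S 8) * (3 * C) * fluctScale N ^ 3 := by
    refine h1.trans ?_
    calc _ ≤ 1 * (((6 : ℕ) + 1) ^ 2 * ((6 : ℕ) + 2) ^ 2 * (P.S : ℝ) ^ 2 *
          Real.exp (cavityRate P.S (6 + 2))) * (3 * C * fluctScale N ^ 3) := by gcongr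
      _ = _ := by norm_num; ring
  have h3 : |(modelAvg P fun σ : Fin 6 → Config N P.S =>
        cavityOverlap p q i σ k l * cavityOverlap p q i σ k' l') - overlapCov P p q N k l k' l'|
      ≤ 2 * (P.S : ℝ) ^ 2 * C * fluctScale N ^ 3 := by
    unfold overlapCov
    rw [← modelAvg_sub]
    have hpt : ∀ σ : Fin 6 → Config N P.S, |cavityOverlap p q i σ k l * cavityOverlap p q i σ k' l'
        - overlap p q σ k l * overlap p q σ k' l'| ≤ (P.S : ℝ) ^ 2 / N *
          (|cavityOverlap p q i σ k' l'| ^ 1 + |overlap p q σ k l| ^ 1) := by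
      intro σ
      have e : cavityOverlap p q i σ k l * cavityOverlap p q i σ k' l'
        - overlap p q σ k l * overlap p q σ k' l'
        = -((overlap p q σ k l - cavityOverlap p q i σ k l) * cavityOverlap p q i σ k' l'
          + (overlap p q σ k' l' - cavityOverlap p q i σ k' l') * overlap p q σ k l) := by ring
      rw [e, abs_neg, pow_one, pow_one, mul_add]
      refine (abs_add_le _ _).trans (add_le_add ?_ ?_) <;> rw [abs_mul]
      · exact mul_le_mul_of_nonneg_right (abs_cavityOverlap_sub_le p q i σ k l) (abs_nonneg _)
      · exact mul_le_mul_of_nonneg_right (abs_cavityOverlap_sub_le p q i σ k' l') (abs_nonneg _)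
    refine (abs_modelAvg_le P hpt).trans ?_
    rw [modelAvg_const_mul, modelAvg_add]
    have c1 := (hC N 6 k' l' 1 le_rfl (by norm_num)).2 i
    have c2 := (hC N 6 k l 1 le_rfl (by norm_num)).1
    have e : (P.S : ℝ) ^ 2 / N = (P.S : ℝ) ^ 2 * fluctScale N ^ 2 := by
      rw [fluctScale_sq]; ring
    rw [e]
    calc _ ≤ (P.S : ℝ) ^ 2 * fluctScale N ^ 2 * (C * fluctScale N ^ 1 + C * fluctScale N ^ 1) := by
          gcongr
      _ = _ := by ring
  refine (abs_sub_le _ _ _).trans ((add_le_add h2 h3).trans_eq ?_)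
  ring

/-- The leading term given by the cavity interpolation for the covariance of two overlaps, on top
of the contribution of one site. -/
def cavitySum (P : Params) (p q : ℝ) (N : ℕ) (k l k' l' : Fin 4) : ℝ :=
  P.β ^ 2 / 2 * ∑ a : Fin 6, ∑ b : Fin 6, driftU 4 a * driftV 4 b *
    (cavityCov P p q k.castSucc.castSucc l.castSucc.castSucc a b *
      overlapCov P p q N k'.castSucc.castSucc l'.castSucc.castSucc a b)

/-- The constant of the error term in the cavity equation. -/
def cavityErrorConst (S : ℕ) (C : ℝ) : ℝ :=
  2822400 * (S : ℝ) ^ 4 * Real.exp (cavityRate S 8) * (2 * (S : ℝ) ^ 2 * (3 * C))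
    + 900 * (S : ℝ) ^ 4 * (3136 * (S : ℝ) ^ 2 * Real.exp (cavityRate S 8) * (3 * C)
        + 2 * (S : ℝ) ^ 2 * C)

/-- A second order expansion: the value at angle 0 vanishes, half the drift there factorizes into
cavity covariances times overlap covariances, and the second drift contains three overlaps. -/
theorem abs_modelAvg_spinProduct_mul_cavityOverlap_sub_le (i : Fin N) (k l k' l' : Fin 4) :
    |(modelAvg P fun σ : Fin 4 → Config N P.S =>
      (spinProduct i σ k l - rsParam p q k l) * cavityOverlap p q i σ k' l')
        - cavitySum P p q N k l k' l'| ≤ cavityErrorConst P.S C * fluctScale N ^ 3 := by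
  have hq := h.nonneg
  set X := cavityPath P p q hq i with hX
  set f : (Fin 4 → Config N P.S) → ℝ := fun σ =>
    (spinProduct i σ k l - rsParam p q k l) * cavityOverlap p q i σ k' l' with hfdef
  have hι : Function.Injective fun k : Fin 4 => k.castSucc.castSucc :=
    (Fin.castSucc_injective _).comp (Fin.castSucc_injective _)
  have hι2 : Function.Injective fun k : Fin 4 => k.castSucc.castSucc.castSucc.castSucc :=
    ((Fin.castSucc_injective _).comp (Fin.castSucc_injective _)).comp hι
  have hz : X.avg 0 f = 0 := by
    have := cavityPath_avg_zero_mul P p q hq i (n := 4)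
      (fun ε => ε k * ε l - rsParam p q k l) (fun σ => cavityOverlap p q i σ k' l')
      (fun σ => by rw [cavityOverlap_eraseSpin])
    rw [h.nu0_mul_sub, zero_mul] at this
    exact this
  have hf : ∀ σ, |f σ| ≤ 2 * (P.S : ℝ) ^ 2 * |cavityOverlap p q i σ k' l'| := by
    intro σ
    rw [hfdef, abs_mul]
    gcongr
    exact abs_spinProduct_sub_le h i σ k l
  have hM : ∀ (c d : Fin 6) (a b : Fin 8), (modelAvg P fun σ : Fin 8 → Config N P.S =>
      2 * (P.S : ℝ) ^ 2 *
        |cavityOverlap p q i (fun m : Fin 4 => σ m.castSucc.castSucc.castSucc.castSucc) k' l'| *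
        |cavityOverlap p q i σ c.castSucc.castSucc d.castSucc.castSucc| *
        |cavityOverlap p q i σ a b|) ≤ 2 * (P.S : ℝ) ^ 2 * (3 * C * fluctScale N ^ 3) := by
    intro c d a b
    simp only [cavityOverlap_comp p q hι2, mul_assoc (2 * (P.S : ℝ) ^ 2)]
    rw [modelAvg_const_mul]
    gcongr
    exact hC.triple i _ _ _ _ _ _
  have h1 := X.abs_avg_sub_sub_le (f := f) fun θ hθ =>
    abs_cavityPath_avg_drift_drift_le hq i hβ h.abs_le.1 h.abs_le.2 hf hM hθ
  rw [hz, sub_zero, hX, cavityPath_avg_end, ← hX] at h1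
  have h2 : 1 / 2 * X.avg 0 (X.drift f) = P.β ^ 2 / 2 * ∑ a : Fin 6, ∑ b : Fin 6,
      driftU 4 a * driftV 4 b * (cavityCov P p q k.castSucc.castSucc l.castSucc.castSucc a b *
        X.avg 0 fun σ : Fin 6 → Config N P.S =>
          cavityOverlap p q i σ k'.castSucc.castSucc l'.castSucc.castSucc *
            cavityOverlap p q i σ a b) := by
    have e1 : ∀ a b : Fin 6, (cavityCov P p q k.castSucc.castSucc l.castSucc.castSucc a b *
        X.avg 0 fun σ : Fin 6 → Config N P.S =>
          cavityOverlap p q i σ k'.castSucc.castSucc l'.castSucc.castSucc *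
            cavityOverlap p q i σ a b)
        = X.avg 0 fun σ : Fin 6 → Config N P.S =>
          (spinProduct i σ k.castSucc.castSucc l.castSucc.castSucc
            - rsParam p q k.castSucc.castSucc l.castSucc.castSucc) * spinProduct i σ a b *
          (cavityOverlap p q i σ k'.castSucc.castSucc l'.castSucc.castSucc *
            cavityOverlap p q i σ a b) := by
      intro a b
      exact (cavityPath_avg_zero_mul P p q hq i (n := 6)
        (fun ε => (ε k.castSucc.castSucc * ε l.castSucc.castSucc
          - rsParam p q k.castSucc.castSucc l.castSucc.castSucc) * (ε a * ε b)) _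
        (fun σ => by simp only [cavityOverlap_eraseSpin])).symm
    simp_rw [e1, ← X.avg_const_mul, ← X.avg_sum, ← X.avg_const_mul]
    congr 1
    funext σ
    rw [hX, cavityPath_drift]
    simp only [hfdef, cavityOverlap_comp p q hι, spinProduct_comp, ← rsParam_comp p q hι k l]
    simp_rw [Finset.mul_sum]
    refine Finset.sum_congr rfl fun a _ => Finset.sum_congr rfl fun b _ => ?_
    ring
  set A : Fin 6 → Fin 6 → ℝ := fun a b => X.avg 0 fun σ : Fin 6 → Config N P.S =>
          cavityOverlap p q i σ k'.castSucc.castSucc l'.castSucc.castSucc *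
            cavityOverlap p q i σ a b with hA
  set E := (3136 * (P.S : ℝ) ^ 2 * Real.exp (cavityRate P.S 8) * (3 * C)
        + 2 * (P.S : ℝ) ^ 2 * C) * fluctScale N ^ 3 with hE
  have h3 : |1 / 2 * X.avg 0 (X.drift f) - cavitySum P p q N k l k' l'|
      ≤ 900 * (P.S : ℝ) ^ 4 * E := by
    rw [h2]
    unfold cavitySum
    rw [← mul_sub, abs_mul, abs_of_nonneg (by positivity), ← Finset.sum_sub_distrib]
    simp_rw [← Finset.sum_sub_distrib, ← mul_sub]
    have hE0 : 0 ≤ E := (abs_nonneg _).trans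
      (abs_avg_zero_cavityOverlap_mul_sub_le h hβ hC i 0 0 0 0)
    have hs : |∑ a : Fin 6, ∑ b : Fin 6, driftU 4 a * driftV 4 b *
        (cavityCov P p q k.castSucc.castSucc l.castSucc.castSucc a b *
        (A a b - overlapCov P p q N k'.castSucc.castSucc l'.castSucc.castSucc a b))|
        ≤ ∑ _a : Fin 6, ∑ _b : Fin 6, (5 : ℝ) * 5 * (2 * (P.S : ℝ) ^ 2 * (P.S : ℝ) ^ 2 * E) := by
      refine (Finset.abs_sum_le_sum_abs _ _).trans (Finset.sum_le_sum fun a _ =>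
        (Finset.abs_sum_le_sum_abs _ _).trans (Finset.sum_le_sum fun b _ => ?_))
      rw [abs_mul, abs_mul, abs_mul]
      have hu := abs_driftU_le (n := 4) a
      have hv := abs_driftV_le (n := 4) b
      norm_num at hu hv
      gcongr
      · exact abs_cavityCov_le h _ _ _ _
      · exact abs_avg_zero_cavityOverlap_mul_sub_le h hβ hC i _ _ _ _
    calc _ ≤ 1 / 2 * ∑ _a : Fin 6, ∑ _b : Fin 6,
          (5 : ℝ) * 5 * (2 * (P.S : ℝ) ^ 2 * (P.S : ℝ) ^ 2 * E) :=
          mul_le_mul (by linarith) hs (abs_nonneg _) (by norm_num)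
      _ = _ := by simp; ring
  refine (abs_sub_le _ _ _).trans ((add_le_add h1 h3).trans_eq ?_)
  unfold cavityErrorConst
  rw [hE]
  norm_num
  ring

/-- The cavity equation for the covariance of two overlaps. -/
theorem abs_overlapCov_sub_le (k l k' l' : Fin 4) :
    |overlapCov P p q N k l k' l' - 1 / N * cavityCov P p q k l k' l'
      - cavitySum P p q N k l k' l'| ≤ (cavityErrorConst P.S C +
        900 * (P.S : ℝ) ^ 2 * Real.exp (cavityRate P.S 6) *
        (2 * (P.S : ℝ) ^ 4 * C)) * fluctScale N ^ 3 := by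
  have hN : (0 : ℝ) < N := Nat.cast_pos.2 (NeZero.pos N)
  set E1 := cavityErrorConst P.S C * fluctScale N ^ 3 with hE1
  set E2 := 900 * (P.S : ℝ) ^ 2 * Real.exp (cavityRate P.S 6) *
        (2 * (P.S : ℝ) ^ 4 * C) * fluctScale N with hE2
  set U : Fin N → ℝ := fun i => modelAvg P fun σ : Fin 4 → Config N P.S =>
      (spinProduct i σ k l - rsParam p q k l) * cavityOverlap p q i σ k' l' with hU
  set W : Fin N → ℝ := fun i => modelAvg P fun σ : Fin 4 → Config N P.S =>
      (spinProduct i σ k l - rsParam p q k l) * spinProduct i σ k' l' with hW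
  -- The first overlap is expanded over the sites, and in the second one the site is split off: `U`
  -- carries the cavity overlap and `W` the removed spin product.
  have e1 : overlapCov P p q N k l k' l' = 1 / N * ∑ i, (U i + 1 / N * W i) := by
    simp only [hU, hW, ← modelAvg_const_mul, ← modelAvg_add, ← modelAvg_sum]
    unfold overlapCov
    congr 1
    funext σ
    rw [overlap_eq_sum p q σ k l, mul_assoc, Finset.sum_mul]
    congr 1
    refine Finset.sum_congr rfl fun i _ => ?_
    unfold cavityOverlap
    ring
  have e2 : overlapCov P p q N k l k' l' - 1 / N * cavityCov P p q k l k' l'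
      - cavitySum P p q N k l k' l'
      = 1 / N * ∑ i, ((U i - cavitySum P p q N k l k' l')
        + 1 / N * (W i - cavityCov P p q k l k' l')) := by
    rw [e1]
    simp only [Finset.sum_add_distrib, ← Finset.mul_sum, Finset.sum_sub_distrib, Finset.sum_const,
      Finset.card_univ, Fintype.card_fin, nsmul_eq_mul]
    field_simp
    ring
  rw [e2, abs_mul, abs_of_nonneg (by positivity), one_div_mul_eq_div,
    div_le_iff₀' hN]
  calc _ ≤ ∑ _i : Fin N, (E1 + 1 / N * E2) := by
        refine (Finset.abs_sum_le_sum_abs _ _).trans (Finset.sum_le_sum fun i _ => ?_)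
        refine (abs_add_le _ _).trans (add_le_add
          (abs_modelAvg_spinProduct_mul_cavityOverlap_sub_le h hβ hC i k l k' l') ?_)
        rw [abs_mul, abs_of_nonneg (by positivity : (0 : ℝ) ≤ 1 / N)]
        exact mul_le_mul_of_nonneg_left (abs_modelAvg_spinProduct_mul_sub_le h hβ hC i k l k' l')
          (by positivity)
    _ = _ := by
        rw [← fluctScale_sq, hE1, hE2]
        simp only [Finset.sum_const, Finset.card_univ, Fintype.card_fin, nsmul_eq_mul]
        ring

end

end GhatakSherrington

end

noncomputable section

namespace GhatakSherrington

/-! ### Covariances depend on the pattern of coincidences of the replicas -/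

/-- The values of a covariance of two pairs of replicas, according to the coincidences among the
replicas. -/
structure PatternValues where
  same : ℝ
  chain : ℝ
  disjoint : ℝ
  diagMeet : ℝ
  diagApart : ℝ
  diagSame : ℝ
  diagDiag : ℝ

/-- The covariance of the pairs of replicas `(k, l)` and `(a, b)`. -/
def PatternValues.eval {n : ℕ} (v : PatternValues) (k l a b : Fin n) : ℝ :=
  if k = l then
    if a = b then if k = a then v.diagSame else v.diagDiag
    else if k = a ∨ k = b then v.diagMeet else v.diagApart
  else if a = b then if a = k ∨ a = l then v.diagMeet else v.diagApart
  else if (k = a ∧ l = b) ∨ (k = b ∧ l = a) then v.same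
  else if k = a ∨ k = b ∨ l = a ∨ l = b then v.chain else v.disjoint

/-- The sum of the absolute values of the entries. -/
def PatternValues.norm (v : PatternValues) : ℝ :=
  |v.same| + |v.chain| + |v.disjoint| + |v.diagMeet| + |v.diagApart| + |v.diagSame| + |v.diagDiag|

theorem PatternValues.abs_eval_le {n : ℕ} (v : PatternValues) (k l a b : Fin n) :
    |v.eval k l a b| ≤ v.norm := by
  have h1 := abs_nonneg v.same
  have h2 := abs_nonneg v.chain
  have h3 := abs_nonneg v.disjoint
  have h4 := abs_nonneg v.diagMeet
  have h5 := abs_nonneg v.diagApart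
  have h6 := abs_nonneg v.diagSame
  have h7 := abs_nonneg v.diagDiag
  unfold PatternValues.eval PatternValues.norm
  split_ifs <;> linarith

/-- The values of a function of two pairs of replicas among four replicas. -/
def PatternValues.of (T : Fin 4 → Fin 4 → Fin 4 → Fin 4 → ℝ) : PatternValues where
  same := T 0 1 0 1
  chain := T 0 1 0 2
  disjoint := T 0 1 2 3
  diagMeet := T 0 0 0 1
  diagApart := T 0 0 1 2
  diagSame := T 0 0 0 0
  diagDiag := T 0 0 1 1

theorem injective_vec2 {n : ℕ} {x y : Fin n} (h : x ≠ y) : Function.Injective ![x, y] := by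
  intro a b; fin_cases a <;> fin_cases b <;> simp [h, h.symm]

theorem injective_vec3 {n : ℕ} {x y z : Fin n} (h : x ≠ y) (h' : x ≠ z) (h'' : y ≠ z) :
    Function.Injective ![x, y, z] := by
  intro a b; fin_cases a <;> fin_cases b <;> simp [h, h.symm, h', h'.symm, h'', h''.symm]

theorem injective_vec4 {n : ℕ} {x y z w : Fin n} (h1 : x ≠ y) (h2 : x ≠ z) (h3 : x ≠ w)
    (h4 : y ≠ z) (h5 : y ≠ w) (h6 : z ≠ w) : Function.Injective ![x, y, z, w] := by
  intro a b
  fin_cases a <;> fin_cases b <;>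
    simp [h1, h1.symm, h2, h2.symm, h3, h3.symm, h4, h4.symm, h5, h5.symm, h6, h6.symm]

/-- A symmetric function of two pairs of replicas which is invariant under relabelling is given by
its pattern values. -/
theorem eq_eval_of_symmetric (T : ∀ n, Fin n → Fin n → Fin n → Fin n → ℝ)
    (hι : ∀ {m n : ℕ} {ι : Fin m → Fin n}, Function.Injective ι → ∀ k l a b,
      T n (ι k) (ι l) (ι a) (ι b) = T m k l a b)
    (h1 : ∀ n k l a b, T n k l a b = T n l k a b) (h2 : ∀ n k l a b, T n k l a b = T n k l b a)
    (h3 : ∀ n k l a b, T n k l a b = T n a b k l) {n : ℕ} (k l a b : Fin n) :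
    T n k l a b = (PatternValues.of (T 4)).eval k l a b := by
  have d1 : ∀ x : Fin n, T n x x x x = T 4 0 0 0 0 := fun x =>
    (hι (ι := fun _ : Fin 1 => x) (Function.injective_of_subsingleton _) 0 0 0 0).trans
      (hι (ι := fun _ : Fin 1 => (0 : Fin 4)) (Function.injective_of_subsingleton _) 0 0 0 0).symm
  have i2 : Function.Injective ![(0 : Fin 4), 1] := injective_vec2 (by decide)
  have i3 : Function.Injective ![(0 : Fin 4), 1, 2] :=
    injective_vec3 (by decide) (by decide) (by decide)
  have d2 : ∀ x y : Fin n, x ≠ y → T n x x y y = T 4 0 0 1 1 := fun x y h =>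
    (hι (injective_vec2 h) 0 0 1 1).trans (hι i2 0 0 1 1).symm
  have d3 : ∀ x y : Fin n, x ≠ y → T n x x x y = T 4 0 0 0 1 := fun x y h =>
    (hι (injective_vec2 h) 0 0 0 1).trans (hι i2 0 0 0 1).symm
  have d4 : ∀ x y z : Fin n, x ≠ y → x ≠ z → y ≠ z → T n x x y z = T 4 0 0 1 2 :=
    fun x y z h h' h'' =>
      (hι (injective_vec3 h h' h'') 0 0 1 2).trans (hι i3 0 0 1 2).symm
  have d5 : ∀ x y : Fin n, x ≠ y → T n x y x y = T 4 0 1 0 1 := fun x y h =>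
    (hι (injective_vec2 h) 0 1 0 1).trans (hι i2 0 1 0 1).symm
  have d6 : ∀ x y z : Fin n, x ≠ y → x ≠ z → y ≠ z → T n x y x z = T 4 0 1 0 2 :=
    fun x y z h h' h'' =>
      (hι (injective_vec3 h h' h'') 0 1 0 2).trans (hι i3 0 1 0 2).symm
  have d7 : ∀ x y z w : Fin n, x ≠ y → x ≠ z → x ≠ w → y ≠ z → y ≠ w → z ≠ w →
      T n x y z w = T 4 0 1 2 3 := fun x y z w a b c d e f =>
    hι (injective_vec4 a b c d e f) 0 1 2 3
  have meet : ∀ x a b : Fin n, a ≠ b → T n x x a b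
      = if x = a ∨ x = b then T 4 0 0 0 1 else T 4 0 0 1 2 := by
    intro x a b hab
    split_ifs with h
    · rcases h with rfl | rfl
      · exact d3 _ _ hab
      · rw [h2]; exact d3 _ _ hab.symm
    · rw [not_or] at h
      exact d4 _ _ _ h.1 h.2 hab
  unfold PatternValues.eval PatternValues.of
  by_cases hkl : k = l
  · subst hkl
    by_cases hab : a = b
    · subst hab
      by_cases hka : k = a
      · subst hka; simp [d1]
      · simp [hka, d2]
    · simp [hab, meet]
  · by_cases hab : a = b
    · subst hab
      rw [h3, meet _ _ _ hkl]
      simp [hkl]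
    · simp only [hkl, hab, if_false]
      by_cases e1 : k = a
      · subst e1
        by_cases e2 : l = b
        · subst e2; simp [d5 _ _ hkl]
        · simp [e2, hab, d6 _ _ _ hkl hab e2]
      · by_cases e2 : k = b
        · subst e2
          by_cases e3 : l = a
          · subst e3; rw [h2, d5 _ _ hkl]; simp
          · rw [h2, d6 _ _ _ hkl e1 e3]; simp [e1, e3]
        · by_cases e3 : l = a
          · subst e3
            rw [h1, d6 _ _ _ (Ne.symm hkl) hab e2]; simp [e1, e2]
          · by_cases e4 : l = b
            · subst e4
              rw [h1, h2, d6 _ _ _ (Ne.symm hkl) e3 e1]; simp [e1, e2, e3]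
            · rw [d7 _ _ _ _ hkl e1 e2 e3 e4 hab]; simp [e1, e2, e3, e4]

section

variable {P : Params} {p q : ℝ}

theorem overlap_symm {N S n : ℕ} (σ : Fin n → Config N S) (k l : Fin n) :
    overlap p q σ k l = overlap p q σ l k := by
  simp only [overlap, spinProduct, rsParam, mul_comm (σ k _).val, eq_comm (a := k)]

/-- The pattern values of the covariances of the overlaps. -/
def overlapPattern (P : Params) (p q : ℝ) (N : ℕ) : PatternValues :=
  PatternValues.of (overlapCov P p q N)

theorem overlapCov_eq_eval {N : ℕ} [NeZero N] {n : ℕ} (k l a b : Fin n) :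
    overlapCov P p q N k l a b = (overlapPattern P p q N).eval k l a b := by
  refine eq_eval_of_symmetric (fun n => overlapCov P p q N (n := n)) ?_ ?_ ?_ ?_ k l a b
  · intro m n ι hι k l a b
    unfold overlapCov
    simp only [← overlap_comp p q hι]
    exact modelAvg_comp_injective P hι fun σ => overlap p q σ k l * overlap p q σ a b
  · intro n k l a b
    simp only [overlapCov, overlap_symm _ k l]
  · intro n k l a b
    simp only [overlapCov, overlap_symm _ a b]
  · intro n k l a b
    simp only [overlapCov, mul_comm (overlap p q _ k l)]

/-- The pattern values of the covariances of the cavity spins. -/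
def cavityPattern (P : Params) (p q : ℝ) : PatternValues := PatternValues.of (cavityCov P p q)

variable (h : IsReplicaSymmetric P p q)

include h

/-- The equations for p and q make centering one factor the same as centering both. Hence the
symmetry in the two pairs, which also gives K_3 = I_5. -/
theorem cavityCov_eq {n : ℕ} (k l a b : Fin n) :
    cavityCov P p q k l a b
      = (nu0 P p q fun ε : Fin n → ℝ => ε k * ε l * (ε a * ε b))
        - rsParam p q k l * rsParam p q a b := by
  unfold cavityCov
  simp_rw [sub_mul]
  rw [nu0_sub h.nonneg, nu0_const_mul h.nonneg, h.nu0_mul a b]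

theorem cavityCov_eq_eval {n : ℕ} (k l a b : Fin n) :
    cavityCov P p q k l a b = (cavityPattern P p q).eval k l a b := by
  refine eq_eval_of_symmetric (fun n => cavityCov P p q (n := n)) ?_ ?_ ?_ ?_ k l a b
  · intro m n ι hι k l a b
    unfold cavityCov
    simp only [rsParam_comp p q hι]
    exact nu0_comp_injective P p q hι fun ε => (ε k * ε l - rsParam p q k l) * (ε a * ε b)
  · intro n k l a b
    simp only [cavityCov, rsParam, mul_comm (_ : ℝ) _, eq_comm (a := k)]
  · intro n k l a b
    simp only [cavityCov, mul_comm (_ : ℝ) _]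
  · intro n k l a b
    rw [cavityCov_eq h, cavityCov_eq h, mul_comm (rsParam p q k l)]
    simp only [mul_comm (_ * _ : ℝ) (_ * _ : ℝ)]

end

/-- The linear map of the cavity equations: `z` holds the covariances of the cavity spins. -/
def cavityLinear (z v : PatternValues) (k l k' l' : Fin 4) : ℝ :=
  ∑ a : Fin 6, ∑ b : Fin 6, driftU 4 a * driftV 4 b *
    (z.eval k.castSucc.castSucc l.castSucc.castSucc a b *
      v.eval k'.castSucc.castSucc l'.castSucc.castSucc a b)

end GhatakSherrington

end

noncomputable section

namespace GhatakSherrington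

/-! ### Solution of the cavity equations -/

/-- With four replicas the signs are (1, 1, 1, 1, -4, 0) and (1, 1, 1, 1, 1, -5). -/
theorem sum_drift_four (x : Fin 6 → Fin 6 → ℝ) :
    ∑ a : Fin 6, ∑ b : Fin 6, driftU 4 a * driftV 4 b * x a b
      = (∑ a : Fin 4, (∑ b : Fin 5, x a.castSucc.castSucc b.castSucc - 5 * x a.castSucc.castSucc 5))
        - 4 * (∑ b : Fin 5, x 4 b.castSucc - 5 * x 4 5) := by
  simp_rw [mul_assoc, ← Finset.mul_sum, sum_driftV_mul]
  rw [sum_driftU_mul]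
  norm_num
  rfl

/-- The pattern values `v` solve the cavity equations with coefficients `z` and parameters `b`
(the square of the inverse temperature) and `N`. -/
def SolvesCavity (b N : ℝ) (z v : PatternValues) (k l k' l' : Fin 4) : Prop :=
  v.eval k l k' l' = 1 / N * z.eval k l k' l' + b / 2 * cavityLinear z v k l k' l'

set_option maxHeartbeats 4000000 in
-- Decomposing R_12 = T_12 + T_1 + T_2 + T and R_11 = S_1 + S, with the components belonging to
-- different replicas uncorrelated, suggests the entries of `v`; `z` has the corresponding form.
-- Each of the seven equations is then a rational identity in the constants, once denominators are
-- cleared and M, M1, M2, M3 are expanded.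
theorem solvesCavity_of_eq {b F G E D I3 I K4 N A2 A1 B1 C1 A0 B0 C0 M1 M2 M3 M : ℝ} (hN : N ≠ 0)
    (hM : M ≠ 0) (hM3 : M3 ≠ 0)
    (e1 : M1 = 1 - b * (F - 3 * G)) (e2 : M2 = 1 - b / 2 * D) (e3 : M3 = 1 - b * (F - G))
    (e4 : M = M1 * M2 + b ^ 2 * E ^ 2)
    (hA2 : A2 = (F - G) / (N * M3))
    (hA1 : A1 = (G * M2 + b / 2 * E ^ 2) / M * (1 / (N * M3)))
    (hB1 : B1 = (D * M1 - 2 * b * E ^ 2) / (N * M)) (hC1 : C1 = E / (N * M))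
    (hA0 : A0 = b / M * (b * E * K4 + M2 * I) * C1
      + 2 * (b / M) * (b * E * (E - I) + M2 * (2 * G - I3)) * A1
      + b / M * (b * E * I + M2 * I3) * A2 + 1 / (M * N) * (b * E * I + M2 * I3))
    (hB0 : B0 = b / (2 * M) * (M1 * K4 - b * E * I) * B1
      + b / M * (M1 * (E - I) - E * b * (2 * G - I3)) * C1 + 1 / (M * N) * (M1 * K4 - b * E * I))
    (hC0 : C0 = b / M * (1 / 2 * M2 * I + 1 / 2 * b * E * K4) * B1
      + b / M * (M2 * (2 * G - I3) + b * E * (E - I)) * C1 + 1 / (M * N) * (M2 * I + b * E * K4)) :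
    let z : PatternValues := ⟨F + G + I3, G + I3, I3, E + I, I, D + K4, K4⟩
    let v : PatternValues := ⟨A2 + 2 * A1 + A0, A1 + A0, A0, C1 + C0, C0, B1 + B0, B0⟩
    SolvesCavity b N z v 0 1 0 1 ∧ SolvesCavity b N z v 0 1 0 2 ∧ SolvesCavity b N z v 0 1 2 3 ∧
    SolvesCavity b N z v 0 0 0 1 ∧ SolvesCavity b N z v 0 0 1 2 ∧ SolvesCavity b N z v 0 0 0 0 ∧
    SolvesCavity b N z v 0 0 1 1 := by
  intro z v
  simp only [SolvesCavity, cavityLinear, sum_drift_four, Fin.sum_univ_four, Fin.sum_univ_five,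
    Fin.reduceCastSucc, PatternValues.eval, Fin.reduceEq, ↓reduceIte, or_true, true_or, or_false,
    false_or, and_true, and_false, or_self, and_self, z, v]
  simp only [hA0, hC0, hB0, hA2, hA1, hB1, hC1]
  refine ⟨?_, ?_, ?_, ?_, ?_, ?_, ?_⟩ <;> (field_simp; subst e4 e1 e2 e3; ring)

section

variable (P : Params) (p q : ℝ)

/-- The leading terms of the covariances of the overlaps. -/
def leadingPattern (N : ℕ) : PatternValues where
  same := A2sq P p q N + 2 * A1sq P p q N + A0sq P p q N
  chain := A1sq P p q N + A0sq P p q N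
  disjoint := A0sq P p q N
  diagMeet := C1sq P p q N + C0 P p q N
  diagApart := C0 P p q N
  diagSame := B1sq P p q N + B0sq P p q N
  diagDiag := B0sq P p q N

variable {P p q} (h : IsReplicaSymmetric P p q)

include h

/-- The constants F, G, E and the diagonal one are differences of uncentered fourth moments. When
the products of the centerings agree these are differences of covariances, hence of pattern values.
-/
theorem nu0_eq_of_cavityCov {n : ℕ} {φ : (Fin n → ℝ) → ℝ} (k l a b k' l' a' b' : Fin n)
    (hr : rsParam p q k l * rsParam p q a b = rsParam p q k' l' * rsParam p q a' b')
    (hφ : ∀ ε, φ ε = ε k * ε l * (ε a * ε b) - ε k' * ε l' * (ε a' * ε b')) :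
    nu0 P p q φ = (cavityPattern P p q).eval k l a b - (cavityPattern P p q).eval k' l' a' b' := by
  rw [← cavityCov_eq_eval h, ← cavityCov_eq_eval h, cavityCov_eq h, cavityCov_eq h, hr,
    show φ = fun ε => ε k * ε l * (ε a * ε b) - ε k' * ε l' * (ε a' * ε b') from funext hφ,
    nu0_sub h.nonneg]
  ring

theorem constF_eq : constF P p q = (cavityPattern P p q).same - (cavityPattern P p q).chain :=
  nu0_eq_of_cavityCov h 0 2 0 2 1 2 0 2 rfl fun ε => by ring

theorem constG_eq : constG P p q = (cavityPattern P p q).chain - (cavityPattern P p q).disjoint :=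
  nu0_eq_of_cavityCov h 0 2 0 3 1 2 0 3 rfl fun ε => by ring

theorem constE_eq : constE P p q = (cavityPattern P p q).diagMeet - (cavityPattern P p q).diagApart :=
  nu0_eq_of_cavityCov h 0 0 0 2 1 1 0 2 rfl fun ε => by ring

theorem constD_eq : constD P p q = (cavityPattern P p q).diagSame - (cavityPattern P p q).diagDiag :=
  nu0_eq_of_cavityCov h 0 0 0 0 1 1 0 0 rfl fun ε => by ring

theorem constA_eq : constA P p q = constF P p q - constG P p q := by
  have a1 := nu0_eq_of_cavityCov h (φ := fun ε : Fin 4 → ℝ =>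
    ε 0 * ε 1 * (ε 0 * ε 1) - ε 0 * ε 3 * (ε 0 * ε 1)) 0 1 0 1 0 3 0 1 rfl fun ε => rfl
  have a2 := nu0_eq_of_cavityCov h (φ := fun ε : Fin 4 → ℝ =>
    ε 2 * ε 1 * (ε 0 * ε 1) - ε 2 * ε 3 * (ε 0 * ε 1)) 2 1 0 1 2 3 0 1 rfl fun ε => rfl
  calc constA P p q
      = nu0 P p q fun ε : Fin 4 → ℝ => (ε 0 * ε 1 * (ε 0 * ε 1) - ε 0 * ε 3 * (ε 0 * ε 1))
        - (ε 2 * ε 1 * (ε 0 * ε 1) - ε 2 * ε 3 * (ε 0 * ε 1)) := by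
        unfold constA
        congr 1
        funext ε
        ring
    _ = _ := nu0_sub h.nonneg _ _
    _ = _ := by
        rw [a1, a2, constF_eq h, constG_eq h]
        rfl

theorem constI5_eq : constI5 P p q = (cavityPattern P p q).diagApart :=
  cavityCov_eq_eval h (0 : Fin 4) 1 2 2

theorem cavityPattern_eq : cavityPattern P p q
    = ⟨constF P p q + constG P p q + constI3 P p q, constG P p q + constI3 P p q, constI3 P p q,
      constE P p q + constI5 P p q, constI5 P p q, constD P p q + constK4 P p q, constK4 P p q⟩ := by
  have e3 : constI3 P p q = (cavityPattern P p q).disjoint := rfl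
  have e4 : constK4 P p q = (cavityPattern P p q).diagDiag := rfl
  rw [constF_eq h, constG_eq h, constE_eq h, constD_eq h, constI5_eq h, e3, e4]
  generalize cavityPattern P p q = z
  cases z
  simp

theorem constK3_eq : constK3 P p q = constI5 P p q := (constI5_eq h).symm

theorem abs_cavityPattern_eval_le {n : ℕ} (k l a b : Fin n) :
    |(cavityPattern P p q).eval k l a b| ≤ 2 * (P.S : ℝ) ^ 4 := by
  rw [← cavityCov_eq_eval h]
  exact (abs_cavityCov_le h k l a b).trans_eq (by ring)

theorem leadingPattern_solvesCavity {N : ℕ} (hN : (N : ℝ) ≠ 0) (hM : constM P p q ≠ 0)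
    (hM3 : constM3 P p q ≠ 0) {k l k' l' : Fin 4}
    (hk : (k, l, k', l') ∈ ({(0, 1, 0, 1), (0, 1, 0, 2), (0, 1, 2, 3), (0, 0, 0, 1), (0, 0, 1, 2),
      (0, 0, 0, 0), (0, 0, 1, 1)} : Finset (Fin 4 × Fin 4 × Fin 4 × Fin 4))) :
    SolvesCavity (P.β ^ 2) N (cavityPattern P p q) (leadingPattern P p q N) k l k' l' := by
  have hK := constK3_eq h
  have key := solvesCavity_of_eq (b := P.β ^ 2) (F := constF P p q) (G := constG P p q)
    (E := constE P p q) (D := constD P p q) (I3 := constI3 P p q) (I := constI5 P p q)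
    (K4 := constK4 P p q) (N := N) (A2 := A2sq P p q N) (A1 := A1sq P p q N) (B1 := B1sq P p q N)
    (C1 := C1sq P p q N) (A0 := A0sq P p q N) (B0 := B0sq P p q N) (C0 := C0 P p q N)
    (M1 := constM1 P p q) (M2 := constM2 P p q) (M3 := constM3 P p q) (M := constM P p q)
    hN hM hM3 rfl rfl rfl (by rw [constM]; ring)
    (by rw [A2sq, constA_eq h, constM3]) rfl rfl rfl (by simp only [A0sq, hK])
    (by simp only [B0sq, hK]) (by simp only [C0, hK])
  rw [cavityPattern_eq h]
  obtain ⟨k1, k2, k3, k4, k5, k6, k7⟩ := key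
  simp only [Finset.mem_insert, Finset.mem_singleton, Prod.mk.injEq] at hk
  rcases hk with ⟨rfl, rfl, rfl, rfl⟩ | ⟨rfl, rfl, rfl, rfl⟩ | ⟨rfl, rfl, rfl, rfl⟩ |
    ⟨rfl, rfl, rfl, rfl⟩ | ⟨rfl, rfl, rfl, rfl⟩ | ⟨rfl, rfl, rfl, rfl⟩ | ⟨rfl, rfl, rfl, rfl⟩
  exacts [k1, k2, k3, k4, k5, k6, k7]

end

/-- Entrywise difference. -/
def PatternValues.sub (v w : PatternValues) : PatternValues where
  same := v.same - w.same
  chain := v.chain - w.chain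
  disjoint := v.disjoint - w.disjoint
  diagMeet := v.diagMeet - w.diagMeet
  diagApart := v.diagApart - w.diagApart
  diagSame := v.diagSame - w.diagSame
  diagDiag := v.diagDiag - w.diagDiag

theorem PatternValues.eval_sub {n : ℕ} (v w : PatternValues) (k l a b : Fin n) :
    (v.sub w).eval k l a b = v.eval k l a b - w.eval k l a b := by
  unfold PatternValues.eval PatternValues.sub
  split_ifs <;> rfl

theorem cavityLinear_sub (z v w : PatternValues) (k l k' l' : Fin 4) :
    cavityLinear z (v.sub w) k l k' l' = cavityLinear z v k l k' l' - cavityLinear z w k l k' l' := by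
  unfold cavityLinear
  simp only [PatternValues.eval_sub, mul_sub, Finset.sum_sub_distrib]

theorem abs_cavityLinear_le {z : PatternValues} {B : ℝ}
    (hz : ∀ k l a b : Fin 6, |z.eval k l a b| ≤ B) (v : PatternValues) (k l k' l' : Fin 4) :
    |cavityLinear z v k l k' l'| ≤ 900 * B * v.norm := by
  have hB : 0 ≤ B := (abs_nonneg _).trans (hz 0 0 0 0)
  unfold cavityLinear
  calc _ ≤ ∑ _a : Fin 6, ∑ _b : Fin 6, (5 : ℝ) * 5 * (B * v.norm) := by
        refine (Finset.abs_sum_le_sum_abs _ _).trans (Finset.sum_le_sum fun a _ =>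
          (Finset.abs_sum_le_sum_abs _ _).trans (Finset.sum_le_sum fun b _ => ?_))
        rw [abs_mul, abs_mul, abs_mul]
        have hu := abs_driftU_le (n := 4) a
        have hv := abs_driftV_le (n := 4) b
        norm_num at hu hv
        gcongr
        · exact hz _ _ _ _
        · exact v.abs_eval_le _ _ _ _
    _ = _ := by simp; ring

/-- The covariances of the overlaps are close to their leading terms. -/
theorem norm_overlapPattern_sub_le {P : Params} {p q C : ℝ} (h : IsReplicaSymmetric P p q)
    (hβ : P.β ^ 2 ≤ 1) (hsmall : 12600 * (P.β ^ 2 * (P.S : ℝ) ^ 4) ≤ 1)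
    (hC : HasFluctuationBound P p q C) (hM : constM P p q ≠ 0) (hM3 : constM3 P p q ≠ 0)
    {N : ℕ} [NeZero N] :
    ((overlapPattern P p q N).sub (leadingPattern P p q N)).norm
      ≤ 14 * ((cavityErrorConst P.S C +
        900 * (P.S : ℝ) ^ 2 * Real.exp (cavityRate P.S 6) *
        (2 * (P.S : ℝ) ^ 4 * C)) * fluctScale N ^ 3) := by
  have hN : (N : ℝ) ≠ 0 := Nat.cast_ne_zero.2 (NeZero.ne N)
  set δ := (overlapPattern P p q N).sub (leadingPattern P p q N) with hδ
  set K := (cavityErrorConst P.S C +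
        900 * (P.S : ℝ) ^ 2 * Real.exp (cavityRate P.S 6) *
        (2 * (P.S : ℝ) ^ 4 * C)) * fluctScale N ^ 3 with hK
  have hn : 0 ≤ δ.norm := by unfold PatternValues.norm; positivity
  have main : ∀ k l k' l' : Fin 4, (k, l, k', l') ∈ ({(0, 1, 0, 1), (0, 1, 0, 2), (0, 1, 2, 3),
      (0, 0, 0, 1), (0, 0, 1, 2), (0, 0, 0, 0), (0, 0, 1, 1)} :
      Finset (Fin 4 × Fin 4 × Fin 4 × Fin 4)) → |δ.eval k l k' l'| ≤ K + 1 / 14 * δ.norm := by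
    intro k l k' l' hk
    have h1 := abs_overlapCov_sub_le h hβ hC (N := N) k l k' l'
    have h2 := leadingPattern_solvesCavity h hN hM hM3 hk
    have e : cavitySum P p q N k l k' l'
        = P.β ^ 2 / 2 * cavityLinear (cavityPattern P p q) (overlapPattern P p q N) k l k' l' := by
      unfold cavitySum cavityLinear
      simp only [overlapCov_eq_eval, cavityCov_eq_eval h]
    rw [e, overlapCov_eq_eval, cavityCov_eq_eval h] at h1
    unfold SolvesCavity at h2
    have h3 := abs_cavityLinear_le (fun k l a b => abs_cavityPattern_eval_le h k l a b) δ k l k' l'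
    have h4 : |P.β ^ 2 / 2 * cavityLinear (cavityPattern P p q) δ k l k' l'|
        ≤ 1 / 14 * δ.norm := by
      rw [abs_mul, abs_of_nonneg (by positivity)]
      calc _ ≤ P.β ^ 2 / 2 * (900 * (2 * (P.S : ℝ) ^ 4) * δ.norm) := by gcongr
        _ = 1 / 14 * (12600 * (P.β ^ 2 * (P.S : ℝ) ^ 4) * δ.norm) := by ring
        _ ≤ 1 / 14 * (1 * δ.norm) := by gcongr
        _ = _ := by ring
    -- The leading pattern solves the linear equations without error. The discrepancy δ therefore
    -- solves them up to the error of the true covariances.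
    have e2 : δ.eval k l k' l' = ((overlapPattern P p q N).eval k l k' l'
        - 1 / N * (cavityPattern P p q).eval k l k' l' - P.β ^ 2 / 2 *
          cavityLinear (cavityPattern P p q) (overlapPattern P p q N) k l k' l')
        + P.β ^ 2 / 2 * cavityLinear (cavityPattern P p q) δ k l k' l' := by
      rw [hδ, PatternValues.eval_sub, cavityLinear_sub, h2]
      ring
    rw [e2]
    exact (abs_add_le _ _).trans (add_le_add h1 h4)
  have m1 : |δ.same| ≤ _ := main 0 1 0 1 (by decide)
  have m2 : |δ.chain| ≤ _ := main 0 1 0 2 (by decide)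
  have m3 : |δ.disjoint| ≤ _ := main 0 1 2 3 (by decide)
  have m4 : |δ.diagMeet| ≤ _ := main 0 0 0 1 (by decide)
  have m5 : |δ.diagApart| ≤ _ := main 0 0 1 2 (by decide)
  have m6 : |δ.diagSame| ≤ _ := main 0 0 0 0 (by decide)
  have m7 : |δ.diagDiag| ≤ _ := main 0 0 1 1 (by decide)
  -- The constant 12600 = 14 · 900 makes the linear map contribute at most 1/14 of the norm to each
  -- of the seven entries. In total this is half the norm, which is absorbed and leaves the factor
  -- 14.
  have : δ.norm ≤ 7 * (K + 1 / 14 * δ.norm) := by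
    conv_lhs => unfold PatternValues.norm
    linarith
  linarith

/-! ### The basis components -/

section Basis

variable {C : Type*} [Fintype C]

/-- Disjoint groups of replicas are independent for fixed disorder, so products of Gibbs averages
are Gibbs averages over more replicas. -/
theorem gibbsAvg_append {m n : ℕ} (H : C → ℝ) (f : (Fin m → C) → ℝ) (g : (Fin n → C) → ℝ) :
    gibbsAvg H (fun σ : Fin (m + n) → C =>
      f (fun k => σ (Fin.castAdd n k)) * g (fun k => σ (Fin.natAdd m k)))
      = gibbsAvg H f * gibbsAvg H g := by
  unfold gibbsAvg
  rw [Finset.sum_mul_sum, ← Fintype.sum_prod_type', ← Equiv.sum_comp (Fin.appendEquiv m n)]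
  refine Finset.sum_congr rfl fun x _ => ?_
  simp only [Fin.appendEquiv, Equiv.coe_fn_mk, Fin.prod_univ_add, Fin.append_left,
    Fin.append_right]
  ring

theorem gibbsAvg_affine {n : ℕ} {I : Type*} [Fintype I] [Nonempty C] (H : C → ℝ) (a c : ℝ)
    (f : I → (Fin n → C) → ℝ) :
    gibbsAvg H (fun σ => a * ∑ i, f i σ - c) = a * ∑ i, gibbsAvg H (f i) - c := by
  unfold gibbsAvg
  simp only [mul_sub, Finset.sum_sub_distrib, ← Finset.sum_mul, sum_prod_gibbsProb, one_mul]
  congr 1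
  rw [Finset.sum_comm, Finset.mul_sum]
  refine Finset.sum_congr rfl fun σ _ => ?_
  rw [← Finset.mul_sum]
  ring

variable (P : Params) {p q : ℝ} {N : ℕ}

theorem basisT_eq (g : Disorder N) :
    basisT P q g = gibbsAvg (hamiltonian P g)
      fun σ : Fin 2 → Config N P.S => overlap p q σ 0 1 := by
  have h : ∀ i, siteMean P g i ^ 2 = gibbsAvg (hamiltonian P g)
      fun σ : Fin 2 → Config N P.S => spinProduct i σ 0 1 := fun i => by
    rw [sq]
    exact (gibbsAvg_append (hamiltonian P g) (fun σ : Fin 1 → Config N P.S => (σ 0 i).val)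
      fun σ : Fin 1 → Config N P.S => (σ 0 i).val).symm
  unfold basisT
  simp_rw [h]
  exact (gibbsAvg_affine _ _ _ _).symm

theorem basisS_eq (g : Disorder N) :
    basisS P p g = gibbsAvg (hamiltonian P g)
      fun σ : Fin 1 → Config N P.S => overlap p q σ 0 0 := by
  have h : ∀ i, siteSecondMoment P g i = gibbsAvg (hamiltonian P g)
      fun σ : Fin 1 → Config N P.S => spinProduct i σ 0 0 := fun i => by
    simp only [spinProduct, ← sq]
    rfl
  unfold basisS
  simp_rw [h]
  exact (gibbsAvg_affine _ _ _ _).symm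

theorem gibbs_const (g : Disorder N) (a : ℝ) :
    gibbs P g (fun _ : Fin 1 → Config N P.S => a) = a := by
  change gibbsAvg (hamiltonian P g) (fun _ : Fin 1 → Config N P.S => a) = a
  unfold gibbsAvg
  rw [← Finset.sum_mul, sum_prod_gibbsProb, one_mul]

/-- T² is ⟨R_12⟩⟨R_34⟩ for fixed disorder, the average of a product over two disjoint pairs. -/
theorem nu_basisT_sq [NeZero N] :
    nu P (fun (g : Disorder N) (_ : Fin 1 → Config N P.S) => basisT P q g ^ 2)
      = (overlapPattern P p q N).disjoint := by
  change _ = overlapCov P p q N (0 : Fin 4) 1 2 3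
  unfold overlapCov modelAvg nu
  congr 1
  funext g
  rw [gibbs_const, sq, basisT_eq P (p := p)]
  refine (gibbsAvg_append (m := 2) (n := 2) _ _ _).symm.trans ?_
  have h1 : Function.Injective (Fin.castAdd 2 : Fin 2 → Fin 4) := Fin.castAdd_injective 2 2
  have h2 : Function.Injective (Fin.natAdd 2 : Fin 2 → Fin 4) := Fin.natAdd_injective 2 2
  simp only [overlap_comp p q h1, overlap_comp p q h2]
  rfl

theorem nu_basisS_sq [NeZero N] :
    nu P (fun (g : Disorder N) (_ : Fin 1 → Config N P.S) => basisS P p g ^ 2)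
      = (overlapPattern P p q N).diagDiag := by
  have e : (overlapPattern P p q N).diagDiag = overlapCov P p q N (0 : Fin 2) 0 1 1 :=
    (overlapCov_eq_eval (0 : Fin 2) 0 1 1).symm
  rw [e]
  unfold overlapCov modelAvg nu
  congr 1
  funext g
  rw [gibbs_const, sq, basisS_eq P (q := q)]
  refine (gibbsAvg_append (m := 1) (n := 1) _ _ _).symm.trans ?_
  have h1 : Function.Injective (Fin.castAdd 1 : Fin 1 → Fin 2) := Fin.castAdd_injective 1 1
  have h2 : Function.Injective (Fin.natAdd 1 : Fin 1 → Fin 2) := Fin.natAdd_injective 1 1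
  simp only [overlap_comp p q h1, overlap_comp p q h2]
  rfl

theorem nu_basisS_mul_basisT [NeZero N] :
    nu P (fun (g : Disorder N) (_ : Fin 1 → Config N P.S) => basisS P p g * basisT P q g)
      = (overlapPattern P p q N).diagApart := by
  have e : (overlapPattern P p q N).diagApart = overlapCov P p q N (0 : Fin 3) 0 1 2 :=
    (overlapCov_eq_eval (0 : Fin 3) 0 1 2).symm
  rw [e]
  unfold overlapCov modelAvg nu
  congr 1
  funext g
  rw [gibbs_const, basisS_eq P (q := q), basisT_eq P (p := p)]
  refine (gibbsAvg_append (m := 1) (n := 2) _ _ _).symm.trans ?_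
  have h1 : Function.Injective (Fin.castAdd 2 : Fin 1 → Fin 3) := Fin.castAdd_injective 1 2
  have h2 : Function.Injective (Fin.natAdd 1 : Fin 2 → Fin 3) := Fin.natAdd_injective 2 1
  simp only [overlap_comp p q h1, overlap_comp p q h2]
  rfl

end Basis

/-- The denominators of the leading terms are positive at high temperature. -/
theorem const_pos {P : Params} {p q : ℝ} (h : IsReplicaSymmetric P p q)
    (hsmall : 12600 * (P.β ^ 2 * (P.S : ℝ) ^ 4) ≤ 1) :
    0 < constM1 P p q ∧ 0 < constM2 P p q ∧ 0 < constM3 P p q ∧ 0 < constM P p q := by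
  have hz := fun k l a b : Fin 4 => abs_cavityPattern_eval_le h k l a b
  have z1 : |(cavityPattern P p q).same| ≤ _ := hz 0 1 0 1
  have z2 : |(cavityPattern P p q).chain| ≤ _ := hz 0 1 0 2
  have z3 : |(cavityPattern P p q).disjoint| ≤ _ := hz 0 1 2 3
  have z8 : |(cavityPattern P p q).diagSame| ≤ _ := hz 0 0 0 0
  have z9 : |(cavityPattern P p q).diagDiag| ≤ _ := hz 0 0 1 1
  have hF := constF_eq h
  have hG := constG_eq h
  have hD := constD_eq h
  have hb := sq_nonneg P.β
  rw [abs_le] at z1 z2 z3 z8 z9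
  -- Each pattern value is at most 2 S⁴ in size, so F, G and the diagonal constant are at most 4 S⁴,
  -- and F - G, which combines four pattern values, is at most 8 S⁴.
  have k1 : P.β ^ 2 * (constF P p q - 3 * constG P p q) ≤ P.β ^ 2 * (16 * (P.S : ℝ) ^ 4) :=
    mul_le_mul_of_nonneg_left (by linarith) hb
  have k2 : P.β ^ 2 * constD P p q ≤ P.β ^ 2 * (4 * (P.S : ℝ) ^ 4) :=
    mul_le_mul_of_nonneg_left (by linarith) hb
  have k3 : P.β ^ 2 * (constF P p q - constG P p q) ≤ P.β ^ 2 * (8 * (P.S : ℝ) ^ 4) :=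
    mul_le_mul_of_nonneg_left (by linarith) hb
  have m1 : 0 < constM1 P p q := by unfold constM1; linarith
  have m2 : 0 < constM2 P p q := by unfold constM2; linarith
  have m3 : 0 < constM3 P p q := by unfold constM3; linarith
  refine ⟨m1, m2, m3, ?_⟩
  unfold constM
  have : 0 < constM1 P p q * constM2 P p q := mul_pos m1 m2
  positivity

end GhatakSherrington

end

/-! ### Choice of the temperature threshold and conclusion -/

open GhatakSherrington in
theorem mainTheorem7 (S : ℕ) (hS : 1 ≤ S) :
    ∃ β' : ℝ, 0 < β' ∧ ∀ P : Params, P.S = S → 0 ≤ P.β → P.β < β' → 0 ≤ P.h →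
      ∃ p q : ℝ, IsReplicaSymmetric P p q ∧
        (∀ p' q' : ℝ, IsReplicaSymmetric P p' q' → p' = p ∧ q' = q) ∧
        0 < constM1 P p q ∧ 0 < constM2 P p q ∧ 0 < constM3 P p q ∧ 0 < constM P p q ∧
        ∃ K : ℝ, ∀ N : ℕ, 1 ≤ N →
          |nu P (fun (g : Disorder N) (_ : Fin 1 → Config N P.S) => basisT P q g ^ 2)
              - A0sq P p q N| ≤ K * (N : ℝ) ^ (-(3 / 2) : ℝ) ∧
          |nu P (fun (g : Disorder N) (_ : Fin 1 → Config N P.S) => basisS P p g ^ 2)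
              - B0sq P p q N| ≤ K * (N : ℝ) ^ (-(3 / 2) : ℝ) ∧
          |nu P (fun (g : Disorder N) (_ : Fin 1 → Config N P.S) => basisS P p g * basisT P q g)
              - C0 P p q N| ≤ K * (N : ℝ) ^ (-(3 / 2) : ℝ) := by
  have hR : 0 ≤ momentRate S := by unfold momentRate; positivity
  -- The threshold is at most 1, so β² ≤ β and 4 β² `momentRate` ≤ 1. As `momentRate` is at least
  -- 36864 S⁴, the conditions with 12600 and 336 follow from this one.
  refine ⟨1 / (4 * momentRate S + 1), by positivity, fun P hPS hβ0 hβ _ => ?_⟩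
  rw [← hPS] at hβ hR
  have hb1 : P.β ≤ 1 := hβ.le.trans ((div_le_one (by linarith)).2 (by linarith))
  have hβ2 : P.β ^ 2 ≤ P.β := by nlinarith
  have hsm : 4 * (P.β ^ 2 * momentRate P.S) ≤ 1 := by
    have := (lt_div_iff₀ (by linarith : 0 < 4 * momentRate P.S + 1)).1 hβ
    nlinarith [mul_le_mul_of_nonneg_right hβ2 hR]
  have hmr : 36864 * (P.S : ℝ) ^ 4 ≤ momentRate P.S := by
    unfold momentRate
    exact le_mul_of_one_le_right (by positivity)
      (Real.one_le_exp (by unfold cavityRate; positivity))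
  have hsm' := mul_le_mul_of_nonneg_left hmr (sq_nonneg P.β)
  have hx : 0 ≤ P.β ^ 2 * (P.S : ℝ) ^ 4 := by positivity
  have hβ1 : P.β ^ 2 ≤ 1 := hβ2.trans hb1
  have hs : 12600 * (P.β ^ 2 * (P.S : ℝ) ^ 4) ≤ 1 := by linarith
  obtain ⟨p, q, hrs, huniq⟩ := existsUnique_isReplicaSymmetric P (by linarith)
  obtain ⟨m1, m2, m3, m⟩ := const_pos hrs hs
  obtain ⟨C, _, hC⟩ := exists_modelAvg_abs_pow_le hrs hβ1 hsm
  refine ⟨p, q, hrs, huniq, m1, m2, m3, m, 14 * (cavityErrorConst P.S C +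
    900 * (P.S : ℝ) ^ 2 * Real.exp (cavityRate P.S 6) * (2 * (P.S : ℝ) ^ 4 * C)), fun N hN => ?_⟩
  have : NeZero N := ⟨by omega⟩
  have key := norm_overlapPattern_sub_le hrs hβ1 hs hC m.ne' m3.ne' (N := N)
  rw [← mul_assoc, fluctScale_cube] at key
  rw [nu_basisT_sq P (p := p), nu_basisS_sq P (q := q), nu_basisS_mul_basisT P]
  set δ := (overlapPattern P p q N).sub (leadingPattern P p q N) with hδ
  have k1 : |δ.disjoint| ≤ δ.norm := δ.abs_eval_le (0 : Fin 4) 1 2 3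
  have k2 : |δ.diagDiag| ≤ δ.norm := δ.abs_eval_le (0 : Fin 4) 0 1 1
  have k3 : |δ.diagApart| ≤ δ.norm := δ.abs_eval_le (0 : Fin 4) 0 1 2
  exact ⟨k1.trans key, k2.trans key, k3.trans key⟩
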